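/- Let $(\Omega,\mathcal F,P)$ be a probability space and let $G=\{G(x),x\in\mathbb R\}$ be a (jointly measurable) mean zero Gaussian process with stationary increments. Put $$\sigma^2(h)=E(G(h)-G(0))^2,\qquad \rho_h(x-y)=\frac{1}{\sigma^2(h)}E\big[(G(x+h)-G(x))(G(y+h)-G(y))\big].$$ Fix $-\infty<a<b<\infty$, let $\mu$ be the standard Gaussian measure on $\mathbb R$, let $\eta$ be a standard normal random variable, and for $f\in L^2(\mathbb R,\mu)$ let $$I_G(f,h;a,b)=\int_a^b f\Big(\frac{G(x+h)-G(x)}{\sigma(h)}\Big)\,dx .$$ Let $\{H_m\}_{m\ge 0}$ be the Hermite polynomials normalized to be an orthonormal basis of $L^2(\mathbb R,\mu)$. Let $f\in L^2(\mathbb R,\mu)$ be symmetric ($f(-x)=f(x)$), let $a_{2m}=\int fH_{2m}\,d\mu$, and suppose that $k_0=\min\{m\ge 1: a_{2m}\ne 0\}$ exists. Assume: (i) for every integer $j\ge1$ there is a constant $C_j$ such that, for all sufficiently small $h>0$, $$\sup_{a\le x\le b}\int_a^b|\rho_h(x-y)|^j\,dy\le C_j\int_a^b\!\!\int_a^b|\rho_h(x-y)|^j\,dx\,dy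 ;$$ (ii) for all integers $1\le j<2k_0$, as $h\downarrow0$, $$\Big(\int_a^b\!\!\int_a^b|\rho_h(x-y)|^j\,dx\,dy\Big)^{1/j}=o\left(\Big(\int_a^b\!\!\int_a^b|\rho_h(x-y)|^{2k_0}\,dx\,dy\Big)^{1/(2k_0)}\right);$$ (iii) $$\liminf_{h\downarrow0}\frac{\int_a^b\int_a^b|\rho_h(x-y)|^{2k_0+2}\,dx\,dy}{\int_a^b\int_a^b|\rho_h(x-y)|^{2k_0}\,dx\,dy}>0 ,$$ where the quotient is read as $0$ when $\sigma(h)=0$. Then for all sufficiently small $h>0$ the integral $I_G(f,h;a,b)$ exists almost surely and is square integrable with positive variance, and, as $h\downarrow 0$, $$\frac{I_G(f,h;a,b)-(b-a)Ef(\eta)}{\sqrt{\operatorname{Var} I_G(f,h;a,b)}}\longrightarrow N(0,1)\quad\text{in distribution.}$$ -/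

import Mathlib

open MeasureTheory ProbabilityTheory Filter Asymptotics
open scoped Topology

namespace GaussianIncrementCLT

variable {Ω : Type*} [MeasurableSpace Ω]

/-- The `m`-th Hermite polynomial, normalized so that the family is an orthonormal basis of
`L²(ℝ, μ)`, `μ` the standard Gaussian measure: the probabilists' polynomial divided by `√(m!)`. -/
noncomputable def hermiteFun (m : ℕ) (x : ℝ) : ℝ :=
  Polynomial.aeval x (Polynomial.hermite m) / √(m.factorial : ℝ)

/-- The `m`-th Hermite coefficient `∫ f H_m dμ`. -/
noncomputable def hermiteCoeff (f : ℝ → ℝ) (m : ℕ) : ℝ :=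
  ∫ x, f x * hermiteFun m x ∂(gaussianReal 0 1)

/-- Stationary increments: the law of `G(x) - G(y)` is invariant under translation of `(x, y)`.
(For a centered Gaussian process this is the same as translation invariance of
`E (G(x) - G(y))²`, and as invariance of all joint laws of increments.) -/
def HasStationaryIncrements (G : ℝ → Ω → ℝ) (P : Measure Ω) : Prop :=
  ∀ x y t : ℝ,
    IdentDistrib (fun ω => G (x + t) ω - G (y + t) ω) (fun ω => G x ω - G y ω) P P

/-- The increments variance `σ²(h) = E (G(h) - G(0))²`; for a process with stationary increments,
`E (G(x) - G(y))² = σ²(x - y)`. -/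
noncomputable def sigmaSq (G : ℝ → Ω → ℝ) (P : Measure Ω) (h : ℝ) : ℝ :=
  ∫ ω, (G h ω - G 0 ω) ^ 2 ∂P

/-- `σ(h) = √(σ²(h))`. -/
noncomputable def sigma (G : ℝ → Ω → ℝ) (P : Measure Ω) (h : ℝ) : ℝ :=
  √(sigmaSq G P h)

/-- `ρ_h(x, y) = E[(G(x+h) - G(x)) (G(y+h) - G(y))] / σ²(h)`. -/
noncomputable def rho (G : ℝ → Ω → ℝ) (P : Measure Ω) (h x y : ℝ) : ℝ :=
  (∫ ω, (G (x + h) ω - G x ω) * (G (y + h) ω - G y ω) ∂P) / sigmaSq G P h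

/-- `∫_a^b ∫_a^b |ρ_h(x, y)|^j dx dy`. -/
noncomputable def rhoInt (G : ℝ → Ω → ℝ) (P : Measure Ω) (a b : ℝ) (j : ℕ) (h : ℝ) : ℝ :=
  ∫ x in a..b, ∫ y in a..b, |rho G P h x y| ^ j

/-- The functional `I_G(f, h; a, b) = ∫_a^b f((G(x+h) - G(x)) / σ(h)) dx`, a random variable. -/
noncomputable def functionalI (G : ℝ → Ω → ℝ) (P : Measure Ω) (f : ℝ → ℝ) (a b h : ℝ) (ω : Ω) : ℝ :=
  ∫ x in a..b, f ((G (x + h) ω - G x ω) / sigma G P h)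

end GaussianIncrementCLT

/-! ### Hermite polynomials and Gaussian integration by parts in one variable. -/

namespace GaussianIncrementCLT

/-! Fix h and let X be the normalized increments, a Gaussian field with standard normal marginals
and correlation r(x, y) = ρ_h. Put d = 2k₀, let A_j be the double integral of |r|^j, let g be f
minus its mean, and F the integral of g(X_y) over (a, b]. The claim is convergence of the
characteristic function of F / √(Var F), proved by Stein's method together with diagram bounds.

Suppose first that g is a finite sum Σ c_m He_{m+1}. Writing X_y = Z_y + r(x, y) X_x with Z
independent of X_x, integration by parts in the variable X_x gives E[F e^{isF}] = is E[T e^{isF}].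
Here T is the double integral of Σ c_m He_m(X_x) · g'(X_y) · r(x, y), and E T = E F²
(`integral_timeInt_smul_cexp`, `integral_steinKernel`). So the characteristic function φ of F
satisfies φ' = -s E[T e^{isF}], which is the Gaussian equation φ' = -s Var(F) φ up to |s| E|T - E
T|. Integrating it bounds the distance to e^{-Var(F) s²/2} by s² E|T - E T|
(`norm_integral_cexp_sub_le`).

The deviation of T is at most the square root of its variance, a fourfold integral of r₁₂ r₃₄ times
a covariance of Hermite products. Only multigraphs on four vertices joining {1, 2} to {3, 4}
contribute (`exists_cov_le`). Since every degree is at least d - 1 and the prefactor adds one edge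
to each pair, such a graph is dominated by paths with three weighted edges (`crossBound_majorant`,
`majorant_le_paths`). Integrating a path from both ends with assumption (i) leaves products A_d² A_1
and A_d A_u A_{d-u}, which are o(A_d²) by assumption (ii) (`isLittleO_pathSum`).

For general g, symmetry of f makes every term a_k² r^k of the covariance expansion nonnegative, so
Var F ≥ a_d² A_d, while the remainder of a truncated expansion has variance at most A_d times its
squared L² norm. The truncation error relative to Var F is thus small uniformly in h
(`exists_norm_charFun_sub_le`). Assumption (iii) guarantees A_d > 0, hence σ(h) ≠ 0, for small h. -/

/-- The probabilists' Hermite polynomial as a real function. -/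
noncomputable def He (n : ℕ) (x : ℝ) : ℝ := Polynomial.aeval x (Polynomial.hermite n)

/-- The standard Gaussian measure on the line. -/
noncomputable abbrev stdGauss : Measure ℝ := gaussianReal 0 1

lemma He_zero (x : ℝ) : He 0 x = 1 := by simp [He]

lemma He_one (x : ℝ) : He 1 x = x := by simp [He]

/-- Differentiating He_{n+1} = X He_n - He_n' and inserting the induction hypothesis closes up by
the same recursion. -/
lemma derivative_hermite_succ (n : ℕ) :
    Polynomial.derivative (Polynomial.hermite (n + 1)) =
      ((n : Polynomial ℤ) + 1) * Polynomial.hermite n := by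
  induction n with
  | zero => simp
  | succ n ih =>
    rw [Polynomial.hermite_succ (n + 1), ih, Polynomial.derivative_sub, Polynomial.derivative_mul,
      Polynomial.derivative_X, Polynomial.derivative_mul, ih, Polynomial.hermite_succ n]
    simp
    ring

lemma hasDerivAt_He_succ (n : ℕ) (x : ℝ) : HasDerivAt (He (n + 1)) ((n + 1) * He n x) x := by
  have h := (Polynomial.hermite (n + 1)).hasDerivAt_aeval x
  rw [derivative_hermite_succ] at h
  exact h.congr_deriv (by simp [He])

lemma hasDerivAt_He (n : ℕ) (x : ℝ) : HasDerivAt (He n) (n * He (n - 1) x) x := by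
  cases n with
  | zero =>
    have : He 0 = fun _ => 1 := funext He_zero
    simp [this, hasDerivAt_const]
  | succ n => simpa using hasDerivAt_He_succ n x

/-- The truncated index n - 1 is harmless at n = 0, because its coefficient n vanishes; the same
convention is used in all recursions below. -/
lemma He_succ (n : ℕ) (x : ℝ) : He (n + 1) x = x * He n x - n * He (n - 1) x := by
  have h := ((Polynomial.hermite n).hasDerivAt_aeval x).unique (hasDerivAt_He n x)
  rw [← h]
  simp [He, Polynomial.hermite_succ]

lemma continuous_He (n : ℕ) : Continuous (He n) :=
  (Polynomial.hermite n).continuous_aeval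

@[fun_prop]
lemma measurable_He (n : ℕ) : Measurable (He n) := (continuous_He n).measurable

lemma integrable_exp_abs_stdGauss (t : ℝ) :
    Integrable (fun x : ℝ => Real.exp (t * |x|)) stdGauss := by
  refine ((integrable_exp_mul_gaussianReal (μ := 0) (v := 1) t).add
    (integrable_exp_mul_gaussianReal (μ := 0) (v := 1) (-t))).mono' (by fun_prop) ?_
  refine ae_of_all _ fun x => ?_
  simp only [Real.norm_eq_abs, Real.abs_exp, Pi.add_apply]
  rcases abs_cases x with ⟨h, -⟩ | ⟨h, -⟩ <;> rw [h]
  · linarith [Real.exp_pos (-t * x)]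
  · have : t * -x = -t * x := by ring
    rw [this]; linarith [Real.exp_pos (t * x)]

lemma integrable_pow_stdGauss (n : ℕ) : Integrable (fun x : ℝ => x ^ n) stdGauss := by
  refine ((integrable_exp_abs_stdGauss 1).const_mul (n.factorial : ℝ)).mono' (by fun_prop) ?_
  refine ae_of_all _ fun x => ?_
  have := Real.pow_div_factorial_le_exp (|x|) (abs_nonneg x) n
  have hn : (0 : ℝ) < n.factorial := by positivity
  rw [div_le_iff₀ hn] at this
  simpa [mul_comm] using this

lemma integrable_aeval_stdGauss (p : Polynomial ℤ) :
    Integrable (fun x : ℝ => Polynomial.aeval x p) stdGauss := by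
  induction p using Polynomial.induction_on' with
  | add p q hp hq => simpa using! hp.add hq
  | monomial n a =>
    simpa using (integrable_pow_stdGauss n).const_mul (a : ℝ)

lemma integrable_He_pow (n k : ℕ) : Integrable (fun x => He n x ^ k) stdGauss := by
  simpa [He] using integrable_aeval_stdGauss (Polynomial.hermite n ^ k)

lemma integrable_He_mul_He (m n : ℕ) : Integrable (fun x => He m x * He n x) stdGauss := by
  simpa [He] using integrable_aeval_stdGauss (Polynomial.hermite m * Polynomial.hermite n)

lemma memLp_He (n : ℕ) : MemLp (He n) 2 stdGauss :=
  (memLp_two_iff_integrable_sq (measurable_He n).aestronglyMeasurable).2 (integrable_He_pow n 2)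

lemma memLp_pow_stdGauss (n : ℕ) : MemLp (fun x : ℝ => x ^ n) 2 stdGauss := by
  refine (memLp_two_iff_integrable_sq (by fun_prop)).2 ?_
  simpa [← pow_mul] using integrable_pow_stdGauss (n * 2)

lemma hasDerivAt_gaussianPDFReal_std (x : ℝ) :
    HasDerivAt (gaussianPDFReal 0 1) (-x * gaussianPDFReal 0 1 x) x := by
  have h : HasDerivAt (fun y : ℝ => -(y - 0) ^ 2 / (2 * ((1 : NNReal) : ℝ))) (-x) x := by
    exact ((((hasDerivAt_id x).sub_const 0).pow 2).neg.div_const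
      (2 * ((1 : NNReal) : ℝ))).congr_deriv (by simp; ring)
  have h2 := h.exp.const_mul (√(2 * Real.pi * ((1 : NNReal) : ℝ)))⁻¹
  unfold gaussianPDFReal
  exact h2.congr_deriv (by ring)

lemma integrable_stdGauss_iff {E : Type*} [NormedAddCommGroup E] [NormedSpace ℝ E] {f : ℝ → E} :
    Integrable f stdGauss ↔ Integrable (fun x => gaussianPDFReal 0 1 x • f x) := by
  rw [stdGauss, gaussianReal_of_var_ne_zero _ one_ne_zero,
    integrable_withDensity_iff_integrable_smul' (measurable_gaussianPDF _ _)
      (ae_of_all _ fun _ => gaussianPDF_lt_top)]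
  simp

/-- Gaussian integration by parts against Hermite polynomials. -/
lemma integral_He_succ_smul {E : Type*} [NormedAddCommGroup E] [NormedSpace ℝ E]
    {φ φ' : ℝ → E} (n : ℕ) (hφ : ∀ x, HasDerivAt φ (φ' x) x)
    (h0 : Integrable (fun x => He n x • φ x) stdGauss)
    (h1 : Integrable (fun x => He (n + 1) x • φ x) stdGauss)
    (h2 : Integrable (fun x => He n x • φ' x) stdGauss) :
    ∫ x, He (n + 1) x • φ x ∂stdGauss = ∫ x, He n x • φ' x ∂stdGauss := by
  rw [integral_gaussianReal_eq_integral_smul one_ne_zero,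
    integral_gaussianReal_eq_integral_smul one_ne_zero]
  -- With γ the density, (γ He_n)' = -γ He_{n+1}, so He_{n+1} γ is an exact derivative. Values in a
  -- general space E allow real products as well as complex exponentials for φ.
  have hu : ∀ x, HasDerivAt (fun x => gaussianPDFReal 0 1 x * He n x)
      (-(gaussianPDFReal 0 1 x * He (n + 1) x)) x := by
    intro x
    exact ((hasDerivAt_gaussianPDFReal_std x).mul (hasDerivAt_He n x)).congr_deriv
      (by rw [He_succ]; ring)
  have key := integral_bilinear_hasDerivAt_right_eq_neg_left_of_integrable
    (L := ContinuousLinearMap.lsmul ℝ ℝ (E := E)) (u := fun x => gaussianPDFReal 0 1 x * He n x)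
    (u' := fun x => -(gaussianPDFReal 0 1 x * He (n + 1) x)) (v := φ) (v' := φ')
    (fun x _ => hu x) (fun x _ => hφ x)
    (by simpa [mul_smul] using integrable_stdGauss_iff.1 h2)
    (by simpa [mul_smul] using (integrable_stdGauss_iff.1 h1).neg)
    (by simpa [mul_smul] using integrable_stdGauss_iff.1 h0)
  simp only [ContinuousLinearMap.lsmul_apply, neg_smul, integral_neg, neg_neg] at key
  simpa [mul_smul] using key.symm

/-- Each integration by parts lowers both indices by one and yields the factor n, until one of them
is zero. -/
lemma integral_He_mul_He (m n : ℕ) :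
    ∫ x, He m x * He n x ∂stdGauss = if m = n then (m.factorial : ℝ) else 0 := by
  have step : ∀ m n : ℕ, ∫ x, He (m + 1) x * He n x ∂stdGauss
      = n * ∫ x, He m x * He (n - 1) x ∂stdGauss := by
    intro m n
    have := integral_He_succ_smul (E := ℝ) m (fun x => hasDerivAt_He n x)
      (by simpa using integrable_He_mul_He m n) (by simpa using integrable_He_mul_He (m + 1) n)
      (by simpa [mul_left_comm] using (integrable_He_mul_He m (n - 1)).const_mul (n : ℝ))
    simp only [smul_eq_mul] at this
    rw [this, ← integral_const_mul]
    congr 1; ext x; ring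
  have base : ∀ n : ℕ, ∫ x, He n x ∂stdGauss = if n = 0 then 1 else 0 := by
    intro n
    cases n with
    | zero => simp [He_zero]
    | succ n => simpa [He_zero] using step n 0
  induction m generalizing n with
  | zero => simp [He_zero, base, eq_comm]
  | succ m ih =>
    rw [step, ih]
    cases n with
    | zero => simp
    | succ n =>
      by_cases h : m = n
      · subst h; simp [Nat.factorial_succ]
      · simp [h]

end GaussianIncrementCLT

/-! ### Completeness of the Hermite system in L² of the Gaussian measure. -/

namespace GaussianIncrementCLT

lemma memLp_pow_mul_He (k n : ℕ) : MemLp (fun x => x ^ k * He n x) 2 stdGauss := by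
  refine (memLp_two_iff_integrable_sq (by fun_prop)).2 ?_
  refine (integrable_aeval_stdGauss ((Polynomial.X ^ k * Polynomial.hermite n) ^ 2)).congr
    (ae_of_all _ fun x => ?_)
  simp only [map_mul, map_pow, Polynomial.aeval_X, He]

/-- The three-term recurrence writes x He_n through He_{n+1} and He_{n-1}, so orthogonality to all
He_n propagates to all x^k He_n; the case n = 0 gives the monomials. -/
lemma integral_mul_pow_mul_He_eq_zero {g : ℝ → ℝ} (hg : MemLp g 2 stdGauss)
    (h : ∀ n, ∫ x, g x * He n x ∂stdGauss = 0) (k n : ℕ) :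
    ∫ x, g x * (x ^ k * He n x) ∂stdGauss = 0 := by
  induction k generalizing n with
  | zero => simpa using h n
  | succ k ih =>
    have e : ∀ x, g x * (x ^ (k + 1) * He n x)
        = g x * (x ^ k * He (n + 1) x) + n * (g x * (x ^ k * He (n - 1) x)) := by
      intro x; rw [He_succ]; ring
    simp_rw [e]
    have hi : ∀ m, Integrable (fun x => g x * (x ^ k * He m x)) stdGauss := fun m =>
      hg.integrable_mul (memLp_pow_mul_He k m)
    rw [integral_add (hi _) ((hi _).const_mul _), integral_const_mul, ih, ih]
    simp

lemma memLp_exp_abs_stdGauss (t : ℝ) : MemLp (fun x : ℝ => Real.exp (t * |x|)) 2 stdGauss := by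
  refine (memLp_two_iff_integrable_sq (by fun_prop)).2 ?_
  refine (integrable_exp_abs_stdGauss (2 * t)).congr (ae_of_all _ fun x => ?_)
  simp only [← Real.exp_nat_mul]
  congr 1; push_cast; ring

/-- The exponential series is integrated term by term; it is dominated by |g| e^{|t||x|}, integrable
as a product of two square integrable functions. -/
lemma integral_mul_cexp_eq_zero {g : ℝ → ℝ} (hg : MemLp g 2 stdGauss)
    (h : ∀ n, ∫ x, g x * He n x ∂stdGauss = 0) (t : ℝ) :
    ∫ x, (g x : ℂ) * Complex.exp (t * x * Complex.I) ∂stdGauss = 0 := by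
  have hsum : ∀ x : ℝ, HasSum (fun n : ℕ => |g x| * ((|t| * |x|) ^ n / n.factorial))
      (|g x| * Real.exp (|t| * |x|)) := fun x => by
    rw [Real.exp_eq_exp_ℝ]
    exact (NormedSpace.expSeries_div_hasSum_exp (|t| * |x|)).mul_left _
  have key := hasSum_integral_of_dominated_convergence (μ := stdGauss)
    (F := fun (n : ℕ) (x : ℝ) => (g x : ℂ) * ((t * x * Complex.I) ^ n / n.factorial))
    (f := fun x : ℝ => (g x : ℂ) * Complex.exp (t * x * Complex.I))
    (fun n x => |g x| * ((|t| * |x|) ^ n / n.factorial))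
    (fun n => (Complex.continuous_ofReal.comp_aestronglyMeasurable hg.1).mul (by fun_prop))
    (fun n => ae_of_all _ fun x => by simp)
    (ae_of_all _ fun x => (hsum x).summable)
    (by
      simp_rw [fun x => (hsum x).tsum_eq]
      exact hg.abs.integrable_mul (memLp_exp_abs_stdGauss _))
    (ae_of_all _ fun x => by
      rw [Complex.exp_eq_exp_ℂ]
      exact (NormedSpace.expSeries_div_hasSum_exp ((t : ℂ) * x * Complex.I)).mul_left _)
  have hz : ∀ n : ℕ, ∫ x : ℝ, (g x : ℂ) * ((t * x * Complex.I) ^ n / n.factorial) ∂stdGauss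
      = 0 := by
    intro n
    have e : ∀ x : ℝ, (g x : ℂ) * ((t * x * Complex.I) ^ n / n.factorial)
        = ((t * Complex.I) ^ n / n.factorial) * ((g x * (x ^ n * He 0 x) : ℝ) : ℂ) := by
      intro x; rw [He_zero]; push_cast; ring
    simp_rw [e]
    rw [integral_const_mul, integral_complex_ofReal, integral_mul_pow_mul_He_eq_zero hg h]
    simp
  simp_rw [hz] at key
  exact key.unique hasSum_zero

/-- The positive and negative parts of g are densities of two finite measures whose characteristic
functions agree by `integral_mul_cexp_eq_zero`; hence the measures, and then the densities,
coincide. -/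
lemma ae_eq_zero_of_forall_integral_mul_He {g : ℝ → ℝ} (hg : MemLp g 2 stdGauss)
    (h : ∀ n, ∫ x, g x * He n x ∂stdGauss = 0) : g =ᵐ[stdGauss] 0 := by
  have hgi : Integrable g stdGauss := hg.integrable one_le_two
  have hfin : ∀ u : ℝ → ℝ, Integrable u stdGauss →
      ∫⁻ x, ENNReal.ofReal (u x) ∂stdGauss ≠ ⊤ := fun u hu => by
    refine ne_top_of_le_ne_top hu.2.ne (lintegral_mono fun x => ?_)
    exact Real.ofReal_le_enorm (u x)
  have hchar : ∀ u : ℝ → ℝ, Integrable u stdGauss → ∀ t : ℝ,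
      charFun (stdGauss.withDensity fun x => ENNReal.ofReal (u x)) t
        = ∫ x, ((max (u x) 0 : ℝ) : ℂ) * Complex.exp (t * x * Complex.I) ∂stdGauss := by
    intro u hu t
    rw [charFun_apply_real, integral_withDensity_eq_integral_toReal_smul₀
      hu.1.aemeasurable.ennreal_ofReal (ae_of_all _ fun _ => ENNReal.ofReal_lt_top)]
    simp [ENNReal.toReal_ofReal']
  have hint : ∀ u : ℝ → ℝ, Integrable u stdGauss → ∀ t : ℝ, Integrable
      (fun x : ℝ => ((max (u x) 0 : ℝ) : ℂ) * Complex.exp (t * x * Complex.I)) stdGauss := by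
    intro u hu t
    refine (hu.pos_part.ofReal (𝕜 := ℂ)).mul_bdd (c := 1) (by fun_prop) (ae_of_all _ fun x => ?_)
    rw [← Complex.ofReal_mul, Complex.norm_exp_ofReal_mul_I]
  have : IsFiniteMeasure (stdGauss.withDensity fun x => ENNReal.ofReal (g x)) :=
    isFiniteMeasure_withDensity (hfin g hgi)
  have : IsFiniteMeasure (stdGauss.withDensity fun x => ENNReal.ofReal ((-g) x)) :=
    isFiniteMeasure_withDensity (hfin (-g) hgi.neg)
  have heq : (stdGauss.withDensity fun x => ENNReal.ofReal (g x))
      = stdGauss.withDensity fun x => ENNReal.ofReal ((-g) x) := by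
    refine Measure.ext_of_charFun (funext fun t => ?_)
    rw [hchar g hgi, hchar (-g) hgi.neg, ← sub_eq_zero, ← integral_sub (hint g hgi t)
      (hint (-g) hgi.neg t), ← integral_mul_cexp_eq_zero hg h t]
    refine integral_congr_ae (ae_of_all _ fun x => ?_)
    simp only [← sub_mul, ← Complex.ofReal_sub, Pi.neg_apply]
    congr 2
    rcases le_total 0 (g x) with h0 | h0
    · rw [max_eq_left h0, max_eq_right (by linarith)]; ring
    · rw [max_eq_right h0, max_eq_left (by linarith)]; ring
  rw [withDensity_eq_iff hgi.1.aemeasurable.ennreal_ofReal hgi.neg.1.aemeasurable.ennreal_ofReal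
    (hfin g hgi)] at heq
  filter_upwards [heq] with x hx
  simp only [Pi.neg_apply] at hx
  rcases le_total 0 (g x) with h0 | h0
  · rw [ENNReal.ofReal_of_nonpos (by linarith : -g x ≤ 0), ENNReal.ofReal_eq_zero] at hx
    exact le_antisymm hx h0
  · rw [ENNReal.ofReal_of_nonpos h0, eq_comm, ENNReal.ofReal_eq_zero] at hx
    exact le_antisymm h0 (by simpa using hx)

lemma hermiteFun_eq (n : ℕ) (x : ℝ) : hermiteFun n x = He n x / √(n.factorial : ℝ) := rfl

lemma memLp_hermiteFun (n : ℕ) : MemLp (hermiteFun n) 2 stdGauss := by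
  have : hermiteFun n = fun x => (√(n.factorial : ℝ))⁻¹ * He n x := by
    ext x; rw [hermiteFun_eq]; ring
  rw [this]
  exact (memLp_He n).const_mul _

lemma integral_hermiteFun_mul (m n : ℕ) :
    ∫ x, hermiteFun m x * hermiteFun n x ∂stdGauss = if m = n then 1 else 0 := by
  have e : ∀ x, hermiteFun m x * hermiteFun n x
      = ((√(m.factorial : ℝ))⁻¹ * (√(n.factorial : ℝ))⁻¹) * (He m x * He n x) := by
    intro x; rw [hermiteFun_eq, hermiteFun_eq]; ring
  simp_rw [e]
  rw [integral_const_mul, integral_He_mul_He]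
  split_ifs with h
  · subst h
    have : (0 : ℝ) < m.factorial := by positivity
    rw [← mul_inv, Real.mul_self_sqrt this.le, inv_mul_cancel₀ this.ne']
  · simp

/-- The Hermite functions as elements of `L²`. -/
noncomputable def hermiteLp (n : ℕ) : Lp ℝ 2 stdGauss := (memLp_hermiteFun n).toLp _

lemma inner_hermiteLp_toLp (n : ℕ) {f : ℝ → ℝ} (hf : MemLp f 2 stdGauss) :
    inner ℝ (hermiteLp n) (hf.toLp f) = hermiteCoeff f n := by
  rw [L2.inner_def, hermiteCoeff]
  refine integral_congr_ae ?_
  filter_upwards [(memLp_hermiteFun n).coeFn_toLp, hf.coeFn_toLp] with x h1 h2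
  simp [hermiteLp, h1, h2]

lemma orthonormal_hermiteLp : Orthonormal ℝ hermiteLp := by
  rw [orthonormal_iff_ite]
  intro i j
  rw [show hermiteLp j = (memLp_hermiteFun j).toLp _ from rfl, inner_hermiteLp_toLp, hermiteCoeff]
  simp_rw [mul_comm (hermiteFun j _)]
  exact integral_hermiteFun_mul i j

lemma span_hermiteLp_orthogonal : (Submodule.span ℝ (Set.range hermiteLp))ᗮ = ⊥ := by
  rw [Submodule.eq_bot_iff]
  intro g hg
  have hz : ∀ n, ∫ x, g x * He n x ∂stdGauss = 0 := by
    intro n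
    have h := (Submodule.mem_orthogonal _ _).1 hg (hermiteLp n)
      (Submodule.subset_span (Set.mem_range_self n))
    rw [← Lp.toLp_coeFn g (Lp.memLp g), inner_hermiteLp_toLp, hermiteCoeff] at h
    simp_rw [hermiteFun_eq, ← mul_div_assoc] at h
    rw [integral_div, div_eq_zero_iff] at h
    have : (0 : ℝ) < n.factorial := by positivity
    exact h.resolve_right (Real.sqrt_pos.2 this).ne'
  exact (Lp.eq_zero_iff_ae_eq_zero).2 (ae_eq_zero_of_forall_integral_mul_He (Lp.memLp g) hz)

/-- The partial sums of the Hermite expansion. -/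
noncomputable def hermiteSum (f : ℝ → ℝ) (N : ℕ) (x : ℝ) : ℝ :=
  ∑ k ∈ Finset.range N, hermiteCoeff f k * hermiteFun k x

lemma memLp_hermiteSum (f : ℝ → ℝ) (N : ℕ) : MemLp (hermiteSum f N) 2 stdGauss :=
  memLp_finsetSum _ fun k _ => (memLp_hermiteFun k).const_mul (hermiteCoeff f k)

lemma toLp_hermiteSum (f : ℝ → ℝ) (N : ℕ) : (memLp_hermiteSum f N).toLp (hermiteSum f N)
    = ∑ k ∈ Finset.range N, hermiteCoeff f k • hermiteLp k := by
  induction N with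
  | zero =>
    refine (Lp.eq_zero_iff_ae_eq_zero).2 ?_
    filter_upwards [(memLp_hermiteSum f 0).coeFn_toLp] with x hx
    simp [hx, hermiteSum]
  | succ N ih =>
    rw [Finset.sum_range_succ, ← ih]
    unfold hermiteLp
    rw [← MemLp.toLp_const_smul, ← MemLp.toLp_add]
    refine MemLp.toLp_congr _ _ (ae_of_all _ fun x => ?_)
    simp [hermiteSum, Finset.sum_range_succ]

lemma norm_toLp_sq {g : ℝ → ℝ} (hg : MemLp g 2 stdGauss) :
    ‖hg.toLp g‖ ^ 2 = ∫ x, g x ^ 2 ∂stdGauss := by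
  rw [← real_inner_self_eq_norm_sq, L2.inner_def]
  refine integral_congr_ae ?_
  filter_upwards [hg.coeFn_toLp] with x hx
  simp [hx, sq]

/-- The Hermite expansion of a square integrable function converges in `L²`. -/
lemma tendsto_integral_sub_hermiteSum_sq {f : ℝ → ℝ} (hf : MemLp f 2 stdGauss) :
    Tendsto (fun N => ∫ x, (f x - hermiteSum f N x) ^ 2 ∂stdGauss) atTop (𝓝 0) := by
  let b := HilbertBasis.mkOfOrthogonalEqBot orthonormal_hermiteLp span_hermiteLp_orthogonal
  have h := (b.hasSum_repr (hf.toLp f)).tendsto_sum_nat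
  have hb : ∀ k, b.repr (hf.toLp f) k • b k = hermiteCoeff f k • hermiteLp k := by
    intro k
    have hbk : b k = hermiteLp k :=
      congrFun (HilbertBasis.coe_mkOfOrthogonalEqBot orthonormal_hermiteLp _) k
    rw [HilbertBasis.repr_apply_apply, hbk, inner_hermiteLp_toLp]
  simp_rw [hb, ← toLp_hermiteSum] at h
  have h2 := ((tendsto_const_nhds (x := hf.toLp f)).sub h).norm.pow 2
  simp_rw [← MemLp.toLp_sub] at h2
  simp_rw [norm_toLp_sq] at h2
  simpa using h2

end GaussianIncrementCLT

/-! ### Standard Gaussian fields and the resampling of one value. -/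

namespace GaussianIncrementCLT

variable {Ω : Type*} [MeasurableSpace Ω]

/-- A jointly measurable centered Gaussian process on the line with unit variances. -/
structure IsStdGaussField (X : ℝ → Ω → ℝ) (P : Measure Ω) : Prop where
  meas : Measurable (Function.uncurry X)
  gauss : IsGaussianProcess X P
  law : ∀ x, P.map (X x) = stdGauss

/-- The covariance function of a centered process. -/
noncomputable def corr (X : ℝ → Ω → ℝ) (P : Measure Ω) (x y : ℝ) : ℝ := ∫ ω, X x ω * X y ω ∂P

/-- The process obtained from `X` by replacing the value `X x` by an independent variable. -/
noncomputable def resample (X : ℝ → Ω → ℝ) (P : Measure Ω) (x : ℝ) (z : Ω × ℝ) (y : ℝ) : ℝ :=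
  X y z.1 + corr X P x y * (z.2 - X x z.1)

variable {P : Measure Ω} {X : ℝ → Ω → ℝ}

lemma corr_comm (x y : ℝ) : corr X P x y = corr X P y x := by
  unfold corr; simp_rw [mul_comm]

namespace IsStdGaussField

lemma meas_eval (hX : IsStdGaussField X P) (x : ℝ) : Measurable (X x) :=
  hX.meas.comp measurable_prodMk_left

lemma meas_path (hX : IsStdGaussField X P) : Measurable (fun ω y => X y ω) :=
  measurable_pi_lambda _ fun y => hX.meas_eval y

lemma integrable_comp (hX : IsStdGaussField X P) (x : ℝ) {f : ℝ → ℝ}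
    (hf : Integrable f stdGauss) : Integrable (fun ω => f (X x ω)) P := by
  rw [← hX.law x] at hf
  exact hf.comp_measurable (hX.meas_eval x)

lemma integral_comp (hX : IsStdGaussField X P) (x : ℝ) {f : ℝ → ℝ}
    (hf : AEStronglyMeasurable f stdGauss) :
    ∫ ω, f (X x ω) ∂P = ∫ z, f z ∂stdGauss := by
  rw [← hX.law x] at hf ⊢
  exact (integral_map (hX.meas_eval x).aemeasurable hf).symm

lemma memLp_comp (hX : IsStdGaussField X P) (x : ℝ) {f : ℝ → ℝ}
    (hf : MemLp f 2 stdGauss) : MemLp (fun ω => f (X x ω)) 2 P := by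
  rw [← hX.law x] at hf
  exact hf.comp_of_map (hX.meas_eval x).aemeasurable

lemma memLp_two (hX : IsStdGaussField X P) (x : ℝ) : MemLp (X x) 2 P := by
  simpa using hX.memLp_comp x (memLp_pow_stdGauss 1)

lemma integral_eq_zero (hX : IsStdGaussField X P) (x : ℝ) : ∫ ω, X x ω ∂P = 0 := by
  have := hX.integral_comp x (f := id) (by fun_prop)
  simpa [integral_id_gaussianReal] using this

lemma integral_sq (hX : IsStdGaussField X P) (x : ℝ) : ∫ ω, X x ω ^ 2 ∂P = 1 := by
  rw [hX.integral_comp x (f := fun z => z ^ 2) (by fun_prop)]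
  have := integral_He_mul_He 1 1
  simpa [He_one, ← sq] using this

lemma corr_self (hX : IsStdGaussField X P) (x : ℝ) : corr X P x x = 1 := by
  rw [← hX.integral_sq x, corr]; simp_rw [sq]

lemma abs_corr_le (hX : IsStdGaussField X P) (x y : ℝ) : |corr X P x y| ≤ 1 := by
  have hx := (hX.memLp_two x).integrable_sq
  have hy := (hX.memLp_two y).integrable_sq
  calc |corr X P x y| ≤ ∫ ω, |X x ω * X y ω| ∂P := abs_integral_le_integral_abs
    _ ≤ ∫ ω, (X x ω ^ 2 + X y ω ^ 2) / 2 ∂P := by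
        refine integral_mono ((hX.memLp_two x).integrable_mul (hX.memLp_two y)).abs
          ((hx.add hy).div_const 2) fun ω => ?_
        simp only [abs_mul]
        nlinarith [sq_nonneg (|X x ω| - |X y ω|), sq_abs (X x ω), sq_abs (X y ω)]
    _ = 1 := by
        rw [integral_div, integral_add hx hy, hX.integral_sq, hX.integral_sq]; norm_num

lemma measurable_corr [SFinite P] (hX : IsStdGaussField X P) :
    Measurable (fun z : ℝ × ℝ => corr X P z.1 z.2) := by
  unfold corr
  have h1 : Measurable fun q : (ℝ × ℝ) × Ω => X q.1.1 q.2 :=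
    hX.meas.comp ((measurable_fst.comp measurable_fst).prodMk measurable_snd)
  have h2 : Measurable fun q : (ℝ × ℝ) × Ω => X q.1.2 q.2 :=
    hX.meas.comp ((measurable_snd.comp measurable_fst).prodMk measurable_snd)
  exact (h1.mul h2).stronglyMeasurable.integral_prod_right.measurable

lemma measurable_resample (hX : IsStdGaussField X P) (x : ℝ) :
    Measurable (resample X P x) := by
  refine measurable_pi_lambda _ fun y => ?_
  have h1 : Measurable fun q : Ω × ℝ => X y q.1 := (hX.meas_eval y).comp measurable_fst
  have h2 : Measurable fun q : Ω × ℝ => X x q.1 := (hX.meas_eval x).comp measurable_fst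
  exact h1.add (measurable_const.mul (measurable_snd.sub h2))

lemma measurable_resample_uncurry [SFinite P] (hX : IsStdGaussField X P) (x : ℝ) :
    Measurable (fun q : ℝ × (Ω × ℝ) => resample X P x q.2 q.1) := by
  have h1 : Measurable fun q : ℝ × (Ω × ℝ) => X q.1 q.2.1 :=
    hX.meas.comp (measurable_fst.prodMk (measurable_fst.comp measurable_snd))
  have h2 : Measurable fun q : ℝ × (Ω × ℝ) => X x q.2.1 :=
    (hX.meas_eval x).comp (measurable_fst.comp measurable_snd)
  have h3 : Measurable fun q : ℝ × (Ω × ℝ) => corr X P x q.1 :=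
    hX.measurable_corr.comp (measurable_const.prodMk measurable_fst)
  exact h1.add (h3.mul ((measurable_snd.comp measurable_snd).sub h2))

lemma resample_self (hX : IsStdGaussField X P) (x : ℝ) (z : Ω × ℝ) : resample X P x z x = z.2 := by
  simp [resample, hX.corr_self]

lemma hasDerivAt_resample (_ : IsStdGaussField X P) (x y : ℝ) (ω : Ω) (n : ℝ) :
    HasDerivAt (fun n => resample X P x (ω, n) y) (corr X P x y) n := by
  have h := (((hasDerivAt_id n).sub_const (X x ω)).const_mul (corr X P x y)).const_add (X y ω)
  exact h.congr_deriv (by simp)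

/-- The resampled process has the same law as the original one. -/
lemma map_resample [IsProbabilityMeasure P] (hX : IsStdGaussField X P) (x : ℝ) :
    P.map (fun ω y => X y ω) = (P.prod stdGauss).map (resample X P x) := by
  set Z : ℝ → Ω → ℝ := fun y ω => X y ω - corr X P x y * X x ω with hZ
  have mZ : ∀ y, Measurable (Z y) := fun y =>
    (hX.meas_eval y).sub (measurable_const.mul (hX.meas_eval x))
  have mZp : Measurable (fun ω y => Z y ω) := measurable_pi_lambda _ mZ
  -- The residuals Z are uncorrelated with X x; joint Gaussianity of the enlarged family turns this
  -- into independence, so X x may be replaced by a fresh standard normal variable.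
  have hG : IsGaussianProcess (Sum.elim Z (fun _ : Unit => X x)) P := by
    classical
    refine hX.gauss.of_isGaussianProcess fun s => ?_
    cases s with
    | inl y => exact ⟨{x, y}, ContinuousLinearMap.proj ⟨y, by simp⟩ -
        corr X P x y • ContinuousLinearMap.proj ⟨x, by simp⟩, fun ω => by simp [hZ]⟩
    | inr y => exact ⟨{x}, ContinuousLinearMap.proj ⟨x, by simp⟩, fun ω => by simp⟩
  have hind := hG.indepFun_of_covariance_eq_zero (fun y => (mZ y).aemeasurable)
    (fun _ => (hX.meas_eval x).aemeasurable) (fun y _ => by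
      have hZ2 : MemLp (Z y) 2 P := (hX.memLp_two y).sub ((hX.memLp_two x).const_mul _)
      rw [covariance_eq_sub hZ2 (hX.memLp_two x), hX.integral_eq_zero, mul_zero, sub_zero]
      have e : ∀ ω, (Z y * X x) ω = X y ω * X x ω - corr X P x y * X x ω ^ 2 := fun ω => by
        simp only [hZ, Pi.mul_apply]; ring
      simp_rw [e]
      have hi : Integrable (fun ω => X y ω * X x ω) P :=
        (hX.memLp_two y).integrable_mul (hX.memLp_two x)
      rw [integral_sub hi ((hX.memLp_two x).integrable_sq.const_mul _),
        integral_const_mul, hX.integral_sq, mul_one,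
        corr_comm]
      exact sub_self _)
  have hind2 : IndepFun (fun ω y => Z y ω) (X x) P :=
    hind.comp measurable_id (measurable_pi_apply ())
  rw [indepFun_iff_map_prod_eq_prod_map_map mZp.aemeasurable (hX.meas_eval x).aemeasurable] at hind2
  let Ψ : (ℝ → ℝ) × ℝ → ℝ → ℝ := fun q y => q.1 y + corr X P x y * q.2
  have mΨ : Measurable Ψ := measurable_pi_lambda _ fun y =>
    ((measurable_pi_apply y).comp measurable_fst).add (measurable_const.mul measurable_snd)
  have e1 : (fun ω y => X y ω) = Ψ ∘ fun ω => (fun y => Z y ω, X x ω) := by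
    ext ω y; simp [Ψ, hZ]
  have e2 : resample X P x = Ψ ∘ Prod.map (fun ω y => Z y ω) id := by
    ext ω y; simp [Ψ, hZ, resample]; ring
  rw [e1, e2, ← Measure.map_map mΨ (mZp.prodMk (hX.meas_eval x)), hind2,
    ← Measure.map_map mΨ (mZp.prodMap measurable_id), ← Measure.map_prod_map _ _ mZp measurable_id,
    hX.law, Measure.map_id]

/-- All one-point marginals are standard normal, so randomizing the time only multiplies the law by
the mass of κ. This turns null sets and integrability on the line into the same on time × Ω. -/
lemma map_comp_prod {S : Type*} [MeasurableSpace S] [IsProbabilityMeasure P]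
    (hX : IsStdGaussField X P) (κ : Measure S) [IsFiniteMeasure κ] {u : S → ℝ}
    (hu : Measurable u) :
    (κ.prod P).map (fun q => X (u q.1) q.2) = κ Set.univ • stdGauss := by
  have hm : Measurable (fun q : S × Ω => X (u q.1) q.2) :=
    hX.meas.comp ((hu.comp measurable_fst).prodMk measurable_snd)
  ext A hA
  rw [Measure.map_apply hm hA, Measure.prod_apply (hm hA)]
  have : ∀ s, P (Prod.mk s ⁻¹' ((fun q : S × Ω => X (u q.1) q.2) ⁻¹' A)) = stdGauss A := by
    intro s
    rw [← hX.law (u s), Measure.map_apply (hX.meas_eval _) hA]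
    rfl
  simp [this, mul_comm]

lemma integrable_comp_prod {S : Type*} [MeasurableSpace S] [IsProbabilityMeasure P]
    (hX : IsStdGaussField X P) (κ : Measure S) [IsFiniteMeasure κ] {u : S → ℝ}
    (hu : Measurable u) {f : ℝ → ℝ} (hf : Integrable f stdGauss) :
    Integrable (fun q : S × Ω => f (X (u q.1) q.2)) (κ.prod P) := by
  have hm : Measurable (fun q : S × Ω => X (u q.1) q.2) :=
    hX.meas.comp ((hu.comp measurable_fst).prodMk measurable_snd)
  have h : Integrable f ((κ.prod P).map (fun q => X (u q.1) q.2)) := by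
    rw [hX.map_comp_prod κ hu]
    exact hf.smul_measure (measure_ne_top _ _)
  exact h.comp_measurable hm

/-- Path functionals have the same integral for a process and its resampled version. -/
lemma integral_path_eq {E : Type*} [NormedAddCommGroup E] [NormedSpace ℝ E]
    [IsProbabilityMeasure P] (hX : IsStdGaussField X P) (x : ℝ)
    {Φ : (ℝ → ℝ) → E} (hΦ : StronglyMeasurable Φ) :
    ∫ ω, Φ (fun y => X y ω) ∂P = ∫ z, Φ (resample X P x z) ∂(P.prod stdGauss) := by
  rw [← integral_map hX.meas_path.aemeasurable hΦ.aestronglyMeasurable, hX.map_resample x,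
    integral_map (hX.measurable_resample x).aemeasurable hΦ.aestronglyMeasurable]

lemma integrable_path_iff {E : Type*} [NormedAddCommGroup E]
    [IsProbabilityMeasure P] (hX : IsStdGaussField X P) (x : ℝ)
    {Φ : (ℝ → ℝ) → E} (hΦ : StronglyMeasurable Φ) :
    Integrable (fun ω => Φ (fun y => X y ω)) P ↔
      Integrable (fun z => Φ (resample X P x z)) (P.prod stdGauss) := by
  have h1 := integrable_map_measure (μ := P) (f := fun ω y => X y ω) (g := Φ)
    hΦ.aestronglyMeasurable hX.meas_path.aemeasurable
  have h2 := integrable_map_measure (μ := P.prod stdGauss) (f := resample X P x) (g := Φ)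
    hΦ.aestronglyMeasurable (hX.measurable_resample x).aemeasurable
  rw [hX.map_resample x] at h1
  exact h1.symm.trans h2

end IsStdGaussField

/-- Reduces integrability of fourfold Hermite products to fourth moments of single values. -/
lemma abs_mul_four_le (a b c d : ℝ) : |a * b * c * d| ≤ a ^ 4 + b ^ 4 + c ^ 4 + d ^ 4 := by
  have h1 : |a * b * c * d| ≤ ((a * b) ^ 2 + (c * d) ^ 2) / 2 := by
    rw [abs_le]; constructor <;> nlinarith [sq_nonneg (a * b - c * d), sq_nonneg (a * b + c * d)]
  have h2 : (a * b) ^ 2 ≤ (a ^ 4 + b ^ 4) / 2 := by nlinarith [sq_nonneg (a ^ 2 - b ^ 2)]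
  have h3 : (c * d) ^ 2 ≤ (c ^ 4 + d ^ 4) / 2 := by nlinarith [sq_nonneg (c ^ 2 - d ^ 2)]
  have : 0 ≤ a ^ 4 := by positivity
  have : 0 ≤ b ^ 4 := by positivity
  have : 0 ≤ c ^ 4 := by positivity
  have : 0 ≤ d ^ 4 := by positivity
  linarith

/-- The product of four Hermite polynomials along a path. -/
noncomputable def hermiteProd (i j k l : ℕ) (x₁ x₂ x₃ x₄ : ℝ) (w : ℝ → ℝ) : ℝ :=
  He i (w x₁) * He j (w x₂) * He k (w x₃) * He l (w x₄)

/-- Mixed moments of four Hermite polynomials. -/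
noncomputable def moment4 (X : ℝ → Ω → ℝ) (P : Measure Ω) (i j k l : ℕ) (x₁ x₂ x₃ x₄ : ℝ) : ℝ :=
  ∫ ω, hermiteProd i j k l x₁ x₂ x₃ x₄ (fun y => X y ω) ∂P

lemma measurable_hermiteProd (i j k l : ℕ) (x₁ x₂ x₃ x₄ : ℝ) :
    Measurable (hermiteProd i j k l x₁ x₂ x₃ x₄) := by
  unfold hermiteProd
  fun_prop

namespace IsStdGaussField

lemma integrable_hermiteProd (hX : IsStdGaussField X P) (i j k l : ℕ) (x₁ x₂ x₃ x₄ : ℝ) :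
    Integrable (fun ω => hermiteProd i j k l x₁ x₂ x₃ x₄ (fun y => X y ω)) P := by
  have h := fun n x => hX.integrable_comp x (integrable_He_pow n 4)
  refine ((((h i x₁).add (h j x₂)).add (h k x₃)).add (h l x₄)).mono'
    ((measurable_hermiteProd i j k l x₁ x₂ x₃ x₄).comp hX.meas_path).aestronglyMeasurable
    (ae_of_all _ fun ω => ?_)
  exact abs_mul_four_le _ _ _ _

/-- Integration by parts for mixed Hermite moments. -/
lemma moment4_succ [IsProbabilityMeasure P] (hX : IsStdGaussField X P)
    (i j k l : ℕ) (x₁ x₂ x₃ x₄ : ℝ) :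
    moment4 X P (i + 1) j k l x₁ x₂ x₃ x₄ =
      j * corr X P x₁ x₂ * moment4 X P i (j - 1) k l x₁ x₂ x₃ x₄ +
      k * corr X P x₁ x₃ * moment4 X P i j (k - 1) l x₁ x₂ x₃ x₄ +
      l * corr X P x₁ x₄ * moment4 X P i j k (l - 1) x₁ x₂ x₃ x₄ := by
  -- Pass to the resampled process: its value at x₁ is the independent coordinate n, and its value
  -- at y is affine in n with slope `corr X P x₁ y`. The factor of degree i + 1 is then integrated
  -- by parts in n with ω fixed, and the product rule gives the three terms.
  have hint := fun i j k l => (hX.integrable_path_iff x₁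
    (measurable_hermiteProd i j k l x₁ x₂ x₃ x₄).stronglyMeasurable).1
      (hX.integrable_hermiteProd i j k l x₁ x₂ x₃ x₄)
  have heq : ∀ i j k l, moment4 X P i j k l x₁ x₂ x₃ x₄ = _ := fun i j k l =>
    hX.integral_path_eq x₁ (measurable_hermiteProd i j k l x₁ x₂ x₃ x₄).stronglyMeasurable
  simp only [heq]
  have i1 := (hint i (j - 1) k l).const_mul (j * corr X P x₁ x₂)
  have i2 := (hint i j (k - 1) l).const_mul (k * corr X P x₁ x₃)
  have i3 := (hint i j k (l - 1)).const_mul (l * corr X P x₁ x₄)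
  rw [← integral_const_mul, ← integral_const_mul, ← integral_const_mul, ← integral_add' i1 i2,
    ← integral_add' (i1.add i2) i3, integral_prod _ (hint (i + 1) j k l),
    integral_prod _ ((i1.add i2).add i3)]
  refine integral_congr_ae ?_
  filter_upwards [(hint i j k l).prod_right_ae, (hint (i + 1) j k l).prod_right_ae,
    ((i1.add i2).add i3).prod_right_ae] with ω h0 h1 h2
  have hd : ∀ (m : ℕ) (y n : ℝ), HasDerivAt (fun n => He m (resample X P x₁ (ω, n) y))
      (m * He (m - 1) (resample X P x₁ (ω, n) y) * corr X P x₁ y) n := by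
    intro m y n
    exact (hasDerivAt_He m _).comp n (hX.hasDerivAt_resample x₁ y ω n)
  have key := integral_He_succ_smul (E := ℝ) i
    (fun n => ((hd j x₂ n).mul (hd k x₃ n)).mul (hd l x₄ n)) (h0.congr (ae_of_all _ fun n => by
      simp [hermiteProd, hX.resample_self, mul_assoc])) (h1.congr (ae_of_all _ fun n => by
      simp [hermiteProd, hX.resample_self, mul_assoc])) (h2.congr (ae_of_all _ fun n => by
      simp [hermiteProd, hX.resample_self]; ring))
  convert key using 1
  · refine integral_congr_ae (ae_of_all _ fun n => ?_)
    simp [hermiteProd, hX.resample_self, mul_assoc]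
  · refine integral_congr_ae (ae_of_all _ fun n => ?_)
    simp [hermiteProd, hX.resample_self]; ring

/-- He_0 = 1 forgets its point, so the four slots can be rotated and `moment4_succ` applied to the
first nontrivial one; the edge to the trivial slot has coefficient zero. -/
lemma moment4_zero_succ [IsProbabilityMeasure P] (hX : IsStdGaussField X P)
    (j k l : ℕ) (x₁ x₂ x₃ x₄ : ℝ) :
    moment4 X P 0 (j + 1) k l x₁ x₂ x₃ x₄ =
      k * corr X P x₂ x₃ * moment4 X P 0 j (k - 1) l x₁ x₂ x₃ x₄ +
      l * corr X P x₂ x₄ * moment4 X P 0 j k (l - 1) x₁ x₂ x₃ x₄ := by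
  have e : ∀ j k l, moment4 X P 0 j k l x₁ x₂ x₃ x₄ = moment4 X P j k l 0 x₂ x₃ x₄ x₁ := by
    intro j k l; simp [moment4, hermiteProd, He_zero]
  simp only [e, hX.moment4_succ]
  simp

lemma moment4_zero_zero_succ [IsProbabilityMeasure P] (hX : IsStdGaussField X P)
    (k l : ℕ) (x₁ x₂ x₃ x₄ : ℝ) :
    moment4 X P 0 0 (k + 1) l x₁ x₂ x₃ x₄ =
      l * corr X P x₃ x₄ * moment4 X P 0 0 k (l - 1) x₁ x₂ x₃ x₄ := by
  have e : ∀ k l, moment4 X P 0 0 k l x₁ x₂ x₃ x₄ = moment4 X P k l 0 0 x₃ x₄ x₁ x₂ := by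
    intro k l; simp [moment4, hermiteProd, He_zero]
  simp only [e, hX.moment4_succ]
  simp

lemma moment4_zero_zero_zero (hX : IsStdGaussField X P) (l : ℕ) (x₁ x₂ x₃ x₄ : ℝ) :
    moment4 X P 0 0 0 l x₁ x₂ x₃ x₄ = if l = 0 then 1 else 0 := by
  have := integral_He_mul_He l 0
  simp only [He_zero, mul_one] at this
  simp only [moment4, hermiteProd, He_zero, one_mul]
  rw [hX.integral_comp x₄ (measurable_He l).aestronglyMeasurable, this]
  split_ifs with h
  · simp [h]
  · rfl

end IsStdGaussField

end GaussianIncrementCLT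

/-! ### Diagram bounds for mixed Hermite moments. -/

namespace GaussianIncrementCLT

/-- Labels on the edges of the complete graph on four vertices. -/
structure Edges (α : Type*) where
  e12 : α
  e13 : α
  e14 : α
  e23 : α
  e24 : α
  e34 : α

/-- The weight of a multigraph `a` for the edge weights `r`. -/
noncomputable def weight (r : Edges ℝ) (a : Edges ℕ) : ℝ :=
  |r.e12| ^ a.e12 * |r.e13| ^ a.e13 * |r.e14| ^ a.e14 * |r.e23| ^ a.e23 * |r.e24| ^ a.e24 *
    |r.e34| ^ a.e34

/-- Multigraphs on four vertices with prescribed degrees. -/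
def IsDiag (a : Edges ℕ) (i j k l : ℕ) : Prop :=
  a.e12 + a.e13 + a.e14 = i ∧ a.e12 + a.e23 + a.e24 = j ∧ a.e13 + a.e23 + a.e34 = k ∧
    a.e14 + a.e24 + a.e34 = l

/-- `R` times the weight of any diagram with the given degrees is at most `K`. -/
def DiagBound (r : Edges ℝ) (R K : ℝ) (i j k l : ℕ) : Prop :=
  ∀ a, IsDiag a i j k l → R * weight r a ≤ K

/-- `R` times the weight of any diagram with the given degrees and an edge between `{1, 2}` and
`{3, 4}` is at most `K`. -/
def CrossBound (r : Edges ℝ) (R K : ℝ) (i j k l : ℕ) : Prop :=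
  ∀ a, IsDiag a i j k l → 1 ≤ a.e13 + a.e14 + a.e23 + a.e24 → R * weight r a ≤ K

/-- The recursion satisfied by mixed Hermite moments of a Gaussian vector. -/
structure MomentRec (M : ℕ → ℕ → ℕ → ℕ → ℝ) (r : Edges ℝ) : Prop where
  succ : ∀ i j k l, M (i + 1) j k l = j * r.e12 * M i (j - 1) k l + k * r.e13 * M i j (k - 1) l +
    l * r.e14 * M i j k (l - 1)
  zero_succ : ∀ j k l, M 0 (j + 1) k l = k * r.e23 * M 0 j (k - 1) l + l * r.e24 * M 0 j k (l - 1)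
  zero_zero_succ : ∀ k l, M 0 0 (k + 1) l = l * r.e34 * M 0 0 k (l - 1)
  zero_zero_zero : ∀ l, M 0 0 0 l = if l = 0 then 1 else 0

/-- The covariance of Hermite polynomials of two variables with correlation `r`. -/
noncomputable def pairMoment (i j : ℕ) (r : ℝ) : ℝ := if i = j then (i.factorial : ℝ) * r ^ i else 0

/-- The same recursion as the term of edge 12 in `MomentRec.succ`; this is what lets the product of
pair moments be subtracted inductively. -/
lemma pairMoment_succ (i j : ℕ) (r : ℝ) :
    pairMoment (i + 1) j r = j * r * pairMoment i (j - 1) r := by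
  unfold pairMoment
  cases j with
  | zero => simp
  | succ j =>
    by_cases h : i = j
    · subst h; simp [Nat.factorial_succ]; ring
    · simp [h]

lemma MomentRec.zero_zero {M : ℕ → ℕ → ℕ → ℕ → ℝ} {r : Edges ℝ} (h : MomentRec M r) (k l : ℕ) :
    M 0 0 k l = pairMoment k l r.e34 := by
  induction k generalizing l with
  | zero => rw [h.zero_zero_zero]; simp [pairMoment, eq_comm]
  | succ k ih => rw [h.zero_zero_succ, ih, pairMoment_succ]

section steps

variable {r : Edges ℝ} {R K : ℝ} {i j k l : ℕ}

/-- R collects the weights of the edges already drawn. Adding the edge back to a diagram of the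
lower degrees gives an admissible diagram of the higher degrees, so the bound K never changes. -/
lemma DiagBound.step12 (h : DiagBound r R K (i + 1) (j + 1) k l) :
    DiagBound r (R * |r.e12|) K i j k l := fun a ha => by
  obtain ⟨h1, h2, h3, h4⟩ := ha
  refine le_of_eq_of_le ?_ (h { a with e12 := a.e12 + 1 } ⟨?_, ?_, ?_, ?_⟩)
  · simp only [weight]; ring
  all_goals simp only; omega

/-- An edge 12 does not join the two pairs, so the requirement of a crossing edge persists. -/
lemma CrossBound.step12 (h : CrossBound r R K (i + 1) (j + 1) k l) :
    CrossBound r (R * |r.e12|) K i j k l := fun a ha hc => by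
  obtain ⟨h1, h2, h3, h4⟩ := ha
  refine le_of_eq_of_le ?_ (h { a with e12 := a.e12 + 1 } ⟨?_, ?_, ?_, ?_⟩ hc)
  · simp only [weight]; ring
  all_goals simp only; omega

/-- Once a crossing edge has been drawn the rest of the diagram is free, so the restricted bound
becomes the unrestricted one. -/
lemma CrossBound.step13 (h : CrossBound r R K (i + 1) j (k + 1) l) :
    DiagBound r (R * |r.e13|) K i j k l := fun a ha => by
  obtain ⟨h1, h2, h3, h4⟩ := ha
  refine le_of_eq_of_le ?_ (h { a with e13 := a.e13 + 1 } ⟨?_, ?_, ?_, ?_⟩ ?_)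
  · simp only [weight]; ring
  all_goals simp only; omega

lemma CrossBound.step14 (h : CrossBound r R K (i + 1) j k (l + 1)) :
    DiagBound r (R * |r.e14|) K i j k l := fun a ha => by
  obtain ⟨h1, h2, h3, h4⟩ := ha
  refine le_of_eq_of_le ?_ (h { a with e14 := a.e14 + 1 } ⟨?_, ?_, ?_, ?_⟩ ?_)
  · simp only [weight]; ring
  all_goals simp only; omega

lemma CrossBound.step23 (h : CrossBound r R K i (j + 1) (k + 1) l) :
    DiagBound r (R * |r.e23|) K i j k l := fun a ha => by
  obtain ⟨h1, h2, h3, h4⟩ := ha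
  refine le_of_eq_of_le ?_ (h { a with e23 := a.e23 + 1 } ⟨?_, ?_, ?_, ?_⟩ ?_)
  · simp only [weight]; ring
  all_goals simp only; omega

lemma CrossBound.step24 (h : CrossBound r R K i (j + 1) k (l + 1)) :
    DiagBound r (R * |r.e24|) K i j k l := fun a ha => by
  obtain ⟨h1, h2, h3, h4⟩ := ha
  refine le_of_eq_of_le ?_ (h { a with e24 := a.e24 + 1 } ⟨?_, ?_, ?_, ?_⟩ ?_)
  · simp only [weight]; ring
  all_goals simp only; omega

lemma DiagBound.step34 (h : DiagBound r R K i j (k + 1) (l + 1)) :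
    DiagBound r (R * |r.e34|) K i j k l := fun a ha => by
  obtain ⟨h1, h2, h3, h4⟩ := ha
  refine le_of_eq_of_le ?_ (h { a with e34 := a.e34 + 1 } ⟨?_, ?_, ?_, ?_⟩)
  · simp only [weight]; ring
  all_goals simp only; omega

lemma DiagBound.cross (h : DiagBound r R K i j k l) : CrossBound r R K i j k l :=
  fun a ha _ => h a ha

end steps

lemma mul_abs_nat_mul_le {R r M B : ℝ} (n : ℕ) (h : R * |r| * |M| ≤ B) :
    R * |n * r * M| ≤ n * B := by
  rw [abs_mul, abs_mul, Nat.abs_cast]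
  calc R * (n * |r| * |M|) = n * (R * |r| * |M|) := by ring
    _ ≤ n * B := by gcongr

/-- The mixed moments are bounded by the diagrams with the given degrees. -/
lemma exists_moment_le (i j k l : ℕ) : ∃ C : ℝ, ∀ (r : Edges ℝ) (M : ℕ → ℕ → ℕ → ℕ → ℝ),
    MomentRec M r → ∀ R K : ℝ, 0 ≤ R → DiagBound r R K i j k l → R * |M i j k l| ≤ C * K := by
  -- The recursion draws the edges one at a time, always from the first vertex with positive degree.
  -- C depends on the degrees alone, not on the correlations.
  induction i generalizing j k l with
  | zero =>
    induction j generalizing k l with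
    | zero =>
      induction k generalizing l with
      | zero =>
        refine ⟨if l = 0 then 1 else 0, fun r M hM R K hR h => ?_⟩
        rw [hM.zero_zero_zero]
        split_ifs with hl
        · have := h ⟨0, 0, 0, 0, 0, 0⟩ ⟨rfl, rfl, rfl, hl.symm⟩
          simpa [weight] using this
        · simp
      | succ k ih =>
        cases l with
        | zero => exact ⟨0, fun r M hM R K hR h => by simp [hM.zero_zero_succ]⟩
        | succ l =>
          obtain ⟨C, hC⟩ := ih l
          refine ⟨(l + 1 : ℕ) * C, fun r M hM R K hR h => ?_⟩
          rw [hM.zero_zero_succ, mul_assoc (((l + 1 : ℕ) : ℝ)) C]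
          exact mul_abs_nat_mul_le _ (hC r M hM _ K (by positivity) h.step34)
    | succ j ih =>
      have hk : ∃ C : ℝ, ∀ (r : Edges ℝ) (M : ℕ → ℕ → ℕ → ℕ → ℝ), MomentRec M r → ∀ R K : ℝ,
          0 ≤ R → DiagBound r R K 0 (j + 1) k l →
          R * |k * r.e23 * M 0 j (k - 1) l| ≤ C * K := by
        cases k with
        | zero => exact ⟨0, fun r M hM R K hR h => by simp⟩
        | succ k =>
          obtain ⟨C, hC⟩ := ih k l
          refine ⟨(k + 1 : ℕ) * C, fun r M hM R K hR h => ?_⟩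
          rw [mul_assoc (((k + 1 : ℕ) : ℝ)) C]
          exact mul_abs_nat_mul_le _ (hC r M hM _ K (by positivity) h.cross.step23)
      have hl : ∃ C : ℝ, ∀ (r : Edges ℝ) (M : ℕ → ℕ → ℕ → ℕ → ℝ), MomentRec M r → ∀ R K : ℝ,
          0 ≤ R → DiagBound r R K 0 (j + 1) k l →
          R * |l * r.e24 * M 0 j k (l - 1)| ≤ C * K := by
        cases l with
        | zero => exact ⟨0, fun r M hM R K hR h => by simp⟩
        | succ l =>
          obtain ⟨C, hC⟩ := ih k l
          refine ⟨(l + 1 : ℕ) * C, fun r M hM R K hR h => ?_⟩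
          rw [mul_assoc (((l + 1 : ℕ) : ℝ)) C]
          exact mul_abs_nat_mul_le _ (hC r M hM _ K (by positivity) h.cross.step24)
      obtain ⟨C₁, h₁⟩ := hk
      obtain ⟨C₂, h₂⟩ := hl
      refine ⟨C₁ + C₂, fun r M hM R K hR h => ?_⟩
      rw [hM.zero_succ, add_mul]
      refine le_trans ?_ (add_le_add (h₁ r M hM R K hR h) (h₂ r M hM R K hR h))
      rw [← mul_add]
      exact mul_le_mul_of_nonneg_left (abs_add_le _ _) hR
  | succ i ih =>
    have hj : ∃ C : ℝ, ∀ (r : Edges ℝ) (M : ℕ → ℕ → ℕ → ℕ → ℝ), MomentRec M r → ∀ R K : ℝ,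
        0 ≤ R → DiagBound r R K (i + 1) j k l →
        R * |j * r.e12 * M i (j - 1) k l| ≤ C * K := by
      cases j with
      | zero => exact ⟨0, fun r M hM R K hR h => by simp⟩
      | succ j =>
        obtain ⟨C, hC⟩ := ih j k l
        refine ⟨(j + 1 : ℕ) * C, fun r M hM R K hR h => ?_⟩
        rw [mul_assoc (((j + 1 : ℕ) : ℝ)) C]
        exact mul_abs_nat_mul_le _ (hC r M hM _ K (by positivity) h.step12)
    have hk : ∃ C : ℝ, ∀ (r : Edges ℝ) (M : ℕ → ℕ → ℕ → ℕ → ℝ), MomentRec M r → ∀ R K : ℝ,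
        0 ≤ R → DiagBound r R K (i + 1) j k l →
        R * |k * r.e13 * M i j (k - 1) l| ≤ C * K := by
      cases k with
      | zero => exact ⟨0, fun r M hM R K hR h => by simp⟩
      | succ k =>
        obtain ⟨C, hC⟩ := ih j k l
        refine ⟨(k + 1 : ℕ) * C, fun r M hM R K hR h => ?_⟩
        rw [mul_assoc (((k + 1 : ℕ) : ℝ)) C]
        exact mul_abs_nat_mul_le _ (hC r M hM _ K (by positivity) h.cross.step13)
    have hl : ∃ C : ℝ, ∀ (r : Edges ℝ) (M : ℕ → ℕ → ℕ → ℕ → ℝ), MomentRec M r → ∀ R K : ℝ,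
        0 ≤ R → DiagBound r R K (i + 1) j k l →
        R * |l * r.e14 * M i j k (l - 1)| ≤ C * K := by
      cases l with
      | zero => exact ⟨0, fun r M hM R K hR h => by simp⟩
      | succ l =>
        obtain ⟨C, hC⟩ := ih j k l
        refine ⟨(l + 1 : ℕ) * C, fun r M hM R K hR h => ?_⟩
        rw [mul_assoc (((l + 1 : ℕ) : ℝ)) C]
        exact mul_abs_nat_mul_le _ (hC r M hM _ K (by positivity) h.cross.step14)
    obtain ⟨C₁, h₁⟩ := hj
    obtain ⟨C₂, h₂⟩ := hk
    obtain ⟨C₃, h₃⟩ := hl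
    refine ⟨C₁ + C₂ + C₃, fun r M hM R K hR h => ?_⟩
    rw [hM.succ, add_mul, add_mul]
    refine le_trans ?_ (add_le_add (add_le_add (h₁ r M hM R K hR h) (h₂ r M hM R K hR h))
      (h₃ r M hM R K hR h))
    rw [← mul_add, ← mul_add]
    exact mul_le_mul_of_nonneg_left (abs_add_three _ _ _) hR

/-- The covariance of products of Hermite polynomials is bounded by the diagrams with an edge
between the two pairs. -/
lemma exists_cov_le (i j k l : ℕ) : ∃ C : ℝ, ∀ (r : Edges ℝ) (M : ℕ → ℕ → ℕ → ℕ → ℝ),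
    MomentRec M r → ∀ R K : ℝ, 0 ≤ R → CrossBound r R K i j k l →
      R * |M i j k l - pairMoment i j r.e12 * pairMoment k l r.e34| ≤ C * K := by
  induction i generalizing j k l with
  | zero =>
    cases j with
    | zero =>
      -- With degrees 0 in the first pair the moment is exactly the pair moment of the second, so
      -- the covariance vanishes.
      refine ⟨0, fun r M hM R K hR h => ?_⟩
      simp [hM.zero_zero, pairMoment]
    | succ j =>
      have hk : ∃ C : ℝ, ∀ (r : Edges ℝ) (M : ℕ → ℕ → ℕ → ℕ → ℝ), MomentRec M r → ∀ R K : ℝ,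
          0 ≤ R → CrossBound r R K 0 (j + 1) k l →
          R * |k * r.e23 * M 0 j (k - 1) l| ≤ C * K := by
        cases k with
        | zero => exact ⟨0, fun r M hM R K hR h => by simp⟩
        | succ k =>
          obtain ⟨C, hC⟩ := exists_moment_le 0 j k l
          refine ⟨(k + 1 : ℕ) * C, fun r M hM R K hR h => ?_⟩
          rw [mul_assoc (((k + 1 : ℕ) : ℝ)) C]
          exact mul_abs_nat_mul_le _ (hC r M hM _ K (by positivity) h.step23)
      have hl : ∃ C : ℝ, ∀ (r : Edges ℝ) (M : ℕ → ℕ → ℕ → ℕ → ℝ), MomentRec M r → ∀ R K : ℝ,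
          0 ≤ R → CrossBound r R K 0 (j + 1) k l →
          R * |l * r.e24 * M 0 j k (l - 1)| ≤ C * K := by
        cases l with
        | zero => exact ⟨0, fun r M hM R K hR h => by simp⟩
        | succ l =>
          obtain ⟨C, hC⟩ := exists_moment_le 0 j k l
          refine ⟨(l + 1 : ℕ) * C, fun r M hM R K hR h => ?_⟩
          rw [mul_assoc (((l + 1 : ℕ) : ℝ)) C]
          exact mul_abs_nat_mul_le _ (hC r M hM _ K (by positivity) h.step24)
      obtain ⟨C₁, h₁⟩ := hk
      obtain ⟨C₂, h₂⟩ := hl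
      refine ⟨C₁ + C₂, fun r M hM R K hR h => ?_⟩
      have hp : pairMoment 0 (j + 1) r.e12 = 0 := by simp [pairMoment]
      rw [hM.zero_succ, hp, zero_mul, sub_zero, add_mul]
      refine le_trans ?_ (add_le_add (h₁ r M hM R K hR h) (h₂ r M hM R K hR h))
      rw [← mul_add]
      exact mul_le_mul_of_nonneg_left (abs_add_le _ _) hR
  | succ i ih =>
    -- Drawing an edge 12 keeps the form of a covariance, so induction applies. In the other two
    -- terms the drawn edge already crosses, and the plain moment bound suffices.
    have hj : ∃ C : ℝ, ∀ (r : Edges ℝ) (M : ℕ → ℕ → ℕ → ℕ → ℝ), MomentRec M r → ∀ R K : ℝ,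
        0 ≤ R → CrossBound r R K (i + 1) j k l →
        R * |j * r.e12 * (M i (j - 1) k l
          - pairMoment i (j - 1) r.e12 * pairMoment k l r.e34)| ≤ C * K := by
      cases j with
      | zero => exact ⟨0, fun r M hM R K hR h => by simp⟩
      | succ j =>
        obtain ⟨C, hC⟩ := ih j k l
        refine ⟨(j + 1 : ℕ) * C, fun r M hM R K hR h => ?_⟩
        rw [mul_assoc (((j + 1 : ℕ) : ℝ)) C]
        exact mul_abs_nat_mul_le _ (hC r M hM _ K (by positivity) h.step12)
    have hk : ∃ C : ℝ, ∀ (r : Edges ℝ) (M : ℕ → ℕ → ℕ → ℕ → ℝ), MomentRec M r → ∀ R K : ℝ,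
        0 ≤ R → CrossBound r R K (i + 1) j k l →
        R * |k * r.e13 * M i j (k - 1) l| ≤ C * K := by
      cases k with
      | zero => exact ⟨0, fun r M hM R K hR h => by simp⟩
      | succ k =>
        obtain ⟨C, hC⟩ := exists_moment_le i j k l
        refine ⟨(k + 1 : ℕ) * C, fun r M hM R K hR h => ?_⟩
        rw [mul_assoc (((k + 1 : ℕ) : ℝ)) C]
        exact mul_abs_nat_mul_le _ (hC r M hM _ K (by positivity) h.step13)
    have hl : ∃ C : ℝ, ∀ (r : Edges ℝ) (M : ℕ → ℕ → ℕ → ℕ → ℝ), MomentRec M r → ∀ R K : ℝ,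
        0 ≤ R → CrossBound r R K (i + 1) j k l →
        R * |l * r.e14 * M i j k (l - 1)| ≤ C * K := by
      cases l with
      | zero => exact ⟨0, fun r M hM R K hR h => by simp⟩
      | succ l =>
        obtain ⟨C, hC⟩ := exists_moment_le i j k l
        refine ⟨(l + 1 : ℕ) * C, fun r M hM R K hR h => ?_⟩
        rw [mul_assoc (((l + 1 : ℕ) : ℝ)) C]
        exact mul_abs_nat_mul_le _ (hC r M hM _ K (by positivity) h.step14)
    obtain ⟨C₁, h₁⟩ := hj
    obtain ⟨C₂, h₂⟩ := hk
    obtain ⟨C₃, h₃⟩ := hl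
    refine ⟨C₁ + C₂ + C₃, fun r M hM R K hR h => ?_⟩
    rw [hM.succ, pairMoment_succ, add_mul, add_mul]
    refine le_trans ?_ (add_le_add (add_le_add (h₁ r M hM R K hR h) (h₂ r M hM R K hR h))
      (h₃ r M hM R K hR h))
    rw [← mul_add, ← mul_add]
    refine mul_le_mul_of_nonneg_left (le_trans (le_of_eq ?_) (abs_add_three _ _ _)) hR
    congr 1
    ring

/-- The majorant of the connected diagrams all of whose degrees are at least `d`. -/
noncomputable def majorant (d : ℕ) (r : Edges ℝ) : ℝ :=
  |r.e12| ^ d * |r.e34| ^ d * (|r.e13| + |r.e14| + |r.e23| + |r.e24|) +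
    ∑ u ∈ Finset.Ico 1 d, (|r.e12| * |r.e34|) ^ u *
      ((|r.e13| * |r.e24|) ^ (d - u) + (|r.e14| * |r.e23|) ^ (d - u))

/-- Replace the smaller base by the larger one and lower the exponent to e. -/
lemma pow_mul_pow_le_add {a b : ℝ} (ha : 0 ≤ a) (ha1 : a ≤ 1) (hb : 0 ≤ b) (hb1 : b ≤ 1)
    {m n e : ℕ} (h : e ≤ m + n) : a ^ m * b ^ n ≤ a ^ e + b ^ e := by
  rcases le_total a b with hab | hab
  · calc a ^ m * b ^ n ≤ b ^ m * b ^ n := by gcongr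
      _ = b ^ (m + n) := (pow_add _ _ _).symm
      _ ≤ b ^ e := pow_le_pow_of_le_one hb hb1 h
      _ ≤ a ^ e + b ^ e := le_add_of_nonneg_left (by positivity)
  · calc a ^ m * b ^ n ≤ a ^ m * a ^ n := by gcongr
      _ = a ^ (m + n) := (pow_add _ _ _).symm
      _ ≤ a ^ e := pow_le_pow_of_le_one ha ha1 h
      _ ≤ a ^ e + b ^ e := le_add_of_nonneg_right (by positivity)

/-- Degrees (i, j, i, j) force a₃₄ = a₁₂ and a₂₃ = a₁₄, and the prefactor raises the multiplicity of
edges 12 and 34 to u = a₁₂ + 1. If u ≥ d, keep d copies of each and one crossing edge. If u < d, the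
degree bounds leave at least d - u crossing edges at every vertex, and they pair up as 13 with 24 or
as 14 with 23. -/
lemma crossBound_majorant {r : Edges ℝ} (h12 : |r.e12| ≤ 1) (h13 : |r.e13| ≤ 1)
    (h14 : |r.e14| ≤ 1) (h23 : |r.e23| ≤ 1) (h24 : |r.e24| ≤ 1) (h34 : |r.e34| ≤ 1)
    {d i j : ℕ} (hi : d ≤ i + 1) (hj : d ≤ j + 1) :
    CrossBound r (|r.e12| * |r.e34|) (majorant d r) i j i j := by
  rintro ⟨a12, a13, a14, a23, a24, a34⟩ ⟨h1, h2, h3, h4⟩ hc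
  simp only at h1 h2 h3 h4 hc
  have e34 : a34 = a12 := by omega
  have e23 : a23 = a14 := by omega
  subst e34 e23
  simp only [weight, majorant]
  generalize hr12 : |r.e12| = r12 at *
  generalize hr13 : |r.e13| = r13 at *
  generalize hr14 : |r.e14| = r14 at *
  generalize hr23 : |r.e23| = r23 at *
  generalize hr24 : |r.e24| = r24 at *
  generalize hr34 : |r.e34| = r34 at *
  have p12 : 0 ≤ r12 := hr12 ▸ abs_nonneg _
  have p13 : 0 ≤ r13 := hr13 ▸ abs_nonneg _
  have p14 : 0 ≤ r14 := hr14 ▸ abs_nonneg _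
  have p23 : 0 ≤ r23 := hr23 ▸ abs_nonneg _
  have p24 : 0 ≤ r24 := hr24 ▸ abs_nonneg _
  have p34 : 0 ≤ r34 := hr34 ▸ abs_nonneg _
  have hsum : ∀ u ∈ Finset.Ico 1 d, 0 ≤ (r12 * r34) ^ u *
      ((r13 * r24) ^ (d - u) + (r14 * r23) ^ (d - u)) := fun u _ => by positivity
  by_cases hu : d ≤ a34 + 1
  · refine le_trans ?_ (le_add_of_nonneg_right (Finset.sum_nonneg hsum))
    have hX : r13 ^ a13 * r14 ^ a23 * r23 ^ a23 * r24 ^ a24 ≤ r13 + r14 + r23 + r24 := by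
      have q13 := pow_le_one₀ p13 h13 (n := a13)
      have q14 := pow_le_one₀ p14 h14 (n := a23)
      have q23 := pow_le_one₀ p23 h23 (n := a23)
      have q24 := pow_le_one₀ p24 h24 (n := a24)
      rcases Nat.eq_zero_or_pos a13 with h | h
      · rcases Nat.eq_zero_or_pos a23 with h' | h'
        · have : r24 ^ a24 ≤ r24 := pow_le_of_le_one p24 h24 (by omega)
          subst h h'; simp only [pow_zero, one_mul]; linarith
        · have : r14 ^ a23 ≤ r14 := pow_le_of_le_one p14 h14 (by omega)
          calc r13 ^ a13 * r14 ^ a23 * r23 ^ a23 * r24 ^ a24 ≤ 1 * r14 * 1 * 1 := by gcongr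
            _ ≤ _ := by linarith
      · have : r13 ^ a13 ≤ r13 := pow_le_of_le_one p13 h13 (by omega)
        calc r13 ^ a13 * r14 ^ a23 * r23 ^ a23 * r24 ^ a24 ≤ r13 * 1 * 1 * 1 := by gcongr
          _ ≤ _ := by linarith
    have hA : r12 ^ (a34 + 1) ≤ r12 ^ d := pow_le_pow_of_le_one p12 h12 hu
    have hB : r34 ^ (a34 + 1) ≤ r34 ^ d := pow_le_pow_of_le_one p34 h34 hu
    calc r12 * r34 * (r12 ^ a34 * r13 ^ a13 * r14 ^ a23 * r23 ^ a23 * r24 ^ a24 * r34 ^ a34)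
        = r12 ^ (a34 + 1) * r34 ^ (a34 + 1) *
          (r13 ^ a13 * r14 ^ a23 * r23 ^ a23 * r24 ^ a24) := by ring
      _ ≤ _ := by gcongr
  · have hmem : a34 + 1 ∈ Finset.Ico 1 d := Finset.mem_Ico.2 ⟨by omega, by omega⟩
    refine le_trans ?_ (le_add_of_nonneg_left (by positivity))
    refine le_trans ?_ (Finset.single_le_sum hsum hmem)
    -- The multiplicities of 13 and 24 may differ; the smaller one together with a₂₃ still reaches d
    -- - u, whichever of the two it is.
    have hm : r13 ^ a13 * r24 ^ a24 ≤ (r13 * r24) ^ min a13 a24 := by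
      rw [mul_pow]
      exact mul_le_mul (pow_le_pow_of_le_one p13 h13 (min_le_left _ _))
        (pow_le_pow_of_le_one p24 h24 (min_le_right _ _)) (by positivity) (by positivity)
    have hY := pow_mul_pow_le_add (a := r13 * r24) (b := r14 * r23) (by positivity)
      (mul_le_one₀ h13 p24 h24) (by positivity) (mul_le_one₀ h14 p23 h23)
      (m := min a13 a24) (n := a23) (e := d - (a34 + 1)) (by omega)
    calc r12 * r34 * (r12 ^ a34 * r13 ^ a13 * r14 ^ a23 * r23 ^ a23 * r24 ^ a24 * r34 ^ a34)
        = (r12 * r34) ^ (a34 + 1) * ((r13 ^ a13 * r24 ^ a24) * (r14 * r23) ^ a23) := by ring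
      _ ≤ (r12 * r34) ^ (a34 + 1) * ((r13 * r24) ^ min a13 a24 * (r14 * r23) ^ a23) := by gcongr
      _ ≤ _ := by gcongr

variable {Ω : Type*} [MeasurableSpace Ω] {P : Measure Ω} {X : ℝ → Ω → ℝ}

/-- The correlations between four values of a process. -/
noncomputable def corrEdges (X : ℝ → Ω → ℝ) (P : Measure Ω) (x₁ x₂ x₃ x₄ : ℝ) : Edges ℝ :=
  ⟨corr X P x₁ x₂, corr X P x₁ x₃, corr X P x₁ x₄, corr X P x₂ x₃, corr X P x₂ x₄, corr X P x₃ x₄⟩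

namespace IsStdGaussField

lemma momentRec [IsProbabilityMeasure P] (hX : IsStdGaussField X P) (x₁ x₂ x₃ x₄ : ℝ) :
    MomentRec (fun i j k l => moment4 X P i j k l x₁ x₂ x₃ x₄) (corrEdges X P x₁ x₂ x₃ x₄) where
  succ i j k l := hX.moment4_succ i j k l x₁ x₂ x₃ x₄
  zero_succ j k l := hX.moment4_zero_succ j k l x₁ x₂ x₃ x₄
  zero_zero_succ k l := hX.moment4_zero_zero_succ k l x₁ x₂ x₃ x₄
  zero_zero_zero l := hX.moment4_zero_zero_zero l x₁ x₂ x₃ x₄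

/-- The covariance of Hermite polynomials of two values of the process. -/
lemma integral_He_mul_He_comp [IsProbabilityMeasure P] (hX : IsStdGaussField X P) (i j : ℕ)
    (x y : ℝ) : ∫ ω, He i (X x ω) * He j (X y ω) ∂P = pairMoment i j (corr X P x y) := by
  have := (hX.momentRec x x x y).zero_zero i j
  simpa [moment4, hermiteProd, He_zero, corrEdges] using this

end IsStdGaussField

/-- The constant is chosen before the field and the points, so it is uniform in h. The hypotheses
are d ≤ i + 1 and d ≤ j + 1 because the Stein kernel involves polynomials with degree lowered by
one. -/
lemma exists_covariance_le (i j d : ℕ) (hi : d ≤ i + 1) (hj : d ≤ j + 1) : ∃ C : ℝ, 0 ≤ C ∧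
    ∀ {Ω : Type*} [MeasurableSpace Ω] (P : Measure Ω) [IsProbabilityMeasure P] (X : ℝ → Ω → ℝ),
      IsStdGaussField X P → ∀ x₁ x₂ x₃ x₄,
      |corr X P x₁ x₂ * corr X P x₃ x₄ * (moment4 X P i j i j x₁ x₂ x₃ x₄ -
        pairMoment i j (corr X P x₁ x₂) * pairMoment i j (corr X P x₃ x₄))| ≤
      C * majorant d (corrEdges X P x₁ x₂ x₃ x₄) := by
  obtain ⟨C, hC⟩ := exists_cov_le i j i j
  refine ⟨|C|, abs_nonneg C, fun P _ X hX x₁ x₂ x₃ x₄ => ?_⟩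
  have h := hC _ _ (hX.momentRec x₁ x₂ x₃ x₄) _ _ (by positivity) (crossBound_majorant
    (hX.abs_corr_le _ _) (hX.abs_corr_le _ _) (hX.abs_corr_le _ _) (hX.abs_corr_le _ _)
    (hX.abs_corr_le _ _) (hX.abs_corr_le _ _) hi hj)
  have hK : 0 ≤ majorant d (corrEdges X P x₁ x₂ x₃ x₄) := by unfold majorant; positivity
  rw [abs_mul, abs_mul]
  exact h.trans (mul_le_mul_of_nonneg_right (le_abs_self C) hK)

end GaussianIncrementCLT

/-! ### Time integrals of processes with equal path laws. -/

namespace GaussianIncrementCLT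

/-- For almost every sequence of independent sample points, the averages of a jointly measurable
process over the sample points converge almost surely to its integral. -/
lemma ae_tendsto_average {Ω : Type*} [MeasurableSpace Ω] {P : Measure Ω} [SFinite P]
    {π : Measure ℝ} [IsProbabilityMeasure π] {Y : ℝ → Ω → ℝ} (hY : Measurable (Function.uncurry Y))
    (hint : Integrable (Function.uncurry Y) (π.prod P)) :
    ∀ᵐ u ∂(Measure.infinitePi fun _ : ℕ => π), ∀ᵐ ω ∂P,
      Tendsto (fun n : ℕ => (∑ i ∈ Finset.range n, Y (u i) ω) / n) atTop
        (𝓝 (∫ y, Y y ω ∂π)) := by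
  have hm : MeasurableSet {x : (ℕ → ℝ) × Ω |
      Tendsto (fun n : ℕ => (∑ i ∈ Finset.range n, Y (x.1 i) x.2) / n) atTop
        (𝓝 (∫ y, Y y x.2 ∂π))} := by
    refine measurableSet_tendsto_fun (fun n => Measurable.div_const
      (Finset.measurable_fun_sum _ fun i _ => ?_) _) ?_
    · have h1 : Measurable fun x : (ℕ → ℝ) × Ω => x.1 i :=
        (measurable_pi_apply i).comp measurable_fst
      exact hY.comp (h1.prodMk measurable_snd)
    · have : StronglyMeasurable fun ω => ∫ y, Y y ω ∂π :=
        (hY.comp measurable_swap).stronglyMeasurable.integral_prod_right'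
      exact this.measurable.comp measurable_snd
  rw [Measure.ae_ae_comm hm]
  filter_upwards [hint.prod_left_ae] with ω hω
  have hYω : Measurable fun y => Y y ω := hY.comp measurable_prodMk_right
  have hlaw : ∀ i : ℕ, (Measure.infinitePi fun _ : ℕ => π).map (fun u => u i) = π := fun i =>
    Measure.infinitePi_map_eval (fun _ => π) i
  have h := strong_law_ae_real (μ := Measure.infinitePi fun _ : ℕ => π)
    (fun i u => Y (u i) ω) ?_ (fun i j hij => ?_) (fun i => ?_)
  · have e : ∫ u, Y (u 0) ω ∂(Measure.infinitePi fun _ : ℕ => π) = ∫ y, Y y ω ∂π := by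
      conv_rhs => rw [← hlaw 0]
      rw [integral_map (measurable_pi_apply 0).aemeasurable hYω.aestronglyMeasurable]
    rw [e] at h
    exact h
  · have hi : Integrable (fun y => Y y ω) π := hω
    rw [← hlaw 0] at hi
    exact hi.comp_measurable (by fun_prop)
  · exact (iIndepFun_infinitePi (P := fun _ : ℕ => π) (X := fun _ y => Y y ω)
      fun _ => hYω).indepFun hij
  · refine IdentDistrib.comp (u := fun y => Y y ω) ⟨(measurable_pi_apply i).aemeasurable,
      (measurable_pi_apply 0).aemeasurable, ?_⟩ hYω
    rw [hlaw, hlaw]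

lemma norm_cexp_mul_I (s : ℝ) : ‖Complex.exp (s * Complex.I)‖ = 1 :=
  Complex.norm_exp_ofReal_mul_I s

/-- Two jointly measurable processes with the same law have the same joint laws of path
functionals and time integrals. -/
lemma integral_smul_cexp_integral_eq {Ω Ω' : Type*} [MeasurableSpace Ω] [MeasurableSpace Ω']
    {P : Measure Ω} {P' : Measure Ω'} [IsProbabilityMeasure P] [IsProbabilityMeasure P']
    {X : ℝ → Ω → ℝ} {X' : ℝ → Ω' → ℝ}
    (hX : Measurable (Function.uncurry X)) (hX' : Measurable (Function.uncurry X'))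
    (hlaw : P.map (fun ω y => X y ω) = P'.map (fun ω y => X' y ω))
    {ν : Measure ℝ} [IsFiniteMeasure ν] [NeZero ν] {p : ℝ → ℝ} (hp : Measurable p)
    (hint : Integrable (fun q : ℝ × Ω => p (X q.1 q.2)) (ν.prod P))
    (hint' : Integrable (fun q : ℝ × Ω' => p (X' q.1 q.2)) (ν.prod P'))
    {ψ : (ℝ → ℝ) → ℝ} (hψ : Measurable ψ) (hψi : Integrable (fun ω => ψ fun y => X y ω) P)
    (s : ℝ) :
    ∫ ω, ψ (fun y => X y ω) • Complex.exp ((s * ∫ y, p (X y ω) ∂ν : ℝ) * Complex.I) ∂P =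
      ∫ ω, ψ (fun y => X' y ω) • Complex.exp ((s * ∫ y, p (X' y ω) ∂ν : ℝ) * Complex.I) ∂P' := by
  have hXp : Measurable fun ω y => X y ω :=
    measurable_pi_lambda _ fun y => hX.comp measurable_prodMk_left
  have hXp' : Measurable fun ω y => X' y ω :=
    measurable_pi_lambda _ fun y => hX'.comp measurable_prodMk_left
  have hψi' : Integrable (fun ω => ψ fun y => X' y ω) P' := by
    have h1 := integrable_map_measure (μ := P) (f := fun ω y => X y ω)
      hψ.aestronglyMeasurable hXp.aemeasurable
    have h2 := integrable_map_measure (μ := P') (f := fun ω y => X' y ω)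
      hψ.aestronglyMeasurable hXp'.aemeasurable
    rw [hlaw] at h1
    exact h2.1 (h1.2 hψi)
  set c : ℝ := (ν Set.univ).toReal with hc
  -- Random sample times need a probability measure; c restores the mass of ν.
  set π : Measure ℝ := (ν Set.univ)⁻¹ • ν with hπ
  have hν0 : ν Set.univ ≠ 0 := by simpa using NeZero.ne ν
  have hinv : (ν Set.univ)⁻¹ ≠ ⊤ := ENNReal.inv_ne_top.2 hν0
  have hcπ : ∀ g : ℝ → ℝ, ∫ y, g y ∂ν = c * ∫ y, g y ∂π := by
    intro g
    rw [hπ, integral_smul_measure, ENNReal.toReal_inv, ← hc, smul_eq_mul, ← mul_assoc,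
      mul_inv_cancel₀ (ENNReal.toReal_ne_zero.2 ⟨hν0, measure_ne_top _ _⟩), one_mul]
  have hpX : Measurable (Function.uncurry fun y ω => p (X y ω)) := hp.comp hX
  have hpX' : Measurable (Function.uncurry fun y ω => p (X' y ω)) := hp.comp hX'
  -- A time integral need not be measurable for the product σ-algebra on paths, so equality of path
  -- laws does not apply to it directly. Averages over finitely many times are measurable there, and
  -- one sequence u of times can be chosen that works for both processes.
  have hA := ae_tendsto_average (P := P) (π := π) hpX (by
    rw [hπ, Measure.prod_smul_left]; exact hint.smul_measure hinv)
  have hB := ae_tendsto_average (P := P') (π := π) hpX' (by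
    rw [hπ, Measure.prod_smul_left]; exact hint'.smul_measure hinv)
  obtain ⟨u, hu, hu'⟩ := (hA.and hB).exists
  let Φ : ℕ → (ℝ → ℝ) → ℂ := fun n w =>
    ψ w • Complex.exp ((s * (c * ((∑ i ∈ Finset.range n, p (w (u i))) / n)) : ℝ) * Complex.I)
  have hΦ : ∀ n, Measurable (Φ n) := by
    intro n
    refine hψ.smul ?_
    refine Complex.continuous_exp.measurable.comp (Measurable.mul_const ?_ _)
    refine Complex.measurable_ofReal.comp (Measurable.const_mul (Measurable.const_mul
      (Measurable.div_const (Finset.measurable_fun_sum _ fun i _ => ?_) _) _) _)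
    exact hp.comp (measurable_pi_apply _)
  have hΦb : ∀ n w, ‖Φ n w‖ ≤ ‖ψ w‖ := by
    intro n w
    simp only [Φ]
    rw [norm_smul, norm_cexp_mul_I, mul_one]
  have hlim : Continuous fun v : ℝ => Complex.exp ((s * (c * v) : ℝ) * Complex.I) := by fun_prop
  have t1 : Tendsto (fun n => ∫ ω, Φ n (fun y => X y ω) ∂P) atTop
      (𝓝 (∫ ω, ψ (fun y => X y ω) •
        Complex.exp ((s * ∫ y, p (X y ω) ∂ν : ℝ) * Complex.I) ∂P)) := by
    refine tendsto_integral_of_dominated_convergence _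
      (fun n => ((hΦ n).comp hXp).aestronglyMeasurable) hψi.norm
      (fun n => ae_of_all _ fun ω => hΦb n _) ?_
    filter_upwards [hu] with ω hω
    rw [hcπ]
    exact ((hlim.tendsto _).comp hω).const_smul _
  have t2 : Tendsto (fun n => ∫ ω, Φ n (fun y => X' y ω) ∂P') atTop
      (𝓝 (∫ ω, ψ (fun y => X' y ω) •
        Complex.exp ((s * ∫ y, p (X' y ω) ∂ν : ℝ) * Complex.I) ∂P')) := by
    refine tendsto_integral_of_dominated_convergence _
      (fun n => ((hΦ n).comp hXp').aestronglyMeasurable) hψi'.norm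
      (fun n => ae_of_all _ fun ω => hΦb n _) ?_
    filter_upwards [hu'] with ω hω
    rw [hcπ]
    exact ((hlim.tendsto _).comp hω).const_smul _
  refine tendsto_nhds_unique t1 (t2.congr fun n => ?_)
  rw [← integral_map hXp.aemeasurable (hΦ n).aestronglyMeasurable, hlaw,
    integral_map hXp'.aemeasurable (hΦ n).aestronglyMeasurable]

end GaussianIncrementCLT

/-! ### Integration by parts against the exponential of a time integral. -/

namespace GaussianIncrementCLT

/-- At most exponential growth. -/
def ExpGrowth (p : ℝ → ℝ) : Prop := ∃ D : ℝ, 0 ≤ D ∧ ∀ z, |p z| ≤ D * Real.exp |z|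

lemma expGrowth_pow (n : ℕ) : ExpGrowth fun z => z ^ n := by
  refine ⟨n.factorial, by positivity, fun z => ?_⟩
  have := Real.pow_div_factorial_le_exp |z| (abs_nonneg z) n
  rw [div_le_iff₀ (by positivity : (0 : ℝ) < n.factorial)] at this
  rw [abs_pow]; linarith

lemma ExpGrowth.add {p q : ℝ → ℝ} (hp : ExpGrowth p) (hq : ExpGrowth q) :
    ExpGrowth fun z => p z + q z := by
  obtain ⟨D, hD, hp⟩ := hp
  obtain ⟨D', hD', hq⟩ := hq
  refine ⟨D + D', by positivity, fun z => (abs_add_le _ _).trans ?_⟩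
  rw [add_mul]
  exact add_le_add (hp z) (hq z)

lemma ExpGrowth.const_mul {p : ℝ → ℝ} (hp : ExpGrowth p) (c : ℝ) :
    ExpGrowth fun z => c * p z := by
  obtain ⟨D, hD, hp⟩ := hp
  refine ⟨|c| * D, by positivity, fun z => ?_⟩
  rw [abs_mul, mul_assoc]
  exact mul_le_mul_of_nonneg_left (hp z) (abs_nonneg c)

lemma ExpGrowth.sum (N : ℕ) {p : ℕ → ℝ → ℝ} (hp : ∀ m, ExpGrowth (p m)) :
    ExpGrowth fun z => ∑ m ∈ Finset.range N, p m z := by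
  induction N with
  | zero => exact ⟨0, le_rfl, fun z => by simp⟩
  | succ N ih =>
    simp_rw [Finset.sum_range_succ]
    exact ih.add (hp N)

lemma expGrowth_He (n : ℕ) : ExpGrowth (He n) := by
  unfold He
  induction Polynomial.hermite n using Polynomial.induction_on' with
  | add p q hp hq => simpa using hp.add hq
  | monomial n a => simpa using (expGrowth_pow n).const_mul (a : ℝ)

lemma ExpGrowth.memLp {p : ℝ → ℝ} (hp : ExpGrowth p) (hm : Measurable p) :
    MemLp p 2 stdGauss := by
  obtain ⟨D, hD, hp⟩ := hp
  refine ((memLp_exp_abs_stdGauss 1).const_mul D).mono' hm.aestronglyMeasurable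
    (ae_of_all _ fun z => ?_)
  simpa using hp z

lemma integrable_exp_abs_one : Integrable (fun x : ℝ => Real.exp |x|) stdGauss := by
  simpa using integrable_exp_abs_stdGauss 1

variable {Ω : Type*} [MeasurableSpace Ω] {P : Measure Ω} {X : ℝ → Ω → ℝ}

namespace IsStdGaussField

lemma abs_resample_le (hX : IsStdGaussField X P) (x y : ℝ) (z : Ω × ℝ) :
    |resample X P x z y| ≤ |X y z.1| + (|z.2| + |X x z.1|) := by
  refine (abs_add_le _ _).trans (add_le_add le_rfl ?_)
  rw [abs_mul]
  calc |corr X P x y| * |z.2 - X x z.1| ≤ 1 * (|z.2| + |X x z.1|) :=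
        mul_le_mul (hX.abs_corr_le x y) (abs_sub _ _) (abs_nonneg _) zero_le_one
    _ = _ := one_mul _

lemma integral_abs_mul_le (hX : IsStdGaussField X P) {u v : ℝ → ℝ} (hu : MemLp u 2 stdGauss)
    (hv : MemLp v 2 stdGauss) (x y : ℝ) :
    ∫ ω, |u (X x ω) * v (X y ω)| ∂P ≤
      ∫ z, u z ^ 2 ∂stdGauss + ∫ z, v z ^ 2 ∂stdGauss := by
  have h1 := (hX.memLp_comp x hu).integrable_sq
  have h2 := (hX.memLp_comp y hv).integrable_sq
  rw [← hX.integral_comp x hu.integrable_sq.1, ← hX.integral_comp y hv.integrable_sq.1,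
    ← integral_add h1 h2]
  refine integral_mono ((hX.memLp_comp x hu).integrable_mul (hX.memLp_comp y hv)).abs
    (h1.add h2) fun ω => ?_
  simp only [abs_mul]
  nlinarith [sq_nonneg (|u (X x ω)| - |v (X y ω)|), sq_abs (u (X x ω)), sq_abs (v (X y ω)),
    sq_nonneg (u (X x ω)), sq_nonneg (v (X y ω))]

/-- Differentiation under the integral sign along the resampled variable. -/
lemma hasDerivAt_integral_resample [IsProbabilityMeasure P] (hX : IsStdGaussField X P)
    {ν : Measure ℝ} [IsFiniteMeasure ν]
    {p p' : ℝ → ℝ} (hp : ∀ z, HasDerivAt p (p' z) z) (hp' : Measurable p')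
    (hpg : ExpGrowth p) (hpg' : ExpGrowth p') (x : ℝ) {ω : Ω}
    (hω : Integrable (fun y => Real.exp |X y ω|) ν) (n : ℝ) :
    HasDerivAt (fun n => ∫ y, p (resample X P x (ω, n) y) ∂ν)
      (∫ y, p' (resample X P x (ω, n) y) * corr X P x y ∂ν) n := by
  obtain ⟨D, hD, hpD⟩ := hpg
  obtain ⟨D', hD', hpD'⟩ := hpg'
  have mp : Measurable p := (continuous_iff_continuousAt.2 fun z =>
    (hp z).continuousAt).measurable
  have mr : ∀ n, Measurable fun y => resample X P x (ω, n) y := fun n =>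
    (hX.measurable_resample_uncurry x).comp measurable_prodMk_right
  have mc : Measurable fun y => corr X P x y := hX.measurable_corr.comp measurable_prodMk_left
  -- Since correlations are at most 1 in absolute value, for t near n the resampled path exceeds |X
  -- y ω| by at most a constant independent of y; exponential growth then gives a dominating
  -- function.
  have hb : ∀ t y, t ∈ Metric.ball n 1 → Real.exp |resample X P x (ω, t) y| ≤
      Real.exp |X y ω| * Real.exp (|n| + 1 + |X x ω|) := by
    intro t y ht
    rw [← Real.exp_add]
    refine Real.exp_le_exp.2 ((hX.abs_resample_le x y (ω, t)).trans ?_)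
    have : |t| ≤ |n| + 1 := by
      have h1 : |t - n| < 1 := by simpa [Real.dist_eq] using ht
      have h2 := abs_sub_abs_le_abs_sub t n
      linarith
    simp only
    linarith
  have hself : n ∈ Metric.ball n 1 := Metric.mem_ball_self one_pos
  refine (hasDerivAt_integral_of_dominated_loc_of_deriv_le
    (F := fun n y => p (resample X P x (ω, n) y))
    (F' := fun n y => p' (resample X P x (ω, n) y) * corr X P x y)
    (bound := fun y => D' * (Real.exp |X y ω| * Real.exp (|n| + 1 + |X x ω|)))
    (Metric.ball_mem_nhds n one_pos)
    (Eventually.of_forall fun t => (mp.comp (mr t)).aestronglyMeasurable) ?_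
    ((hp'.comp (mr n)).mul mc).aestronglyMeasurable (ae_of_all _ fun y t ht => ?_)
    ((hω.mul_const _).const_mul _) (ae_of_all _ fun y t _ => ?_)).2
  · refine ((hω.mul_const (Real.exp (|n| + 1 + |X x ω|))).const_mul D).mono'
      (mp.comp (mr n)).aestronglyMeasurable (ae_of_all _ fun y => ?_)
    exact (hpD _).trans (mul_le_mul_of_nonneg_left (hb n y hself) hD)
  · rw [Real.norm_eq_abs, abs_mul]
    calc |p' (resample X P x (ω, t) y)| * |corr X P x y|
        ≤ |p' (resample X P x (ω, t) y)| * 1 :=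
          mul_le_mul_of_nonneg_left (hX.abs_corr_le x y) (abs_nonneg _)
      _ ≤ D' * Real.exp |resample X P x (ω, t) y| := by rw [mul_one]; exact hpD' _
      _ ≤ _ := mul_le_mul_of_nonneg_left (hb t y ht) hD'
  · exact (hp _).comp t (hX.hasDerivAt_resample x y ω t)

/-- Gaussian integration by parts against the exponential of a time integral. -/
lemma integral_He_smul_cexp [IsProbabilityMeasure P] (hX : IsStdGaussField X P) {ν : Measure ℝ}
    [IsFiniteMeasure ν] [NeZero ν] {p p' : ℝ → ℝ} (hp : ∀ z, HasDerivAt p (p' z) z)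
    (hp' : Measurable p')
    (hpg : ExpGrowth p) (hpg' : ExpGrowth p') (m : ℕ) (x s : ℝ) :
    ∫ ω, He (m + 1) (X x ω) • Complex.exp ((s * ∫ y, p (X y ω) ∂ν : ℝ) * Complex.I) ∂P =
      (s * Complex.I) * ∫ y, corr X P x y • ∫ ω, (He m (X x ω) * p' (X y ω)) •
        Complex.exp ((s * ∫ y, p (X y ω) ∂ν : ℝ) * Complex.I) ∂P ∂ν := by
  have mp : Measurable p := (continuous_iff_continuousAt.2 fun z =>
    (hp z).continuousAt).measurable
  have L2p := hpg.memLp mp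
  have L2p' := hpg'.memLp hp'
  have mru := hX.measurable_resample_uncurry x
  -- integrability of `p` along both processes
  have ip : Integrable (fun q : ℝ × Ω => p (X q.1 q.2)) (ν.prod P) :=
    hX.integrable_comp_prod ν measurable_id (L2p.integrable one_le_two)
  have one_path : ∀ {g : ℝ → ℝ}, Measurable g → MemLp g 2 stdGauss → ∀ y,
      Integrable (fun z => g (resample X P x z y)) (P.prod stdGauss) ∧
      ∫ z, ‖g (resample X P x z y)‖ ∂(P.prod stdGauss) = ∫ z, ‖g z‖ ∂stdGauss := by
    intro g mg hg y
    have mΦ : Measurable fun w : ℝ → ℝ => g (w y) := mg.comp (measurable_pi_apply y)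
    refine ⟨(hX.integrable_path_iff x mΦ.stronglyMeasurable).1
      ((hX.memLp_comp y hg).integrable one_le_two), ?_⟩
    rw [← hX.integral_path_eq x mΦ.norm.stronglyMeasurable]
    exact hX.integral_comp y (f := fun z => ‖g z‖) mg.norm.aestronglyMeasurable
  have ip' : Integrable (fun q : ℝ × (Ω × ℝ) => p (resample X P x q.2 q.1))
      (ν.prod (P.prod stdGauss)) := by
    have mpr : Measurable fun q : ℝ × (Ω × ℝ) => p (resample X P x q.2 q.1) := mp.comp mru
    rw [integrable_prod_iff mpr.aestronglyMeasurable]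
    refine ⟨ae_of_all _ fun y => (one_path mp L2p y).1, ?_⟩
    have h : ∀ y, ∫ z, ‖p (resample X P x z y)‖ ∂(P.prod stdGauss) = ∫ z, ‖p z‖ ∂stdGauss :=
      fun y => (one_path mp L2p y).2
    simp only [h]
    exact integrable_const _
  -- Used twice: to pass to the resampled process, and to return from it after integrating by parts.
  have transfer : ∀ {ψ : (ℝ → ℝ) → ℝ}, Measurable ψ → Integrable (fun ω => ψ fun y => X y ω) P →
      ∫ ω, ψ (fun y => X y ω) • Complex.exp ((s * ∫ y, p (X y ω) ∂ν : ℝ) * Complex.I) ∂P =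
      ∫ z, ψ (resample X P x z) •
        Complex.exp ((s * ∫ y, p (resample X P x z y) ∂ν : ℝ) * Complex.I) ∂(P.prod stdGauss) :=
    fun hψ hψi => integral_smul_cexp_integral_eq (X' := fun y z => resample X P x z y)
      hX.meas mru (hX.map_resample x) mp ip ip' hψ hψi s
  -- notation for the resampled exponential
  set E : Ω × ℝ → ℂ := fun z =>
    Complex.exp ((s * ∫ y, p (resample X P x z y) ∂ν : ℝ) * Complex.I) with hE
  have mE : Measurable E := by
    have h1 : Measurable fun z : Ω × ℝ => ∫ y, p (resample X P x z y) ∂ν :=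
      (mp.comp (mru.comp measurable_swap)).stronglyMeasurable.integral_prod_right'.measurable
    exact Complex.continuous_exp.measurable.comp
      ((Complex.measurable_ofReal.comp (h1.const_mul s)).mul_const _)
  have nE : ∀ z, ‖E z‖ = 1 := fun z => norm_cexp_mul_I _
  have iHe : ∀ m, Integrable (fun z : Ω × ℝ => He m z.2 • E z) (P.prod stdGauss) := by
    intro m
    have : Integrable (fun z : Ω × ℝ => He m z.2) (P.prod stdGauss) :=
      ((memLp_He m).integrable one_le_two).comp_snd P
    refine this.norm.mono' ((((measurable_He m).comp measurable_snd).smul mE).aestronglyMeasurable)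
      (ae_of_all _ fun z => ?_)
    rw [norm_smul, nE, mul_one]
  -- the joint kernel
  let K : ℝ → Ω × ℝ → ℂ := fun y z =>
    (He m z.2 * (p' (resample X P x z y) * corr X P x y)) • E z
  have mc : Measurable fun y => corr X P x y := hX.measurable_corr.comp measurable_prodMk_left
  have mK : Measurable (Function.uncurry K) := by
    have h1 : Measurable fun q : ℝ × (Ω × ℝ) => He m q.2.2 := by fun_prop
    have h2 : Measurable fun q : ℝ × (Ω × ℝ) => p' (resample X P x q.2 q.1) := hp'.comp mru
    exact (h1.mul (h2.mul (mc.comp measurable_fst))).smul (mE.comp measurable_snd)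
  have mΦ : ∀ y, Measurable fun w : ℝ → ℝ => He m (w x) * p' (w y) := fun y => by fun_prop
  have iΦ : ∀ y, Integrable (fun ω => He m (X x ω) * p' (X y ω)) P := fun y =>
    (hX.memLp_comp x (memLp_He m)).integrable_mul (hX.memLp_comp y L2p')
  have iΦ' : ∀ y, Integrable (fun z : Ω × ℝ => He m z.2 * p' (resample X P x z y))
      (P.prod stdGauss) := fun y => by
    have := (hX.integrable_path_iff x (mΦ y).stronglyMeasurable).1 (iΦ y)
    simpa only [hX.resample_self] using this
  have nK : ∀ y z, ‖K y z‖ ≤ ‖He m z.2 * p' (resample X P x z y)‖ := by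
    intro y z
    simp only [K]
    rw [norm_smul, nE, mul_one, ← mul_assoc, norm_mul]
    exact mul_le_of_le_one_right (norm_nonneg _) (hX.abs_corr_le x y)
  have iK : Integrable (Function.uncurry K) (ν.prod (P.prod stdGauss)) := by
    have i1 : ∀ y, Integrable (K y) (P.prod stdGauss) := fun y =>
      (iΦ' y).norm.mono' (mK.comp measurable_prodMk_left).aestronglyMeasurable
        (ae_of_all _ fun z => nK y z)
    rw [integrable_prod_iff mK.aestronglyMeasurable]
    refine ⟨ae_of_all _ i1, Integrable.mono' (integrable_const
      (∫ z, He m z ^ 2 ∂stdGauss + ∫ z, p' z ^ 2 ∂stdGauss))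
      mK.norm.stronglyMeasurable.integral_prod_right'.aestronglyMeasurable
      (ae_of_all _ fun y => ?_)⟩
    rw [Real.norm_of_nonneg (integral_nonneg fun _ => norm_nonneg _)]
    refine (integral_mono (i1 y).norm (iΦ' y).norm fun z => nK y z).trans ?_
    have := hX.integral_path_eq x (mΦ y).norm.stronglyMeasurable
    simp only [hX.resample_self] at this
    rw [← this]
    exact hX.integral_abs_mul_le (memLp_He m) L2p' x y
  -- integration by parts in the resampled variable
  have hae : ∀ᵐ ω ∂P, Integrable (fun y => Real.exp |X y ω|) ν :=
    (hX.integrable_comp_prod ν measurable_id integrable_exp_abs_one).prod_left_ae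
  have hibp : ∀ᵐ ω ∂P, ∫ n, He (m + 1) n • E (ω, n) ∂stdGauss =
      ∫ n, (s * Complex.I) * ∫ y, K y (ω, n) ∂ν ∂stdGauss := by
    filter_upwards [hae, (iHe m).prod_right_ae, (iHe (m + 1)).prod_right_ae,
      iK.integral_prod_right.prod_right_ae] with ω hω h0 h1 h2
    -- Varying n moves the whole path, so differentiating the exponential produces is times the time
    -- integral of p' weighted by the correlation with x.
    have hφ : ∀ n, HasDerivAt (fun n => E (ω, n)) (E (ω, n) * (((s *
        ∫ y, p' (resample X P x (ω, n) y) * corr X P x y ∂ν : ℝ) : ℂ) * Complex.I)) n := fun n =>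
      ((((hX.hasDerivAt_integral_resample hp hp' hpg hpg' x hω
        n).const_mul s).ofReal_comp).mul_const
        Complex.I).cexp
    have e : ∀ n, He m n • (E (ω, n) * (((s *
        ∫ y, p' (resample X P x (ω, n) y) * corr X P x y ∂ν : ℝ) : ℂ) * Complex.I)) =
        (s * Complex.I) * ∫ y, K y (ω, n) ∂ν := by
      intro n
      simp only [K]
      rw [integral_smul_const, integral_const_mul]
      simp only [Complex.real_smul]
      push_cast
      ring
    rw [integral_He_succ_smul m hφ h0 h1 ?_]
    · exact integral_congr_ae (ae_of_all _ e)
    · simp only [e]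
      exact h2.const_mul _
  have hK' : ∀ y, ∫ z, K y z ∂(P.prod stdGauss) = corr X P x y • ∫ ω, (He m (X x ω) * p' (X y ω)) •
      Complex.exp ((s * ∫ y, p (X y ω) ∂ν : ℝ) * Complex.I) ∂P := by
    intro y
    rw [transfer (mΦ y) (iΦ y), ← integral_smul]
    refine integral_congr_ae (ae_of_all _ fun z => ?_)
    simp only [K, hX.resample_self, smul_smul]
    congr 1
    ring
  have mH : Measurable fun w : ℝ → ℝ => He (m + 1) (w x) := by fun_prop
  rw [transfer mH ((hX.memLp_comp x (memLp_He (m + 1))).integrable one_le_two)]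
  simp only [hX.resample_self]
  rw [integral_prod _ (iHe (m + 1)), integral_congr_ae hibp]
  have i3 : Integrable (fun z => (s * Complex.I) * ∫ y, K y z ∂ν) (P.prod stdGauss) :=
    iK.integral_prod_right.const_mul _
  rw [← integral_prod _ i3, integral_const_mul]
  congr 1
  rw [← integral_integral_swap iK]
  exact integral_congr_ae (ae_of_all _ hK')

end IsStdGaussField

end GaussianIncrementCLT

/-! ### The Stein differential inequality and second moments of time integrals. -/

namespace GaussianIncrementCLT

/-- Integrating the inequality `‖φ' + v s φ‖ ≤ δ |s|`. -/
lemma norm_sub_exp_le_of_deriv {φ φ' : ℝ → ℂ} {v δ : ℝ} (hv : 0 ≤ v) (hδ : 0 ≤ δ)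
    (h0 : φ 0 = 1) (hφ : ∀ s, HasDerivAt φ (φ' s) s)
    (hb : ∀ s, ‖φ' s + (v * s : ℝ) * φ s‖ ≤ |s| * δ) (s : ℝ) :
    ‖φ s - (Real.exp (-(v * s ^ 2 / 2)) : ℝ)‖ ≤ s ^ 2 * δ := by
  -- Integrating factor of φ' = -v t φ: the hypothesis bounds g' on [-|s|, |s|], and the mean value
  -- inequality over length |s| gives the factor s².
  set g : ℝ → ℂ := fun t => φ t * (Real.exp (v * t ^ 2 / 2) : ℝ) with hg
  have hd : ∀ t, HasDerivAt g ((φ' t + (v * t : ℝ) * φ t) * (Real.exp (v * t ^ 2 / 2) : ℝ)) t := by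
    intro t
    have h1 : HasDerivAt (fun t : ℝ => Real.exp (v * t ^ 2 / 2))
        (Real.exp (v * t ^ 2 / 2) * (v * t)) t := by
      have h2 := (((hasDerivAt_pow 2 t).const_mul v).div_const 2).exp
      exact h2.congr_deriv (by simp; ring)
    refine ((hφ t).mul h1.ofReal_comp).congr_deriv ?_
    push_cast
    ring
  have hle : ∀ t ∈ Set.Icc (-|s|) |s|,
      ‖(φ' t + (v * t : ℝ) * φ t) * (Real.exp (v * t ^ 2 / 2) : ℝ)‖ ≤
        |s| * δ * Real.exp (v * s ^ 2 / 2) := by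
    intro t ht
    have hts : |t| ≤ |s| := abs_le.2 ht
    have hsq : t ^ 2 ≤ s ^ 2 := sq_le_sq.2 hts
    rw [norm_mul, Complex.norm_real, Real.norm_of_nonneg (Real.exp_pos _).le]
    have := hb t
    gcongr
    exact this.trans (by gcongr)
  have key := (convex_Icc (-|s|) |s|).norm_image_sub_le_of_norm_hasDerivWithin_le
    (f := g) (fun t _ => (hd t).hasDerivWithinAt) hle
    (show (0 : ℝ) ∈ _ from ⟨by simp, by simp⟩) (show s ∈ _ from ⟨neg_abs_le s, le_abs_self s⟩)
  have hg0 : g 0 = 1 := by simp [hg, h0]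
  rw [hg0, sub_zero, Real.norm_eq_abs] at key
  have e : φ s - (Real.exp (-(v * s ^ 2 / 2)) : ℝ)
      = (g s - 1) * (Real.exp (-(v * s ^ 2 / 2)) : ℝ) := by
    simp only [hg, sub_mul, one_mul, mul_assoc]
    rw [← Complex.ofReal_mul, ← Real.exp_add]
    simp
  rw [e, norm_mul, Complex.norm_real, Real.norm_of_nonneg (Real.exp_pos _).le]
  calc ‖g s - 1‖ * Real.exp (-(v * s ^ 2 / 2))
      ≤ (|s| * δ * Real.exp (v * s ^ 2 / 2) * |s|) * Real.exp (-(v * s ^ 2 / 2)) := by gcongr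
    _ = (|s| * |s|) * δ * (Real.exp (v * s ^ 2 / 2) * Real.exp (-(v * s ^ 2 / 2))) := by ring
    _ = s ^ 2 * δ := by rw [← Real.exp_add]; simp [sq]

section timeIntegral

variable {S Ω : Type*} [MeasurableSpace S] [MeasurableSpace Ω] {P : Measure Ω}
  {κ : Measure S} [IsFiniteMeasure κ] {Y : S → Ω → ℝ} {B : ℝ}

/-- A measurable field with uniformly bounded second moments. -/
structure IsL2Field (Y : S → Ω → ℝ) (P : Measure Ω) (B : ℝ) : Prop where
  meas : Measurable (Function.uncurry Y)
  memLp : ∀ s, MemLp (Y s) 2 P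
  bound : ∀ s, ∫ ω, Y s ω ^ 2 ∂P ≤ B

lemma IsL2Field.integral_abs_mul_le (hY : IsL2Field Y P B) (s t : S) :
    ∫ ω, ‖Y s ω * Y t ω‖ ∂P ≤ B := by
  have h1 := (hY.memLp s).integrable_sq
  have h2 := (hY.memLp t).integrable_sq
  calc ∫ ω, ‖Y s ω * Y t ω‖ ∂P ≤ ∫ ω, (Y s ω ^ 2 + Y t ω ^ 2) / 2 ∂P := by
        refine integral_mono ((hY.memLp s).integrable_mul (hY.memLp t)).norm
          ((h1.add h2).div_const 2) fun ω => ?_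
        simp only [Real.norm_eq_abs, abs_mul]
        nlinarith [sq_nonneg (|Y s ω| - |Y t ω|), sq_abs (Y s ω), sq_abs (Y t ω)]
    _ ≤ B := by
        rw [integral_div, integral_add h1 h2]
        linarith [hY.bound s, hY.bound t]

lemma IsL2Field.measurable_integral (hY : IsL2Field Y P B) :
    Measurable fun ω => ∫ s, Y s ω ∂κ :=
  (hY.meas.comp measurable_swap).stronglyMeasurable.integral_prod_right'.measurable

variable [IsProbabilityMeasure P]

/-- Absolute second mixed moments are at most B and κ is finite; this is the Fubini input for
squares of time integrals. -/
lemma IsL2Field.integrable_pair (hY : IsL2Field Y P B) :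
    Integrable (fun q : (S × S) × Ω => Y q.1.1 q.2 * Y q.1.2 q.2) ((κ.prod κ).prod P) := by
  have h1 : Measurable fun q : (S × S) × Ω => Y q.1.1 q.2 :=
    hY.meas.comp ((measurable_fst.comp measurable_fst).prodMk measurable_snd)
  have h2 : Measurable fun q : (S × S) × Ω => Y q.1.2 q.2 :=
    hY.meas.comp ((measurable_snd.comp measurable_fst).prodMk measurable_snd)
  have hm : Measurable fun q : (S × S) × Ω => Y q.1.1 q.2 * Y q.1.2 q.2 := h1.mul h2
  rw [integrable_prod_iff hm.aestronglyMeasurable]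
  refine ⟨ae_of_all _ fun z => (hY.memLp z.1).integrable_mul (hY.memLp z.2),
    (integrable_const B).mono' hm.norm.stronglyMeasurable.integral_prod_right'.aestronglyMeasurable
      (ae_of_all _ fun z => ?_)⟩
  rw [Real.norm_of_nonneg (integral_nonneg fun _ => norm_nonneg _)]
  exact hY.integral_abs_mul_le z.1 z.2

lemma IsL2Field.integrable (hY : IsL2Field Y P B) :
    Integrable (fun q : S × Ω => Y q.1 q.2) (κ.prod P) := by
  have hm : Measurable fun q : S × Ω => Y q.1 q.2 := hY.meas
  rw [integrable_prod_iff hm.aestronglyMeasurable]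
  refine ⟨ae_of_all _ fun s => (hY.memLp s).integrable one_le_two,
    (integrable_const (1 + B)).mono'
      hm.norm.stronglyMeasurable.integral_prod_right'.aestronglyMeasurable
      (ae_of_all _ fun s => ?_)⟩
  rw [Real.norm_of_nonneg (integral_nonneg fun _ => norm_nonneg _)]
  have h1 := (hY.memLp s).integrable_sq
  calc ∫ ω, ‖Y s ω‖ ∂P ≤ ∫ ω, (1 + Y s ω ^ 2) ∂P := by
        refine integral_mono ((hY.memLp s).integrable one_le_two).norm
          ((integrable_const 1).add h1) fun ω => ?_
        simp only [Real.norm_eq_abs]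
        nlinarith [sq_nonneg (|Y s ω| - 1), sq_abs (Y s ω)]
    _ ≤ 1 + B := by
        rw [integral_add (integrable_const 1) h1]
        simpa using hY.bound s

lemma IsL2Field.memLp_integral (hY : IsL2Field Y P B) :
    MemLp (fun ω => ∫ s, Y s ω ∂κ) 2 P := by
  rw [memLp_two_iff_integrable_sq hY.measurable_integral.aestronglyMeasurable]
  refine (hY.integrable_pair (κ := κ)).integral_prod_right.congr (ae_of_all _ fun ω => ?_)
  simp only
  rw [integral_prod_mul (fun s => Y s ω) (fun s => Y s ω), sq]

lemma IsL2Field.integral_integral (hY : IsL2Field Y P B) :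
    ∫ ω, ∫ s, Y s ω ∂κ ∂P = ∫ s, ∫ ω, Y s ω ∂P ∂κ :=
  (integral_integral_swap (hY.integrable (κ := κ))).symm

lemma IsL2Field.integral_integral_sq (hY : IsL2Field Y P B) :
    ∫ ω, (∫ s, Y s ω ∂κ) ^ 2 ∂P = ∫ z, ∫ ω, Y z.1 ω * Y z.2 ω ∂P ∂(κ.prod κ) := by
  rw [integral_integral_swap (f := fun (z : S × S) ω => Y z.1 ω * Y z.2 ω) hY.integrable_pair]
  refine integral_congr_ae (ae_of_all _ fun ω => ?_)
  simp only
  rw [integral_prod_mul (fun s => Y s ω) (fun s => Y s ω), sq]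

lemma sq_integral_le {U : Ω → ℝ} (hU : MemLp U 2 P) : (∫ ω, U ω ∂P) ^ 2 ≤ ∫ ω, U ω ^ 2 ∂P := by
  have h := variance_eq_sub hU
  have h2 := variance_nonneg U P
  simp only [Pi.pow_apply] at h
  linarith

lemma integral_abs_le_sqrt {U : Ω → ℝ} (hU : MemLp U 2 P) :
    ∫ ω, |U ω| ∂P ≤ √(∫ ω, U ω ^ 2 ∂P) := by
  refine Real.le_sqrt_of_sq_le ?_
  have := sq_integral_le hU.abs
  simpa using this

/-- The mean absolute deviation of a time integral in terms of the covariances of the field. -/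
lemma IsL2Field.integral_abs_sub_le (hY : IsL2Field Y P B) :
    ∫ ω, |(∫ s, Y s ω ∂κ) - ∫ ω, ∫ s, Y s ω ∂κ ∂P| ∂P ≤
      √(∫ z, (∫ ω, Y z.1 ω * Y z.2 ω ∂P - (∫ ω, Y z.1 ω ∂P) * ∫ ω, Y z.2 ω ∂P) ∂(κ.prod κ)) := by
  have hW := hY.memLp_integral (κ := κ)
  refine (integral_abs_le_sqrt (hW.sub (memLp_const _))).trans (le_of_eq ?_)
  congr 1
  have hv := variance_eq_sub hW
  rw [variance_eq_integral hW.aestronglyMeasurable.aemeasurable] at hv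
  simp only [Pi.sub_apply, Pi.pow_apply] at hv ⊢
  rw [hv, hY.integral_integral_sq, hY.integral_integral, integral_sub,
    integral_prod_mul (fun s => ∫ ω, Y s ω ∂P) (fun s => ∫ ω, Y s ω ∂P), sq]
  · exact hY.integrable_pair.integral_prod_left
  · have := (hY.integrable (κ := κ)).integral_prod_left
    exact this.mul_prod this

end timeIntegral

end GaussianIncrementCLT

/-! ### The Stein kernel of a Hermite combination. -/

namespace GaussianIncrementCLT

lemma ExpGrowth.integrable_pow {p : ℝ → ℝ} (hp : ExpGrowth p) (hm : Measurable p) (n : ℕ) :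
    Integrable (fun z => p z ^ n) stdGauss := by
  obtain ⟨D, hD, hp⟩ := hp
  refine ((integrable_exp_abs_stdGauss n).const_mul (D ^ n)).mono'
    (hm.pow_const n).aestronglyMeasurable (ae_of_all _ fun z => ?_)
  rw [Real.norm_eq_abs, abs_pow, Real.exp_nat_mul, ← mul_pow]
  exact pow_le_pow_left₀ (abs_nonneg _) (hp z) n

lemma sum_smul_integral {S E : Type*} [MeasurableSpace S] [NormedAddCommGroup E]
    [NormedSpace ℝ E] {κ : Measure S} (c : ℕ → ℝ) (N : ℕ) {J : ℕ → S → E}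
    (hJ : ∀ m, Integrable (J m) κ) :
    ∑ m ∈ Finset.range N, c m • ∫ s, J m s ∂κ =
      ∫ s, ∑ m ∈ Finset.range N, c m • J m s ∂κ := by
  rw [integral_finsetSum (f := fun m s => c m • J m s) _ fun m _ => (hJ m).smul (c m)]
  simp only [integral_smul]

section smulCexp

variable {S Ω : Type*} [MeasurableSpace S] [MeasurableSpace Ω] {P : Measure Ω}
  {κ : Measure S} [IsFiniteMeasure κ] {Y : S → Ω → ℝ} {B : ℝ}

lemma IsL2Field.comp {S' : Type*} [MeasurableSpace S'] (hY : IsL2Field Y P B) {u : S' → S}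
    (hu : Measurable u) : IsL2Field (fun s => Y (u s)) P B where
  meas := hY.meas.comp ((hu.comp measurable_fst).prodMk measurable_snd)
  memLp s := hY.memLp (u s)
  bound s := hY.bound (u s)

variable [IsProbabilityMeasure P]

lemma IsL2Field.integrable_smul (hY : IsL2Field Y P B) {e : Ω → ℂ} (he : Measurable e)
    (hn : ∀ ω, ‖e ω‖ = 1) : Integrable (fun q : S × Ω => Y q.1 q.2 • e q.2) (κ.prod P) := by
  have hm : Measurable fun q : S × Ω => Y q.1 q.2 := hY.meas
  refine hY.integrable.norm.mono' (hm.smul (he.comp measurable_snd)).aestronglyMeasurable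
    (ae_of_all _ fun q => ?_)
  rw [norm_smul, hn, mul_one]

lemma IsL2Field.integral_smul (hY : IsL2Field Y P B) {e : Ω → ℂ} (he : Measurable e)
    (hn : ∀ ω, ‖e ω‖ = 1) :
    ∫ ω, (∫ s, Y s ω ∂κ) • e ω ∂P = ∫ s, ∫ ω, Y s ω • e ω ∂P ∂κ := by
  rw [integral_integral_swap (f := fun s ω => Y s ω • e ω) (hY.integrable_smul he hn)]
  refine integral_congr_ae (ae_of_all _ fun ω => ?_)
  simp only [integral_smul_const]

end smulCexp

variable {Ω : Type*} [MeasurableSpace Ω] {P : Measure Ω} {X : ℝ → Ω → ℝ}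

lemma IsStdGaussField.isL2Field_comp (hX : IsStdGaussField X P) {g : ℝ → ℝ} (mg : Measurable g)
    (hg : MemLp g 2 stdGauss) :
    IsL2Field (fun y ω => g (X y ω)) P (∫ z, g z ^ 2 ∂stdGauss) where
  meas := mg.comp hX.meas
  memLp y := hX.memLp_comp y hg
  bound y := (hX.integral_comp y (f := fun z => g z ^ 2) hg.integrable_sq.1).le

/-- Correlations are at most 1 in absolute value, so fourth moments of u and v bound the second
moment uniformly in the two times. -/
lemma IsStdGaussField.isL2Field_kernel [SFinite P] (hX : IsStdGaussField X P) {u v : ℝ → ℝ}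
    (mu : Measurable u) (mv : Measurable v) (hu : Integrable (fun z => u z ^ 4) stdGauss)
    (hv : Integrable (fun z => v z ^ 4) stdGauss) :
    IsL2Field (fun (z : ℝ × ℝ) ω => u (X z.1 ω) * v (X z.2 ω) * corr X P z.1 z.2) P
      (∫ z, u z ^ 4 ∂stdGauss + ∫ z, v z ^ 4 ∂stdGauss) := by
  have h1 : Measurable fun q : (ℝ × ℝ) × Ω => u (X q.1.1 q.2) :=
    mu.comp (hX.meas.comp ((measurable_fst.comp measurable_fst).prodMk measurable_snd))
  have h2 : Measurable fun q : (ℝ × ℝ) × Ω => v (X q.1.2 q.2) :=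
    mv.comp (hX.meas.comp ((measurable_snd.comp measurable_fst).prodMk measurable_snd))
  have hm : Measurable fun q : (ℝ × ℝ) × Ω => u (X q.1.1 q.2) * v (X q.1.2 q.2) *
      corr X P q.1.1 q.1.2 := (h1.mul h2).mul (hX.measurable_corr.comp measurable_fst)
  have hi : ∀ z : ℝ × ℝ, Integrable (fun ω => u (X z.1 ω) ^ 4 + v (X z.2 ω) ^ 4) P := fun z =>
    (hX.integrable_comp z.1 hu).add (hX.integrable_comp z.2 hv)
  have hb : ∀ (z : ℝ × ℝ) ω, (u (X z.1 ω) * v (X z.2 ω) * corr X P z.1 z.2) ^ 2 ≤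
      u (X z.1 ω) ^ 4 + v (X z.2 ω) ^ 4 := by
    intro z ω
    have hr : corr X P z.1 z.2 ^ 2 ≤ 1 := (sq_le_one_iff_abs_le_one _).2 (hX.abs_corr_le _ _)
    calc (u (X z.1 ω) * v (X z.2 ω) * corr X P z.1 z.2) ^ 2
        = (u (X z.1 ω) * v (X z.2 ω)) ^ 2 * corr X P z.1 z.2 ^ 2 := by ring
      _ ≤ (u (X z.1 ω) * v (X z.2 ω)) ^ 2 * 1 := by gcongr
      _ ≤ u (X z.1 ω) ^ 4 + v (X z.2 ω) ^ 4 := by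
        nlinarith [sq_nonneg (u (X z.1 ω) ^ 2 - v (X z.2 ω) ^ 2), sq_nonneg (u (X z.1 ω) ^ 2),
          sq_nonneg (v (X z.2 ω) ^ 2)]
  have hm' : ∀ z : ℝ × ℝ, Measurable fun ω => u (X z.1 ω) * v (X z.2 ω) * corr X P z.1 z.2 :=
    fun z => hm.comp measurable_prodMk_left
  have hs : ∀ z : ℝ × ℝ, Integrable
      (fun ω => (u (X z.1 ω) * v (X z.2 ω) * corr X P z.1 z.2) ^ 2) P := fun z =>
    (hi z).mono' ((hm' z).pow_const 2).aestronglyMeasurable (ae_of_all _ fun ω => by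
      rw [Real.norm_of_nonneg (sq_nonneg _)]; exact hb z ω)
  refine ⟨hm, fun z => (memLp_two_iff_integrable_sq (hm' z).aestronglyMeasurable).2 (hs z),
    fun z => ?_⟩
  rw [← hX.integral_comp z.1 hu.1, ← hX.integral_comp z.2 hv.1,
    ← integral_add (hX.integrable_comp z.1 hu) (hX.integrable_comp z.2 hv)]
  exact integral_mono (hs z) (hi z) (hb z)

/-- A finite combination of Hermite polynomials of positive degree. -/
noncomputable def hermitePoly (c : ℕ → ℝ) (N : ℕ) (z : ℝ) : ℝ :=
  ∑ m ∈ Finset.range N, c m * He (m + 1) z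

/-- The combination of Hermite polynomials with all degrees lowered by one. -/
noncomputable def lowPoly (c : ℕ → ℝ) (N : ℕ) (z : ℝ) : ℝ :=
  ∑ m ∈ Finset.range N, c m * He m z

/-- The derivative of `hermitePoly c N`. -/
noncomputable abbrev derivPoly (c : ℕ → ℝ) (N : ℕ) : ℝ → ℝ :=
  lowPoly (fun m => c m * (m + 1)) N

@[fun_prop]
lemma measurable_hermitePoly (c : ℕ → ℝ) (N : ℕ) : Measurable (hermitePoly c N) := by
  unfold hermitePoly; fun_prop

@[fun_prop]
lemma measurable_lowPoly (c : ℕ → ℝ) (N : ℕ) : Measurable (lowPoly c N) := by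
  unfold lowPoly; fun_prop

lemma expGrowth_hermitePoly (c : ℕ → ℝ) (N : ℕ) : ExpGrowth (hermitePoly c N) :=
  ExpGrowth.sum N fun m => (expGrowth_He (m + 1)).const_mul (c m)

lemma expGrowth_lowPoly (c : ℕ → ℝ) (N : ℕ) : ExpGrowth (lowPoly c N) :=
  ExpGrowth.sum N fun m => (expGrowth_He m).const_mul (c m)

lemma memLp_hermitePoly (c : ℕ → ℝ) (N : ℕ) : MemLp (hermitePoly c N) 2 stdGauss :=
  (expGrowth_hermitePoly c N).memLp (measurable_hermitePoly c N)

lemma hasDerivAt_hermitePoly (c : ℕ → ℝ) (N : ℕ) (z : ℝ) :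
    HasDerivAt (hermitePoly c N) (derivPoly c N z) z := by
  unfold hermitePoly derivPoly lowPoly
  refine (HasDerivAt.fun_sum fun m _ => (hasDerivAt_He_succ m z).const_mul (c m)).congr_deriv ?_
  exact Finset.sum_congr rfl fun m _ => by ring

/-- The integral of a function of the process. -/
noncomputable def timeInt (X : ℝ → Ω → ℝ) (ν : Measure ℝ) (g : ℝ → ℝ) (ω : Ω) : ℝ :=
  ∫ y, g (X y ω) ∂ν

/-- The double integral appearing in the Gaussian integration by parts formula. -/
noncomputable def steinKernel (X : ℝ → Ω → ℝ) (P : Measure Ω) (ν : Measure ℝ) (u v : ℝ → ℝ)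
    (ω : Ω) : ℝ :=
  ∫ z, u (X z.1 ω) * v (X z.2 ω) * corr X P z.1 z.2 ∂(ν.prod ν)

namespace IsStdGaussField

variable [IsProbabilityMeasure P] {ν : Measure ℝ} [IsFiniteMeasure ν]

lemma isL2Field_poly_kernel (hX : IsStdGaussField X P) (c c' : ℕ → ℝ) (N : ℕ) :
    IsL2Field (fun (z : ℝ × ℝ) ω => lowPoly c N (X z.1 ω) * lowPoly c' N (X z.2 ω) *
      corr X P z.1 z.2) P (∫ z, lowPoly c N z ^ 4 ∂stdGauss + ∫ z, lowPoly c' N z ^ 4 ∂stdGauss) :=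
  hX.isL2Field_kernel (by fun_prop) (by fun_prop)
    ((expGrowth_lowPoly c N).integrable_pow (by fun_prop) 4)
    ((expGrowth_lowPoly c' N).integrable_pow (by fun_prop) 4)

/-- Gaussian integration by parts for the time integral of a Hermite combination. -/
lemma integral_timeInt_smul_cexp (hX : IsStdGaussField X P) [NeZero ν] (c : ℕ → ℝ) (N : ℕ)
    (s : ℝ) :
    ∫ ω, timeInt X ν (hermitePoly c N) ω •
        Complex.exp ((s * timeInt X ν (hermitePoly c N) ω : ℝ) * Complex.I) ∂P =
      (s * Complex.I) * ∫ ω, steinKernel X P ν (lowPoly c N) (derivPoly c N) ω •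
        Complex.exp ((s * timeInt X ν (hermitePoly c N) ω : ℝ) * Complex.I) ∂P := by
  have hF := hX.isL2Field_comp (measurable_hermitePoly c N) (memLp_hermitePoly c N)
  set e : Ω → ℂ := fun ω =>
    Complex.exp ((s * timeInt X ν (hermitePoly c N) ω : ℝ) * Complex.I) with he
  have me : Measurable e := Complex.continuous_exp.measurable.comp
    ((Complex.measurable_ofReal.comp (hF.measurable_integral.const_mul s)).mul_const _)
  have ne : ∀ ω, ‖e ω‖ = 1 := fun ω => norm_cexp_mul_I _
  have hT := hX.isL2Field_poly_kernel c (fun m => c m * (m + 1)) N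
  -- Integrate by parts at a fixed time x, degree by degree, while the exponential contains the
  -- whole combination; integration over x comes afterwards by Fubini.
  have hfix : ∀ x, ∫ ω, hermitePoly c N (X x ω) • e ω ∂P = (s * Complex.I) *
      ∫ y, ∫ ω, (lowPoly c N (X x ω) * derivPoly c N (X y ω) * corr X P x y) • e ω ∂P ∂ν := by
    intro x
    have i1 : ∀ m, Integrable (fun ω => (c m * He m (X x ω)) • e ω) P := fun m =>
      (((hX.memLp_comp x (memLp_He m)).integrable one_le_two).const_mul (c m)).norm.mono'
        (((((measurable_He m).comp (hX.meas_eval x)).const_mul (c m)).smul me).aestronglyMeasurable)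
        (ae_of_all _ fun ω => by rw [norm_smul, ne, mul_one])
    have i1' : ∀ m, Integrable (fun ω => (c m * He (m + 1) (X x ω)) • e ω) P := fun m =>
      (((hX.memLp_comp x (memLp_He (m + 1))).integrable one_le_two).const_mul (c m)).norm.mono'
        (((((measurable_He (m + 1)).comp (hX.meas_eval x)).const_mul
          (c m)).smul me).aestronglyMeasurable)
        (ae_of_all _ fun ω => by rw [norm_smul, ne, mul_one])
    have hK : ∀ m, IsL2Field (fun (y : ℝ) ω => He m (X x ω) * derivPoly c N (X y ω) *
        corr X P x y) P (∫ z, He m z ^ 4 ∂stdGauss + ∫ z, derivPoly c N z ^ 4 ∂stdGauss) := fun m =>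
      (hX.isL2Field_kernel (u := He m) (v := derivPoly c N) (by fun_prop) (by fun_prop)
        (integrable_He_pow m 4) ((expGrowth_lowPoly _ N).integrable_pow (by fun_prop) 4)).comp
          (u := fun y => (x, y)) measurable_prodMk_left
    have i2 : ∀ m, Integrable (fun y => ∫ ω, (He m (X x ω) * derivPoly c N (X y ω) *
        corr X P x y) • e ω ∂P) ν := fun m =>
      ((hK m).integrable_smul (κ := ν) me ne).integral_prod_left
    have hm : ∀ m, ∫ ω, He (m + 1) (X x ω) • e ω ∂P = (s * Complex.I) *
        ∫ y, ∫ ω, (He m (X x ω) * derivPoly c N (X y ω) * corr X P x y) • e ω ∂P ∂ν := by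
      intro m
      have := hX.integral_He_smul_cexp (ν := ν) (hasDerivAt_hermitePoly c N)
        (measurable_lowPoly _ N) (expGrowth_hermitePoly c N) (expGrowth_lowPoly _ N) m x s
      simp only [he, timeInt]
      rw [this]
      congr 1
      refine integral_congr_ae (ae_of_all _ fun y => ?_)
      simp only
      rw [← MeasureTheory.integral_smul]
      refine integral_congr_ae (ae_of_all _ fun ω => ?_)
      simp only [smul_smul]
      congr 1
      ring
    simp only [hermitePoly, Finset.sum_smul]
    rw [integral_finsetSum _ fun m _ => i1' m]
    have e1 : ∀ m, ∫ ω, (c m * He (m + 1) (X x ω)) • e ω ∂P =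
        (s * Complex.I) * (c m • ∫ y, ∫ ω, (He m (X x ω) * derivPoly c N (X y ω) *
          corr X P x y) • e ω ∂P ∂ν) := by
      intro m
      simp only [mul_smul (c m)]
      rw [MeasureTheory.integral_smul, hm, mul_smul_comm]
    simp only [e1]
    rw [← Finset.mul_sum]
    congr 1
    rw [sum_smul_integral c N i2]
    refine integral_congr_ae (ae_of_all _ fun y => ?_)
    simp only
    have i3 : ∀ m, Integrable (fun ω => (He m (X x ω) * derivPoly c N (X y ω) *
        corr X P x y) • e ω) P := fun m => by
      have h0 := (((hK m).memLp y).integrable one_le_two)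
      exact h0.norm.mono' (h0.1.smul me.aestronglyMeasurable)
        (ae_of_all _ fun ω => by rw [norm_smul, ne, mul_one])
    rw [sum_smul_integral c N i3]
    refine integral_congr_ae (ae_of_all _ fun ω => ?_)
    simp only [smul_smul, ← Finset.sum_smul]
    congr 1
    simp only [lowPoly, Finset.sum_mul]
    exact Finset.sum_congr rfl fun m _ => by ring
  have hL := hF.integral_smul (κ := ν) me ne
  have hR := hT.integral_smul (κ := ν.prod ν) me ne
  change ∫ ω, (∫ y, hermitePoly c N (X y ω) ∂ν) • e ω ∂P = (s * Complex.I) *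
    ∫ ω, (∫ z, lowPoly c N (X z.1 ω) * derivPoly c N (X z.2 ω) * corr X P z.1 z.2
      ∂(ν.prod ν)) • e ω ∂P
  rw [hL, hR, integral_prod _ (hT.integrable_smul (κ := ν.prod ν) me ne).integral_prod_left,
    integral_congr_ae (ae_of_all _ hfix), integral_const_mul]

lemma memLp_timeInt (hX : IsStdGaussField X P) {g : ℝ → ℝ} (mg : Measurable g)
    (hg : MemLp g 2 stdGauss) : MemLp (timeInt X ν g) 2 P :=
  (hX.isL2Field_comp mg hg).memLp_integral

lemma memLp_steinKernel (hX : IsStdGaussField X P) (c c' : ℕ → ℝ) (N : ℕ) :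
    MemLp (steinKernel X P ν (lowPoly c N) (lowPoly c' N)) 2 P :=
  (hX.isL2Field_poly_kernel c c' N).memLp_integral

/-- Different degrees are uncorrelated. The shift k covers both `hermitePoly` (k = 1) and `lowPoly`
(k = 0). -/
lemma integral_sum_He_mul_sum_He (hX : IsStdGaussField X P) (c c' : ℕ → ℝ) (N : ℕ) (k : ℕ)
    (x y : ℝ) :
    ∫ ω, (∑ m ∈ Finset.range N, c m * He (m + k) (X x ω)) *
        (∑ m ∈ Finset.range N, c' m * He (m + k) (X y ω)) ∂P =
      ∑ m ∈ Finset.range N, c m * c' m * ((m + k).factorial * corr X P x y ^ (m + k)) := by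
  have hi : ∀ m n, Integrable (fun ω => c m * c' n * (He (m + k) (X x ω) * He (n + k) (X y ω))) P :=
    fun m n => ((hX.memLp_comp x (memLp_He (m + k))).integrable_mul
      (hX.memLp_comp y (memLp_He (n + k)))).const_mul _
  have e : ∀ ω, (∑ m ∈ Finset.range N, c m * He (m + k) (X x ω)) *
        (∑ m ∈ Finset.range N, c' m * He (m + k) (X y ω)) =
      ∑ m ∈ Finset.range N, ∑ n ∈ Finset.range N,
        c m * c' n * (He (m + k) (X x ω) * He (n + k) (X y ω)) := by
    intro ω
    rw [Finset.sum_mul_sum]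
    exact Finset.sum_congr rfl fun m _ => Finset.sum_congr rfl fun n _ => by ring
  simp only [e]
  rw [integral_finsetSum _ fun m _ => integrable_finsetSum _ fun n _ => hi m n]
  refine Finset.sum_congr rfl fun m hm => ?_
  rw [integral_finsetSum _ fun n _ => hi m n, Finset.sum_eq_single m]
  · rw [integral_const_mul, hX.integral_He_mul_He_comp]
    simp [pairMoment]
  · intro n _ hn
    rw [integral_const_mul, hX.integral_He_mul_He_comp]
    simp [pairMoment, hn.symm]
  · exact fun h => absurd hm h

/-- Termwise, (m + 1) · m! · r^m · r = (m + 1)! · r^{m+1}: the derivative supplies the factor m + 1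
and the kernel the extra r. -/
lemma integral_steinKernel (hX : IsStdGaussField X P) (c : ℕ → ℝ) (N : ℕ) :
    ∫ ω, steinKernel X P ν (lowPoly c N) (derivPoly c N) ω ∂P =
      ∫ ω, timeInt X ν (hermitePoly c N) ω ^ 2 ∂P := by
  have hF := hX.isL2Field_comp (measurable_hermitePoly c N) (memLp_hermitePoly c N)
  have hT := hX.isL2Field_poly_kernel c (fun m => c m * (m + 1)) N
  simp only [steinKernel, timeInt]
  rw [hT.integral_integral, hF.integral_integral_sq]
  refine integral_congr_ae (ae_of_all _ fun z => ?_)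
  simp only
  rw [integral_mul_const]
  have h1 := hX.integral_sum_He_mul_sum_He c c N 1 z.1 z.2
  have h0 := hX.integral_sum_He_mul_sum_He c (fun m => c m * (m + 1)) N 0 z.1 z.2
  simp only [add_zero] at h0
  simp only [hermitePoly, lowPoly]
  rw [h0, h1, Finset.sum_mul]
  refine Finset.sum_congr rfl fun m _ => ?_
  rw [Nat.factorial_succ, pow_succ]
  push_cast
  ring

/-- The characteristic function of the time integral of a Hermite combination is close to that of
a Gaussian variable if the Stein kernel is nearly constant. -/
lemma norm_integral_cexp_sub_le (hX : IsStdGaussField X P) [NeZero ν] (c : ℕ → ℝ) (N : ℕ) (s : ℝ) :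
    ‖∫ ω, Complex.exp ((s * timeInt X ν (hermitePoly c N) ω : ℝ) * Complex.I) ∂P -
        (Real.exp (-((∫ ω, timeInt X ν (hermitePoly c N) ω ^ 2 ∂P) * s ^ 2 / 2)) : ℝ)‖ ≤
      s ^ 2 * ∫ ω, |steinKernel X P ν (lowPoly c N) (derivPoly c N) ω -
        ∫ ω, steinKernel X P ν (lowPoly c N) (derivPoly c N) ω ∂P| ∂P := by
  have hF2 : MemLp (timeInt X ν (hermitePoly c N)) 2 P :=
    hX.memLp_timeInt (measurable_hermitePoly c N) (memLp_hermitePoly c N)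
  have mF : Measurable (timeInt X ν (hermitePoly c N)) :=
    (hX.isL2Field_comp (measurable_hermitePoly c N) (memLp_hermitePoly c N)).measurable_integral
  have hT2 : MemLp (steinKernel X P ν (lowPoly c N) (derivPoly c N)) 2 P :=
    hX.memLp_steinKernel c _ N
  have hS := hX.integral_timeInt_smul_cexp (ν := ν) c N
  rw [hX.integral_steinKernel]
  set F := timeInt X ν (hermitePoly c N)
  set T := steinKernel X P ν (lowPoly c N) (derivPoly c N)
  set v := ∫ ω, F ω ^ 2 ∂P with hv
  let e : ℝ → Ω → ℂ := fun s ω => Complex.exp ((s * F ω : ℝ) * Complex.I)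
  have me : ∀ s, Measurable (e s) := fun s => Complex.continuous_exp.measurable.comp
    ((Complex.measurable_ofReal.comp (mF.const_mul s)).mul_const _)
  have ne : ∀ s ω, ‖e s ω‖ = 1 := fun s ω => norm_cexp_mul_I _
  have ie : ∀ s, Integrable (e s) P := fun s =>
    (integrable_const (1 : ℝ)).mono' (me s).aestronglyMeasurable
      (ae_of_all _ fun ω => (ne s ω).le)
  have iT : ∀ s, Integrable (fun ω => T ω • e s ω) P := fun s =>
    (hT2.integrable one_le_two).norm.mono' (hT2.1.smul (me s).aestronglyMeasurable)
      (ae_of_all _ fun ω => by rw [norm_smul, ne, mul_one])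
  refine norm_sub_exp_le_of_deriv (φ := fun s => ∫ ω, e s ω ∂P)
    (φ' := fun s => Complex.I * ∫ ω, F ω • e s ω ∂P) (integral_nonneg fun ω => sq_nonneg _)
    (integral_nonneg fun ω => abs_nonneg _) (by simp [e]) (fun s => ?_) (fun s => ?_) s
  · rw [← integral_const_mul]
    refine (hasDerivAt_integral_of_dominated_loc_of_deriv_le (F := e)
      (F' := fun s ω => Complex.I * F ω • e s ω) (bound := fun ω => |F ω|) univ_mem
      (Eventually.of_forall fun s => (me s).aestronglyMeasurable) (ie s)
      (((mF.smul (me s)).const_mul _).aestronglyMeasurable)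
      (ae_of_all _ fun ω t _ => by
        rw [norm_mul, Complex.norm_I, one_mul, norm_smul, ne, mul_one, Real.norm_eq_abs])
      (hF2.integrable one_le_two).abs (ae_of_all _ fun ω t _ => ?_)).2
    have h1 : HasDerivAt (fun t : ℝ => t * F ω) (F ω) t := by
      simpa using (hasDerivAt_id t).mul_const (F ω)
    refine (h1.ofReal_comp.mul_const Complex.I).cexp.congr_deriv ?_
    simp only [e, Complex.real_smul]
    ring
  · have h1 : Complex.I * ∫ ω, F ω • e s ω ∂P + (v * s : ℝ) * ∫ ω, e s ω ∂P =
        (-s : ℝ) * ∫ ω, (T ω - v) • e s ω ∂P := by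
      have h2 : ∫ ω, (T ω - v) • e s ω ∂P = ∫ ω, T ω • e s ω ∂P - v * ∫ ω, e s ω ∂P := by
        have hve : Integrable (fun ω => v • e s ω) P := (ie s).smul v
        simp only [sub_smul]
        rw [integral_sub (iT s) hve, MeasureTheory.integral_smul, Complex.real_smul]
      rw [h2, show ∫ ω, F ω • e s ω ∂P = _ from hS s]
      simp only [e]
      push_cast
      linear_combination (s * ∫ ω, T ω • Complex.exp (s * F ω * Complex.I) ∂P) * Complex.I_sq
    rw [h1, norm_mul, Complex.norm_real, norm_neg, Real.norm_eq_abs]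
    refine mul_le_mul_of_nonneg_left ?_ (abs_nonneg s)
    refine (norm_integral_le_integral_norm _).trans (le_of_eq ?_)
    refine integral_congr_ae (ae_of_all _ fun ω => ?_)
    simp only [norm_smul, ne, mul_one, Real.norm_eq_abs]

end IsStdGaussField

end GaussianIncrementCLT

/-! ### The deviation of the Stein kernel. -/

namespace GaussianIncrementCLT

variable {Ω : Type*} [MeasurableSpace Ω] {P : Measure Ω} {X : ℝ → Ω → ℝ}
  [IsProbabilityMeasure P] {ν : Measure ℝ} [IsFiniteMeasure ν]

/-- The majorant as a function of two pairs of times. -/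
noncomputable def corrMajorant (X : ℝ → Ω → ℝ) (P : Measure Ω) (d : ℕ)
    (z : (ℝ × ℝ) × (ℝ × ℝ)) : ℝ :=
  majorant d (corrEdges X P z.1.1 z.1.2 z.2.1 z.2.2)

lemma integrable_of_nonneg_of_le {α : Type*} [MeasurableSpace α] {κ : Measure α} [IsFiniteMeasure κ]
    {g : α → ℝ} (hg : Measurable g) (h0 : ∀ q, 0 ≤ g q) {B : ℝ} (h1 : ∀ q, g q ≤ B) :
    Integrable g κ :=
  (integrable_const B).mono' hg.aestronglyMeasurable
    (ae_of_all _ fun q => by rw [Real.norm_of_nonneg (h0 q)]; exact h1 q)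

namespace IsStdGaussField

lemma measurable_abs_corr (hX : IsStdGaussField X P) {α : Type*} [MeasurableSpace α] {u v : α → ℝ}
    (hu : Measurable u) (hv : Measurable v) : Measurable fun q => |corr X P (u q) (v q)| :=
  (hX.measurable_corr.comp (hu.prodMk hv)).abs

lemma integrable_corrMajorant (hX : IsStdGaussField X P) (d : ℕ)
    {κ : Measure ((ℝ × ℝ) × (ℝ × ℝ))} [IsFiniteMeasure κ] :
    Integrable (corrMajorant X P d) κ := by
  have m12 : Measurable fun z : (ℝ × ℝ) × (ℝ × ℝ) => |corr X P z.1.1 z.1.2| :=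
    hX.measurable_abs_corr (by fun_prop) (by fun_prop)
  have m13 : Measurable fun z : (ℝ × ℝ) × (ℝ × ℝ) => |corr X P z.1.1 z.2.1| :=
    hX.measurable_abs_corr (by fun_prop) (by fun_prop)
  have m14 : Measurable fun z : (ℝ × ℝ) × (ℝ × ℝ) => |corr X P z.1.1 z.2.2| :=
    hX.measurable_abs_corr (by fun_prop) (by fun_prop)
  have m23 : Measurable fun z : (ℝ × ℝ) × (ℝ × ℝ) => |corr X P z.1.2 z.2.1| :=
    hX.measurable_abs_corr (by fun_prop) (by fun_prop)
  have m24 : Measurable fun z : (ℝ × ℝ) × (ℝ × ℝ) => |corr X P z.1.2 z.2.2| :=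
    hX.measurable_abs_corr (by fun_prop) (by fun_prop)
  have m34 : Measurable fun z : (ℝ × ℝ) × (ℝ × ℝ) => |corr X P z.2.1 z.2.2| :=
    hX.measurable_abs_corr (by fun_prop) (by fun_prop)
  have hb : ∀ x y, |corr X P x y| ≤ 1 := hX.abs_corr_le
  refine integrable_of_nonneg_of_le (B := 1 * 1 * (1 + 1 + 1 + 1) +
    ∑ u ∈ Finset.Ico 1 d, (1 * 1) ^ u * ((1 * 1) ^ (d - u) + (1 * 1) ^ (d - u))) ?_ ?_ ?_
  · unfold corrMajorant majorant corrEdges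
    fun_prop
  · intro z
    unfold corrMajorant majorant
    positivity
  · intro z
    unfold corrMajorant majorant corrEdges
    simp only
    gcongr
    all_goals first | exact hb _ _ | exact pow_le_one₀ (abs_nonneg _) (hb _ _)

/-- The mean absolute deviation is at most the square root of the variance, and the variance is the
fourfold time integral of r₁₂ r₃₄ times the covariance controlled by `exists_covariance_le`. -/
lemma exists_integral_abs_steinKernel_He_sub_le (P : Measure Ω) [IsProbabilityMeasure P]
    (i j d : ℕ) (hi : d ≤ i + 1) (hj : d ≤ j + 1) :
    ∃ C : ℝ, 0 ≤ C ∧ ∀ (X : ℝ → Ω → ℝ) (ν : Measure ℝ) [IsFiniteMeasure ν],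
      IsStdGaussField X P →
      ∫ ω, |steinKernel X P ν (He i) (He j) ω - ∫ ω, steinKernel X P ν (He i) (He j) ω ∂P| ∂P ≤
        C * √(∫ z, corrMajorant X P d z ∂((ν.prod ν).prod (ν.prod ν))) := by
  obtain ⟨C, hC0, hC⟩ := exists_covariance_le i j d hi hj
  refine ⟨√C, Real.sqrt_nonneg C, fun X ν _ hX => ?_⟩
  have hY := hX.isL2Field_kernel (u := He i) (v := He j) (by fun_prop) (by fun_prop)
    (integrable_He_pow i 4) (integrable_He_pow j 4)
  refine (hY.integral_abs_sub_le (κ := ν.prod ν)).trans ?_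
  rw [← Real.sqrt_mul hC0, ← integral_const_mul]
  refine Real.sqrt_le_sqrt ?_
  refine (Real.le_norm_self _).trans (norm_integral_le_of_norm_le
    ((hX.integrable_corrMajorant d).const_mul C) (ae_of_all _ fun z => ?_))
  refine le_of_eq_of_le ?_ (hC P X hX z.1.1 z.1.2 z.2.1 z.2.2)
  rw [Real.norm_eq_abs]
  congr 1
  rw [integral_mul_const, integral_mul_const, hX.integral_He_mul_He_comp,
    hX.integral_He_mul_He_comp, mul_sub]
  congr 1
  · rw [moment4, ← integral_const_mul]
    refine integral_congr_ae (ae_of_all _ fun ω => ?_)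
    simp only [hermiteProd]
    ring
  · ring

/-- The Stein kernel of a combination of Hermite polynomials is a combination of the kernels of
single ones. -/
lemma steinKernel_lowPoly_ae_eq (hX : IsStdGaussField X P) (c c' : ℕ → ℝ) (N : ℕ) :
    steinKernel X P ν (lowPoly c N) (lowPoly c' N) =ᵐ[P] fun ω =>
      ∑ m ∈ Finset.range N, ∑ n ∈ Finset.range N,
        c m * c' n * steinKernel X P ν (He m) (He n) ω := by
  have hi : ∀ᵐ ω ∂P, ∀ m n, Integrable
      (fun z : ℝ × ℝ => He m (X z.1 ω) * He n (X z.2 ω) * corr X P z.1 z.2) (ν.prod ν) := by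
    refine ae_all_iff.2 fun m => ae_all_iff.2 fun n => ?_
    have hY := hX.isL2Field_kernel (u := He m) (v := He n) (by fun_prop) (by fun_prop)
      (integrable_He_pow m 4) (integrable_He_pow n 4)
    exact (hY.integrable (κ := ν.prod ν)).prod_left_ae
  filter_upwards [hi] with ω hω
  simp only [steinKernel, ← integral_const_mul]
  rw [integral_congr_ae (g := fun z : ℝ × ℝ => ∑ m ∈ Finset.range N, ∑ n ∈ Finset.range N,
    c m * c' n * (He m (X z.1 ω) * He n (X z.2 ω) * corr X P z.1 z.2)),
    integral_finsetSum _ fun m _ => integrable_finsetSum _ fun n _ => (hω m n).const_mul _]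
  · exact Finset.sum_congr rfl fun m _ => integral_finsetSum _ fun n _ => (hω m n).const_mul _
  · refine ae_of_all _ fun z => ?_
    simp only [lowPoly]
    rw [Finset.sum_mul_sum, Finset.sum_mul]
    refine Finset.sum_congr rfl fun m _ => ?_
    rw [Finset.sum_mul]
    exact Finset.sum_congr rfl fun n _ => by ring

/-- Triangle inequality over pairs of degrees. Vanishing of the coefficients below d - 1 leaves only
pairs to which the majorant of order d applies; C is again independent of X and ν. -/
lemma exists_integral_abs_steinKernel_sub_le (P : Measure Ω) [IsProbabilityMeasure P]
    (c c' : ℕ → ℝ) (N d : ℕ) (hc : ∀ m, m + 1 < d → c m = 0) (hc' : ∀ m, m + 1 < d → c' m = 0) :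
    ∃ C : ℝ, 0 ≤ C ∧ ∀ (X : ℝ → Ω → ℝ) (ν : Measure ℝ) [IsFiniteMeasure ν],
      IsStdGaussField X P →
      ∫ ω, |steinKernel X P ν (lowPoly c N) (lowPoly c' N) ω -
          ∫ ω, steinKernel X P ν (lowPoly c N) (lowPoly c' N) ω ∂P| ∂P ≤
        C * √(∫ z, corrMajorant X P d z ∂((ν.prod ν).prod (ν.prod ν))) := by
  have h : ∀ i j, ∃ C : ℝ, 0 ≤ C ∧ ∀ (X : ℝ → Ω → ℝ) (ν : Measure ℝ) [IsFiniteMeasure ν],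
      IsStdGaussField X P →
      |c i * c' j| * ∫ ω, |steinKernel X P ν (He i) (He j) ω -
          ∫ ω, steinKernel X P ν (He i) (He j) ω ∂P| ∂P ≤
        C * √(∫ z, corrMajorant X P d z ∂((ν.prod ν).prod (ν.prod ν))) := by
    intro i j
    by_cases hij : d ≤ i + 1 ∧ d ≤ j + 1
    · obtain ⟨C, h0, hC⟩ := exists_integral_abs_steinKernel_He_sub_le P i j d hij.1 hij.2
      refine ⟨|c i * c' j| * C, by positivity, fun X ν _ hX => ?_⟩
      rw [mul_assoc]
      exact mul_le_mul_of_nonneg_left (hC X ν hX) (abs_nonneg _)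
    · refine ⟨0, le_rfl, fun X ν _ hX => ?_⟩
      have : c i * c' j = 0 := by
        by_cases hi : d ≤ i + 1
        · rw [hc' j (by omega), mul_zero]
        · rw [hc i (by omega), zero_mul]
      simp [this]
  choose C hC0 hC using h
  refine ⟨∑ m ∈ Finset.range N, ∑ n ∈ Finset.range N, C m n,
    Finset.sum_nonneg fun m _ => Finset.sum_nonneg fun n _ => hC0 m n, fun X ν _ hX => ?_⟩
  have ae := hX.steinKernel_lowPoly_ae_eq (ν := ν) c c' N
  have iT : ∀ m n, Integrable (steinKernel X P ν (He m) (He n)) P := fun m n =>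
    (hX.isL2Field_kernel (u := He m) (v := He n) (by fun_prop) (by fun_prop)
      (integrable_He_pow m 4) (integrable_He_pow n 4)).memLp_integral.integrable one_le_two
  have hE : ∫ ω, steinKernel X P ν (lowPoly c N) (lowPoly c' N) ω ∂P =
      ∑ m ∈ Finset.range N, ∑ n ∈ Finset.range N,
        c m * c' n * ∫ ω, steinKernel X P ν (He m) (He n) ω ∂P := by
    rw [integral_congr_ae ae,
      integral_finsetSum _ fun m _ => integrable_finsetSum _ fun n _ => (iT m n).const_mul _]
    refine Finset.sum_congr rfl fun m _ => ?_
    rw [integral_finsetSum _ fun n _ => (iT m n).const_mul _]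
    exact Finset.sum_congr rfl fun n _ => integral_const_mul _ _
  have iA : ∀ m n, Integrable (fun ω => |c m * c' n| * |steinKernel X P ν (He m) (He n) ω -
      ∫ ω, steinKernel X P ν (He m) (He n) ω ∂P|) P := fun m n =>
    ((iT m n).sub (integrable_const _)).abs.const_mul _
  calc ∫ ω, |steinKernel X P ν (lowPoly c N) (lowPoly c' N) ω -
          ∫ ω, steinKernel X P ν (lowPoly c N) (lowPoly c' N) ω ∂P| ∂P
      ≤ ∫ ω, ∑ m ∈ Finset.range N, ∑ n ∈ Finset.range N, |c m * c' n| *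
          |steinKernel X P ν (He m) (He n) ω - ∫ ω, steinKernel X P ν (He m) (He n) ω ∂P| ∂P := by
        refine integral_mono_ae ?_
          (integrable_finsetSum _ fun m _ => integrable_finsetSum _ fun n _ => iA m n) ?_
        · exact (((integrable_finsetSum _ fun m _ => integrable_finsetSum _ fun n _ =>
            (iT m n).const_mul _).congr ae.symm).sub (integrable_const _)).abs
        · filter_upwards [ae] with ω hω
          rw [hω, hE, ← Finset.sum_sub_distrib]
          refine (Finset.abs_sum_le_sum_abs _ _).trans (Finset.sum_le_sum fun m _ => ?_)
          rw [← Finset.sum_sub_distrib]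
          refine (Finset.abs_sum_le_sum_abs _ _).trans (Finset.sum_le_sum fun n _ => ?_)
          rw [← mul_sub, abs_mul]
    _ = ∑ m ∈ Finset.range N, ∑ n ∈ Finset.range N, |c m * c' n| *
          ∫ ω, |steinKernel X P ν (He m) (He n) ω -
            ∫ ω, steinKernel X P ν (He m) (He n) ω ∂P| ∂P := by
        rw [integral_finsetSum _ fun m _ => integrable_finsetSum _ fun n _ => iA m n]
        refine Finset.sum_congr rfl fun m _ => ?_
        rw [integral_finsetSum _ fun n _ => iA m n]
        exact Finset.sum_congr rfl fun n _ => integral_const_mul _ _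
    _ ≤ (∑ m ∈ Finset.range N, ∑ n ∈ Finset.range N, C m n) *
          √(∫ z, corrMajorant X P d z ∂((ν.prod ν).prod (ν.prod ν))) := by
        rw [Finset.sum_mul]
        refine Finset.sum_le_sum fun m _ => ?_
        rw [Finset.sum_mul]
        exact Finset.sum_le_sum fun n _ => hC m n X ν hX

end IsStdGaussField

end GaussianIncrementCLT

/-! ### Fourfold integrals along paths of three edges. -/

namespace GaussianIncrementCLT

section paths

variable {S : Type*} [MeasurableSpace S] {ν : Measure S} [IsFiniteMeasure ν]
  {f g h : S → S → ENNReal} {A C : ENNReal}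

/-- Integrating a path of three edges from its two ends, the middle edge joining the two pairs. -/
lemma lintegral_path_le (hf : Measurable (Function.uncurry f))
    (hg : Measurable (Function.uncurry g))
    (hh : Measurable (Function.uncurry h)) (hA : ∀ᵐ x ∂ν, ∫⁻ y, f y x ∂ν ≤ A)
    (hC : ∀ᵐ x ∂ν, ∫⁻ y, h x y ∂ν ≤ C) :
    ∫⁻ z, f z.1.1 z.1.2 * (g z.1.2 z.2.1 * h z.2.1 z.2.2) ∂((ν.prod ν).prod (ν.prod ν)) ≤
      A * (C * ∫⁻ x, ∫⁻ y, g x y ∂ν ∂ν) := by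
  have mg : Measurable fun x => ∫⁻ y, g x y ∂ν := hg.lintegral_prod_right'
  have m1 : Measurable fun z : (S × S) × (S × S) => f z.1.1 z.1.2 :=
    hf.comp (by fun_prop : Measurable fun z : (S × S) × (S × S) => (z.1.1, z.1.2))
  have m2 : Measurable fun z : (S × S) × (S × S) => g z.1.2 z.2.1 :=
    hg.comp (by fun_prop : Measurable fun z : (S × S) × (S × S) => (z.1.2, z.2.1))
  have m3 : Measurable fun z : (S × S) × (S × S) => h z.2.1 z.2.2 :=
    hh.comp (by fun_prop : Measurable fun z : (S × S) × (S × S) => (z.2.1, z.2.2))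
  have inner : ∀ x : S, ∫⁻ w, g x w.1 * h w.1 w.2 ∂(ν.prod ν) ≤ C * ∫⁻ y, g x y ∂ν := by
    intro x
    have mgx : Measurable fun y => g x y := hg.comp measurable_prodMk_left
    have hm : Measurable fun w : S × S => g x w.1 * h w.1 w.2 := (mgx.comp measurable_fst).mul hh
    rw [lintegral_prod _ hm.aemeasurable, ← lintegral_const_mul C mgx]
    refine lintegral_mono_ae (hC.mono fun y hy => ?_)
    simp only
    have mh : Measurable fun t => h y t := hh.comp measurable_prodMk_left
    rw [lintegral_const_mul _ mh, mul_comm]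
    gcongr
  have hm : Measurable fun z : (S × S) × (S × S) =>
    f z.1.1 z.1.2 * (g z.1.2 z.2.1 * h z.2.1 z.2.2) := m1.mul (m2.mul m3)
  rw [lintegral_prod _ hm.aemeasurable]
  calc ∫⁻ v, ∫⁻ w, f v.1 v.2 * (g v.2 w.1 * h w.1 w.2) ∂(ν.prod ν) ∂(ν.prod ν)
      ≤ ∫⁻ v, f v.1 v.2 * (C * ∫⁻ y, g v.2 y ∂ν) ∂(ν.prod ν) := by
        refine lintegral_mono fun v => ?_
        have mw : Measurable fun w : S × S => g v.2 w.1 * h w.1 w.2 :=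
          (hg.comp (by fun_prop : Measurable fun w : S × S => (v.2, w.1))).mul hh
        simp only
        rw [lintegral_const_mul _ mw]
        gcongr
        exact inner v.2
    _ = ∫⁻ x, (∫⁻ y, f y x ∂ν) * (C * ∫⁻ y, g x y ∂ν) ∂ν := by
        have mv : Measurable fun v : S × S => f v.1 v.2 * (C * ∫⁻ y, g v.2 y ∂ν) :=
          hf.mul ((mg.comp measurable_snd).const_mul C)
        rw [lintegral_prod_symm' _ mv]
        refine lintegral_congr fun x => ?_
        have mf : Measurable fun y => f y x := hf.comp measurable_prodMk_right
        simp only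
        rw [lintegral_mul_const _ mf]
    _ ≤ ∫⁻ x, A * (C * ∫⁻ y, g x y ∂ν) ∂ν :=
        lintegral_mono_ae (hA.mono fun x hx => by gcongr)
    _ = A * (C * ∫⁻ x, ∫⁻ y, g x y ∂ν ∂ν) := by
        rw [lintegral_const_mul _ (mg.const_mul C), lintegral_const_mul _ mg]

/-- Integrating a path of three edges from its two ends, the middle edge joining the second pair. -/
lemma lintegral_path_le' (hf : Measurable (Function.uncurry f))
    (hg : Measurable (Function.uncurry g))
    (hh : Measurable (Function.uncurry h)) (hA : ∀ᵐ x ∂ν, ∫⁻ y, f y x ∂ν ≤ A)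
    (hC : ∀ᵐ x ∂ν, ∫⁻ y, h y x ∂ν ≤ C) :
    ∫⁻ z, f z.1.1 z.2.1 * (g z.2.1 z.2.2 * h z.1.2 z.2.2) ∂((ν.prod ν).prod (ν.prod ν)) ≤
      A * (C * ∫⁻ x, ∫⁻ y, g x y ∂ν ∂ν) := by
  have m1 : Measurable fun z : (S × S) × (S × S) => f z.1.1 z.2.1 :=
    hf.comp (by fun_prop : Measurable fun z : (S × S) × (S × S) => (z.1.1, z.2.1))
  have m2 : Measurable fun z : (S × S) × (S × S) => g z.2.1 z.2.2 :=
    hg.comp (by fun_prop : Measurable fun z : (S × S) × (S × S) => (z.2.1, z.2.2))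
  have m3 : Measurable fun z : (S × S) × (S × S) => h z.1.2 z.2.2 :=
    hh.comp (by fun_prop : Measurable fun z : (S × S) × (S × S) => (z.1.2, z.2.2))
  have hA' : ∀ᵐ w ∂(ν.prod ν), ∫⁻ y, f y w.1 ∂ν ≤ A :=
    Measure.quasiMeasurePreserving_fst.ae hA
  have hC' : ∀ᵐ w ∂(ν.prod ν), ∫⁻ y, h y w.2 ∂ν ≤ C :=
    Measure.quasiMeasurePreserving_snd.ae hC
  have hm : Measurable fun z : (S × S) × (S × S) =>
    f z.1.1 z.2.1 * (g z.2.1 z.2.2 * h z.1.2 z.2.2) := m1.mul (m2.mul m3)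
  have hg2 : ∫⁻ x, ∫⁻ y, g x y ∂ν ∂ν = ∫⁻ w, Function.uncurry g w ∂(ν.prod ν) :=
    (lintegral_prod _ hg.aemeasurable).symm
  rw [lintegral_prod_symm' _ hm, hg2, ← lintegral_const_mul _ hg,
    ← lintegral_const_mul _ (hg.const_mul _)]
  refine lintegral_mono_ae ?_
  filter_upwards [hA', hC'] with w h1 h2
  have mf : Measurable fun y => f y w.1 := hf.comp measurable_prodMk_right
  have mh : Measurable fun y => h y w.2 := hh.comp measurable_prodMk_right
  calc ∫⁻ v, f v.1 w.1 * (g w.1 w.2 * h v.2 w.2) ∂(ν.prod ν)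
      = ∫⁻ v, g w.1 w.2 * (f v.1 w.1 * h v.2 w.2) ∂(ν.prod ν) :=
        lintegral_congr fun v => by ring
    _ = g w.1 w.2 * ((∫⁻ y, f y w.1 ∂ν) * ∫⁻ y, h y w.2 ∂ν) := by
        have mv : Measurable fun v : S × S => f v.1 w.1 * h v.2 w.2 :=
          (mf.comp measurable_fst).mul (mh.comp measurable_snd)
        rw [lintegral_const_mul _ mv, lintegral_prod_mul mf.aemeasurable mh.aemeasurable]
    _ ≤ g w.1 w.2 * (A * C) := by gcongr
    _ = _ := by simp only [Function.uncurry]; ring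

/-- Exchanging the labels inside a pair transports a path bound to the other labelings of the path.
-/
lemma measurePreserving_swap_left :
    MeasurePreserving (fun z : (S × S) × (S × S) => ((z.1.2, z.1.1), z.2))
      ((ν.prod ν).prod (ν.prod ν)) ((ν.prod ν).prod (ν.prod ν)) :=
  (Measure.measurePreserving_swap (μ := ν) (ν := ν)).prod (MeasurePreserving.id (ν.prod ν))

lemma measurePreserving_swap_right :
    MeasurePreserving (fun z : (S × S) × (S × S) => (z.1, (z.2.2, z.2.1)))
      ((ν.prod ν).prod (ν.prod ν)) ((ν.prod ν).prod (ν.prod ν)) :=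
  (MeasurePreserving.id (ν.prod ν)).prod (Measure.measurePreserving_swap (μ := ν) (ν := ν))

end paths

/-- `g` is integrable with integral at most `B`. -/
def IntegralLe {S : Type*} [MeasurableSpace S] (κ : Measure S) (g : S → ℝ) (B : ℝ) : Prop :=
  Integrable g κ ∧ ∫ z, g z ∂κ ≤ B

namespace IntegralLe

variable {S : Type*} [MeasurableSpace S] {κ : Measure S} {g g' : S → ℝ} {B B' : ℝ}

lemma add (h : IntegralLe κ g B) (h' : IntegralLe κ g' B') :
    IntegralLe κ (fun z => g z + g' z) (B + B') :=
  ⟨h.1.add h'.1, by rw [integral_add h.1 h'.1]; exact add_le_add h.2 h'.2⟩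

lemma sum {ι : Type*} (s : Finset ι) {g : ι → S → ℝ} {B : ι → ℝ}
    (h : ∀ i ∈ s, IntegralLe κ (g i) (B i)) :
    IntegralLe κ (fun z => ∑ i ∈ s, g i z) (∑ i ∈ s, B i) :=
  ⟨integrable_finsetSum _ fun i hi => (h i hi).1, by
    rw [integral_finsetSum _ fun i hi => (h i hi).1]
    exact Finset.sum_le_sum fun i hi => (h i hi).2⟩

lemma of_lintegral [IsFiniteMeasure κ] (hm : Measurable g) (h0 : ∀ z, 0 ≤ g z)
    (h1 : ∀ z, g z ≤ 1) (hB : 0 ≤ B) (h : ∫⁻ z, ENNReal.ofReal (g z) ∂κ ≤ ENNReal.ofReal B) :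
    IntegralLe κ g B := by
  refine ⟨integrable_of_nonneg_of_le hm h0 h1, ?_⟩
  rw [integral_eq_lintegral_of_nonneg_ae (ae_of_all _ h0) hm.aestronglyMeasurable]
  exact ENNReal.toReal_le_of_le_ofReal hB h

lemma comp (h : IntegralLe κ g B) {e : S → S} (he : MeasurePreserving e κ κ) :
    IntegralLe κ (fun z => g (e z)) B := by
  refine ⟨he.integrable_comp_of_integrable h.1, ?_⟩
  have := integral_map (μ := κ) (f := g) he.measurable.aemeasurable
    (by rw [he.map_eq]; exact h.1.1)
  rw [← this, he.map_eq]
  exact h.2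

lemma congr (h : IntegralLe κ g B) (hg : ∀ z, g z = g' z) : IntegralLe κ g' B := by
  rwa [← funext hg]

end IntegralLe

/-- A symmetric measurable function of two variables with values in `[0, 1]`. -/
structure IsUnitKernel {S : Type*} [MeasurableSpace S] (r : S → S → ℝ) : Prop where
  meas : Measurable (Function.uncurry r)
  nonneg : ∀ x y, 0 ≤ r x y
  le_one : ∀ x y, r x y ≤ 1
  symm : ∀ x y, r x y = r y x

namespace IsUnitKernel

variable {S : Type*} [MeasurableSpace S] {r : S → S → ℝ} {ν : Measure S} [IsFiniteMeasure ν]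

lemma meas_pow (hr : IsUnitKernel r) {T : Type*} [MeasurableSpace T] {u v : T → S}
    (hu : Measurable u) (hv : Measurable v) (j : ℕ) : Measurable fun z => r (u z) (v z) ^ j :=
  (hr.meas.comp (hu.prodMk hv)).pow_const j

lemma integrable_pow (hr : IsUnitKernel r) (j : ℕ) (x : S) : Integrable (fun y => r x y ^ j) ν :=
  integrable_of_nonneg_of_le (hr.meas_pow measurable_const measurable_id j)
    (fun _ => pow_nonneg (hr.nonneg _ _) j) fun _ => pow_le_one₀ (hr.nonneg _ _) (hr.le_one _ _)

lemma lintegral_pow (hr : IsUnitKernel r) (j : ℕ) (x : S) :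
    ∫⁻ y, ENNReal.ofReal (r x y ^ j) ∂ν = ENNReal.ofReal (∫ y, r x y ^ j ∂ν) :=
  (ofReal_integral_eq_lintegral_ofReal (hr.integrable_pow j x)
    (ae_of_all _ fun _ => pow_nonneg (hr.nonneg _ _) j)).symm

lemma integrable_integral_pow (hr : IsUnitKernel r) (j : ℕ) :
    Integrable (fun x => ∫ y, r x y ^ j ∂ν) ν := by
  have h : Integrable (fun z : S × S => r z.1 z.2 ^ j) (ν.prod ν) :=
    integrable_of_nonneg_of_le (hr.meas_pow measurable_fst measurable_snd j)
      (fun _ => pow_nonneg (hr.nonneg _ _) j) fun _ => pow_le_one₀ (hr.nonneg _ _) (hr.le_one _ _)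
  exact h.integral_prod_left

lemma lintegral_lintegral_pow (hr : IsUnitKernel r) (j : ℕ) :
    ∫⁻ x, ∫⁻ y, ENNReal.ofReal (r x y ^ j) ∂ν ∂ν =
      ENNReal.ofReal (∫ x, ∫ y, r x y ^ j ∂ν ∂ν) := by
  simp only [hr.lintegral_pow]
  exact (ofReal_integral_eq_lintegral_ofReal (hr.integrable_integral_pow j)
    (ae_of_all _ fun _ => integral_nonneg fun _ => pow_nonneg (hr.nonneg _ _) j)).symm

variable {K : ℕ → ℝ}

/-- Each end vertex lies on one edge only, so integrating it out costs K p or K s; the middle edge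
is left with its full double integral. -/
lemma integralLe_path (hr : IsUnitKernel r) (hK0 : ∀ j, 0 ≤ K j)
    {p q s : ℕ} (hp : ∀ᵐ x ∂ν, ∫ y, r x y ^ p ∂ν ≤ K p) (hs : ∀ᵐ x ∂ν, ∫ y, r x y ^ s ∂ν ≤ K s) :
    IntegralLe ((ν.prod ν).prod (ν.prod ν))
      (fun z => r z.1.1 z.1.2 ^ p * (r z.1.2 z.2.1 ^ q * r z.2.1 z.2.2 ^ s))
      (K p * (K s * ∫ x, ∫ y, r x y ^ q ∂ν ∂ν)) := by
  have hA0 : 0 ≤ ∫ x, ∫ y, r x y ^ q ∂ν ∂ν :=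
    integral_nonneg fun _ => integral_nonneg fun _ => pow_nonneg (hr.nonneg _ _) q
  have n : ∀ j x y, 0 ≤ r x y ^ j := fun j x y => pow_nonneg (hr.nonneg x y) j
  have l : ∀ j x y, r x y ^ j ≤ 1 := fun j x y => pow_le_one₀ (hr.nonneg x y) (hr.le_one x y)
  have m : ∀ j, Measurable (Function.uncurry fun x y => ENNReal.ofReal (r x y ^ j)) := fun j =>
    (hr.meas_pow measurable_fst measurable_snd j).ennreal_ofReal
  refine IntegralLe.of_lintegral ?_ (fun z => mul_nonneg (n _ _ _) (mul_nonneg (n _ _ _) (n _ _ _)))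
    (fun z => mul_le_one₀ (l _ _ _) (mul_nonneg (n _ _ _) (n _ _ _))
      (mul_le_one₀ (l _ _ _) (n _ _ _) (l _ _ _)))
    (mul_nonneg (hK0 p) (mul_nonneg (hK0 s) hA0)) ?_
  · exact (hr.meas_pow (by fun_prop) (by fun_prop) p).mul
      ((hr.meas_pow (by fun_prop) (by fun_prop) q).mul
        (hr.meas_pow (by fun_prop) (by fun_prop) s))
  · have := lintegral_path_le (ν := ν) (m p) (m q) (m s) (A := ENNReal.ofReal (K p))
      (C := ENNReal.ofReal (K s))
      (hp.mono fun x hx => by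
        simp only [hr.symm _ x]
        rw [hr.lintegral_pow]; exact ENNReal.ofReal_le_ofReal hx)
      (hs.mono fun x hx => by rw [hr.lintegral_pow]; exact ENNReal.ofReal_le_ofReal hx)
    rw [hr.lintegral_lintegral_pow, ← ENNReal.ofReal_mul (hK0 s), ← ENNReal.ofReal_mul (hK0 p)]
      at this
    refine le_trans (le_of_eq (lintegral_congr fun z => ?_)) this
    rw [ENNReal.ofReal_mul (n _ _ _), ENNReal.ofReal_mul (n _ _ _)]

lemma integralLe_path' (hr : IsUnitKernel r) (hK0 : ∀ j, 0 ≤ K j)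
    {p q s : ℕ} (hp : ∀ᵐ x ∂ν, ∫ y, r x y ^ p ∂ν ≤ K p) (hs : ∀ᵐ x ∂ν, ∫ y, r x y ^ s ∂ν ≤ K s) :
    IntegralLe ((ν.prod ν).prod (ν.prod ν))
      (fun z => r z.1.1 z.2.1 ^ p * (r z.2.1 z.2.2 ^ q * r z.1.2 z.2.2 ^ s))
      (K p * (K s * ∫ x, ∫ y, r x y ^ q ∂ν ∂ν)) := by
  have hA0 : 0 ≤ ∫ x, ∫ y, r x y ^ q ∂ν ∂ν :=
    integral_nonneg fun _ => integral_nonneg fun _ => pow_nonneg (hr.nonneg _ _) q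
  have n : ∀ j x y, 0 ≤ r x y ^ j := fun j x y => pow_nonneg (hr.nonneg x y) j
  have l : ∀ j x y, r x y ^ j ≤ 1 := fun j x y => pow_le_one₀ (hr.nonneg x y) (hr.le_one x y)
  have m : ∀ j, Measurable (Function.uncurry fun x y => ENNReal.ofReal (r x y ^ j)) := fun j =>
    (hr.meas_pow measurable_fst measurable_snd j).ennreal_ofReal
  have e : ∀ {j : ℕ}, (∀ᵐ x ∂ν, ∫ y, r x y ^ j ∂ν ≤ K j) →
      ∀ᵐ x ∂ν, ∫⁻ y, ENNReal.ofReal (r y x ^ j) ∂ν ≤ ENNReal.ofReal (K j) := fun h =>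
    h.mono fun x hx => by
      simp only [hr.symm _ x]
      rw [hr.lintegral_pow]; exact ENNReal.ofReal_le_ofReal hx
  refine IntegralLe.of_lintegral ?_ (fun z => mul_nonneg (n _ _ _) (mul_nonneg (n _ _ _) (n _ _ _)))
    (fun z => mul_le_one₀ (l _ _ _) (mul_nonneg (n _ _ _) (n _ _ _))
      (mul_le_one₀ (l _ _ _) (n _ _ _) (l _ _ _)))
    (mul_nonneg (hK0 p) (mul_nonneg (hK0 s) hA0)) ?_
  · exact (hr.meas_pow (by fun_prop) (by fun_prop) p).mul
      ((hr.meas_pow (by fun_prop) (by fun_prop) q).mul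
        (hr.meas_pow (by fun_prop) (by fun_prop) s))
  · have := lintegral_path_le' (ν := ν) (m p) (m q) (m s) (e hp) (e hs)
    rw [hr.lintegral_lintegral_pow, ← ENNReal.ofReal_mul (hK0 s), ← ENNReal.ofReal_mul (hK0 p)]
      at this
    refine le_trans (le_of_eq (lintegral_congr fun z => ?_)) this
    rw [ENNReal.ofReal_mul (n _ _ _), ENNReal.ofReal_mul (n _ _ _)]

end IsUnitKernel

end GaussianIncrementCLT

/-! ### The integrated majorant is negligible. -/

namespace GaussianIncrementCLT

/-- The bound of the integral of the majorant obtained by integrating paths of three edges from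
their ends; `K j` bounds the integrals over an end vertex and `A j` is the double integral. -/
noncomputable def pathSum (d : ℕ) (K A : ℕ → ℝ) : ℝ :=
  4 * (K d * (K d * A 1)) +
    ∑ u ∈ Finset.Ico 1 d, 2 * (K d * (K u * A (d - u)) + K d * (K (d - u) * A u))

/-- The sum of paths dominating the majorant. -/
lemma majorant_le_paths (d : ℕ) {r : Edges ℝ} (h12 : |r.e12| ≤ 1) (h13 : |r.e13| ≤ 1)
    (h14 : |r.e14| ≤ 1) : majorant d r ≤
      (|r.e12| ^ d * (|r.e13| ^ 1 * |r.e34| ^ d) + |r.e12| ^ d * (|r.e14| ^ 1 * |r.e34| ^ d) +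
        (|r.e12| ^ d * (|r.e23| ^ 1 * |r.e34| ^ d) + |r.e12| ^ d * (|r.e24| ^ 1 * |r.e34| ^ d))) +
      ∑ u ∈ Finset.Ico 1 d,
        (|r.e12| ^ d * (|r.e24| ^ (d - u) * |r.e34| ^ u) +
            |r.e13| ^ d * (|r.e34| ^ u * |r.e24| ^ (d - u)) +
          (|r.e12| ^ d * (|r.e23| ^ (d - u) * |r.e34| ^ u) +
            |r.e14| ^ d * (|r.e34| ^ u * |r.e23| ^ (d - u)))) := by
  unfold majorant
  refine add_le_add (le_of_eq (by ring)) (Finset.sum_le_sum fun u hu => ?_)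
  -- Open each four-cycle at vertex 1: its two edges there carry exponents u and d - u, and their
  -- product is at most the sum of the two d-th powers. Each summand has lost one edge and is a path
  -- with an end edge of power d.
  have hu' := Finset.mem_Ico.1 hu
  have e3 := pow_mul_pow_le_add (abs_nonneg _) h12 (abs_nonneg _) h13
    (m := u) (n := d - u) (e := d) (by omega)
  have e4 := pow_mul_pow_le_add (abs_nonneg _) h12 (abs_nonneg _) h14
    (m := u) (n := d - u) (e := d) (by omega)
  calc (|r.e12| * |r.e34|) ^ u * ((|r.e13| * |r.e24|) ^ (d - u) + (|r.e14| * |r.e23|) ^ (d - u))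
      = (|r.e12| ^ u * |r.e13| ^ (d - u)) * (|r.e34| ^ u * |r.e24| ^ (d - u)) +
        (|r.e12| ^ u * |r.e14| ^ (d - u)) * (|r.e34| ^ u * |r.e23| ^ (d - u)) := by
        simp only [mul_pow]; ring
    _ ≤ (|r.e12| ^ d + |r.e13| ^ d) * (|r.e34| ^ u * |r.e24| ^ (d - u)) +
        (|r.e12| ^ d + |r.e14| ^ d) * (|r.e34| ^ u * |r.e23| ^ (d - u)) := by gcongr
    _ = _ := by ring

namespace IsUnitKernel

variable {S : Type*} [MeasurableSpace S] {r : S → S → ℝ} {ν : Measure S} [IsFiniteMeasure ν]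
  {K : ℕ → ℝ} {p q s : ℕ}

lemma integralLe_path13 (hr : IsUnitKernel r) (hK0 : ∀ j, 0 ≤ K j)
    (hp : ∀ᵐ x ∂ν, ∫ y, r x y ^ p ∂ν ≤ K p) (hs : ∀ᵐ x ∂ν, ∫ y, r x y ^ s ∂ν ≤ K s) :
    IntegralLe ((ν.prod ν).prod (ν.prod ν))
      (fun z => r z.1.1 z.1.2 ^ p * (r z.1.1 z.2.1 ^ q * r z.2.1 z.2.2 ^ s))
      (K p * (K s * ∫ x, ∫ y, r x y ^ q ∂ν ∂ν)) :=
  ((hr.integralLe_path hK0 hp hs).comp measurePreserving_swap_left).congr fun z => by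
    simp only [hr.symm z.1.2 z.1.1]

lemma integralLe_path24 (hr : IsUnitKernel r) (hK0 : ∀ j, 0 ≤ K j)
    (hp : ∀ᵐ x ∂ν, ∫ y, r x y ^ p ∂ν ≤ K p) (hs : ∀ᵐ x ∂ν, ∫ y, r x y ^ s ∂ν ≤ K s) :
    IntegralLe ((ν.prod ν).prod (ν.prod ν))
      (fun z => r z.1.1 z.1.2 ^ p * (r z.1.2 z.2.2 ^ q * r z.2.1 z.2.2 ^ s))
      (K p * (K s * ∫ x, ∫ y, r x y ^ q ∂ν ∂ν)) :=
  ((hr.integralLe_path hK0 hp hs).comp measurePreserving_swap_right).congr fun z => by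
    simp only [hr.symm z.2.2 z.2.1]

lemma integralLe_path14 (hr : IsUnitKernel r) (hK0 : ∀ j, 0 ≤ K j)
    (hp : ∀ᵐ x ∂ν, ∫ y, r x y ^ p ∂ν ≤ K p) (hs : ∀ᵐ x ∂ν, ∫ y, r x y ^ s ∂ν ≤ K s) :
    IntegralLe ((ν.prod ν).prod (ν.prod ν))
      (fun z => r z.1.1 z.1.2 ^ p * (r z.1.1 z.2.2 ^ q * r z.2.1 z.2.2 ^ s))
      (K p * (K s * ∫ x, ∫ y, r x y ^ q ∂ν ∂ν)) :=
  ((hr.integralLe_path13 hK0 hp hs).comp measurePreserving_swap_right).congr fun z => by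
    simp only [hr.symm z.2.2 z.2.1]

lemma integralLe_path14' (hr : IsUnitKernel r) (hK0 : ∀ j, 0 ≤ K j)
    (hp : ∀ᵐ x ∂ν, ∫ y, r x y ^ p ∂ν ≤ K p) (hs : ∀ᵐ x ∂ν, ∫ y, r x y ^ s ∂ν ≤ K s) :
    IntegralLe ((ν.prod ν).prod (ν.prod ν))
      (fun z => r z.1.1 z.2.2 ^ p * (r z.2.1 z.2.2 ^ q * r z.1.2 z.2.1 ^ s))
      (K p * (K s * ∫ x, ∫ y, r x y ^ q ∂ν ∂ν)) :=
  ((hr.integralLe_path' hK0 hp hs).comp measurePreserving_swap_right).congr fun z => by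
    simp only [hr.symm z.2.2 z.2.1]

end IsUnitKernel

variable {Ω : Type*} [MeasurableSpace Ω] {P : Measure Ω} {X : ℝ → Ω → ℝ}

lemma IsStdGaussField.isUnitKernel [IsProbabilityMeasure P] (hX : IsStdGaussField X P) :
    IsUnitKernel fun x y => |corr X P x y| where
  meas := hX.measurable_abs_corr measurable_fst measurable_snd
  nonneg _ _ := abs_nonneg _
  le_one := hX.abs_corr_le
  symm x y := by rw [corr_comm]

lemma IsStdGaussField.integral_corrMajorant_le [IsProbabilityMeasure P] (hX : IsStdGaussField X P)
    {ν : Measure ℝ} [IsFiniteMeasure ν] {d : ℕ} {K : ℕ → ℝ} (hd : 1 ≤ d) (hK0 : ∀ j, 0 ≤ K j)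
    (hK : ∀ j, 1 ≤ j → j ≤ d → ∀ᵐ x ∂ν, ∫ y, |corr X P x y| ^ j ∂ν ≤ K j) :
    ∫ z, corrMajorant X P d z ∂((ν.prod ν).prod (ν.prod ν)) ≤
      pathSum d K fun j => ∫ x, ∫ y, |corr X P x y| ^ j ∂ν ∂ν := by
  have hr := hX.isUnitKernel
  have hKd := hK d hd le_rfl
  have htree := ((hr.integralLe_path13 (q := 1) hK0 hKd hKd).add
      (hr.integralLe_path14 (q := 1) hK0 hKd hKd)).add
    ((hr.integralLe_path (q := 1) hK0 hKd hKd).add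
      (hr.integralLe_path24 (q := 1) hK0 hKd hKd))
  have hcyc := IntegralLe.sum (κ := (ν.prod ν).prod (ν.prod ν)) (Finset.Ico 1 d) fun u hu =>
    have hu' := Finset.mem_Ico.1 hu
    have hKu := hK u hu'.1 hu'.2.le
    have hKv := hK (d - u) (by omega) (by omega)
    ((hr.integralLe_path24 (q := d - u) hK0 hKd hKu).add
      (hr.integralLe_path' (q := u) hK0 hKd hKv)).add
    ((hr.integralLe_path (q := d - u) hK0 hKd hKu).add
      (hr.integralLe_path14' (q := u) hK0 hKd hKv))
  have h := htree.add hcyc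
  refine (integral_mono (hX.integrable_corrMajorant d) h.1 fun z => ?_).trans (h.2.trans ?_)
  · exact majorant_le_paths d (hX.abs_corr_le _ _) (hX.abs_corr_le _ _) (hX.abs_corr_le _ _)
  · refine le_of_eq ?_
    unfold pathSum
    congr 1
    · ring
    · exact Finset.sum_congr rfl fun u _ => by ring

/-- Put y = A_d^{1/d}, so that A_j = o(y^j) for 1 ≤ j < d. The cycle terms are A_d times A_u A_{d-u}
= o(y^d) = o(A_d). The remaining terms are A_d² A_1, with A_1 = o(y) and y bounded. -/
lemma isLittleO_pathSum {l : Filter ℝ} {A : ℕ → ℝ → ℝ} (hA : ∀ j h, 0 ≤ A j h) {d : ℕ}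
    (hd : 1 < d) {B : ℝ} (hB : ∀ᶠ h in l, A d h ≤ B)
    (hsmall : ∀ j : ℕ, 1 ≤ j → j < d →
      (fun h => A j h ^ (1 / (j : ℝ))) =o[l] fun h => A d h ^ (1 / (d : ℝ))) (C : ℕ → ℝ) :
    (fun h => pathSum d (fun j => C j * A j h) fun j => A j h) =o[l] fun h => A d h ^ 2 := by
  have hroot : ∀ j : ℕ, 1 ≤ j → ∀ h, (A j h ^ (1 / (j : ℝ))) ^ j = A j h := fun j hj h => by
    rw [one_div, Real.rpow_inv_natCast_pow (hA j h) (by omega)]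
  set y : ℝ → ℝ := fun h => A d h ^ (1 / (d : ℝ)) with hy
  have hj : ∀ j, 1 ≤ j → j < d → (A j) =o[l] fun h => y h ^ j := fun j h1 h2 =>
    ((hsmall j h1 h2).pow (by omega : 0 < j)).congr_left (hroot j h1)
  have hmul : ∀ u ∈ Finset.Ico 1 d, (fun h => A u h * A (d - u) h) =o[l] A d := fun u hu => by
    have hu' := Finset.mem_Ico.1 hu
    refine ((hj u hu'.1 hu'.2).mul (hj (d - u) (by omega) (by omega))).congr_right fun h => ?_
    rw [← pow_add, show u + (d - u) = d by omega]
    exact hroot d hd.le h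
  have hone : (A 1) =o[l] fun _ => (1 : ℝ) := by
    refine (hj 1 le_rfl hd).trans_isBigO ?_
    refine IsBigO.of_bound (B ^ (1 / (d : ℝ))) (hB.mono fun h hh => ?_)
    simp only [pow_one, norm_one, mul_one, hy]
    rw [Real.norm_of_nonneg (Real.rpow_nonneg (hA d h) _)]
    exact Real.rpow_le_rpow (hA d h) hh (by positivity)
  have hdd : (fun h => A d h ^ 2) =O[l] fun h => A d h ^ 2 := isBigO_refl _ _
  have hd1 : (A d) =O[l] (A d) := isBigO_refl _ _
  unfold pathSum
  refine IsLittleO.add ?_ (IsLittleO.fun_sum fun u hu => ?_)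
  · refine ((hdd.mul_isLittleO hone).const_mul_left (4 * (C d * C d))).congr (fun h => by ring)
      fun h => by ring
  · refine ((hd1.mul_isLittleO (hmul u hu)).const_mul_left
      (2 * (C d * C u + C d * C (d - u)))).congr (fun h => by ring) fun h => by ring

end GaussianIncrementCLT

/-! ### Hermite expansion of covariances. -/

namespace GaussianIncrementCLT

lemma abs_integral_mul_le_sqrt {S : Type*} [MeasurableSpace S] {κ : Measure S} {u v : S → ℝ}
    (hu : MemLp u 2 κ) (hv : MemLp v 2 κ) :
    |∫ s, u s * v s ∂κ| ≤ √(∫ s, u s ^ 2 ∂κ) * √(∫ s, v s ^ 2 ∂κ) := by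
  have hi : ∀ {p q : S → ℝ} (hp : MemLp p 2 κ) (hq : MemLp q 2 κ),
      inner ℝ (hp.toLp p) (hq.toLp q) = ∫ s, q s * p s ∂κ := fun hp hq => by
    rw [L2.inner_def]
    refine integral_congr_ae ?_
    filter_upwards [hp.coeFn_toLp, hq.coeFn_toLp] with s h1 h2
    simp [h1, h2]
  have hn : ∀ {p : S → ℝ} (hp : MemLp p 2 κ), ‖hp.toLp p‖ = √(∫ s, p s ^ 2 ∂κ) := fun hp => by
    rw [norm_eq_sqrt_real_inner, hi hp hp]
    simp only [sq]
  rw [← hi hv hu, ← hn hu, ← hn hv, mul_comm]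
  exact abs_real_inner_le_norm _ _

lemma hermiteCoeff_sub_hermiteSum {g : ℝ → ℝ} (hg : MemLp g 2 stdGauss) (M k : ℕ) :
    hermiteCoeff (fun z => g z - hermiteSum g M z) k = if k < M then 0 else hermiteCoeff g k := by
  have i1 : Integrable (fun z => g z * hermiteFun k z) stdGauss :=
    hg.integrable_mul (memLp_hermiteFun k)
  have i2 : ∀ m, Integrable (fun z => hermiteCoeff g m * (hermiteFun m z * hermiteFun k z))
      stdGauss := fun m => ((memLp_hermiteFun m).integrable_mul (memLp_hermiteFun k)).const_mul _
  have e : ∀ z, (g z - hermiteSum g M z) * hermiteFun k z = g z * hermiteFun k z -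
      ∑ m ∈ Finset.range M, hermiteCoeff g m * (hermiteFun m z * hermiteFun k z) := fun z => by
    rw [sub_mul, hermiteSum, Finset.sum_mul]
    congr 1
    exact Finset.sum_congr rfl fun m _ => by ring
  unfold hermiteCoeff
  simp only [e]
  rw [integral_sub i1 (integrable_finsetSum _ fun m _ => i2 m),
    integral_finsetSum _ fun m _ => i2 m]
  simp only [integral_const_mul, integral_hermiteFun_mul, mul_ite, mul_one, mul_zero,
    Finset.sum_ite_eq', Finset.mem_range]
  split_ifs <;> simp [hermiteCoeff]

namespace IsStdGaussField

variable {Ω : Type*} [MeasurableSpace Ω] {P : Measure Ω} {X : ℝ → Ω → ℝ}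
  [IsProbabilityMeasure P] {g : ℝ → ℝ}

lemma integral_hermiteFun_mul_comp (hX : IsStdGaussField X P) (i j : ℕ) (x y : ℝ) :
    ∫ ω, hermiteFun i (X x ω) * hermiteFun j (X y ω) ∂P =
      if i = j then corr X P x y ^ i else 0 := by
  have e : ∀ ω, hermiteFun i (X x ω) * hermiteFun j (X y ω) =
      (√(i.factorial : ℝ))⁻¹ * (√(j.factorial : ℝ))⁻¹ * (He i (X x ω) * He j (X y ω)) := fun ω => by
    rw [hermiteFun_eq, hermiteFun_eq]; ring
  simp only [e]
  rw [integral_const_mul, hX.integral_He_mul_He_comp, pairMoment]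
  split_ifs with h
  · subst h
    have hf : (0 : ℝ) < i.factorial := by exact_mod_cast i.factorial_pos
    rw [← mul_assoc, ← mul_inv, Real.mul_self_sqrt hf.le, inv_mul_cancel₀ hf.ne', one_mul]
  · simp

lemma integral_hermiteSum_mul_comp (hX : IsStdGaussField X P) (g : ℝ → ℝ) (N : ℕ) (x y : ℝ) :
    ∫ ω, hermiteSum g N (X x ω) * hermiteSum g N (X y ω) ∂P =
      ∑ k ∈ Finset.range N, hermiteCoeff g k ^ 2 * corr X P x y ^ k := by
  have hi : ∀ m n, Integrable (fun ω => hermiteCoeff g m * hermiteCoeff g n *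
      (hermiteFun m (X x ω) * hermiteFun n (X y ω))) P := fun m n =>
    ((hX.memLp_comp x (memLp_hermiteFun m)).integrable_mul
      (hX.memLp_comp y (memLp_hermiteFun n))).const_mul _
  have e : ∀ ω, hermiteSum g N (X x ω) * hermiteSum g N (X y ω) =
      ∑ m ∈ Finset.range N, ∑ n ∈ Finset.range N, hermiteCoeff g m * hermiteCoeff g n *
        (hermiteFun m (X x ω) * hermiteFun n (X y ω)) := by
    intro ω
    rw [hermiteSum, hermiteSum, Finset.sum_mul_sum]
    exact Finset.sum_congr rfl fun m _ => Finset.sum_congr rfl fun n _ => by ring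
  simp only [e]
  rw [integral_finsetSum _ fun m _ => integrable_finsetSum _ fun n _ => hi m n]
  refine Finset.sum_congr rfl fun m hm => ?_
  rw [integral_finsetSum _ fun n _ => hi m n]
  simp only [integral_const_mul, hX.integral_hermiteFun_mul_comp, mul_ite, mul_zero,
    Finset.sum_ite_eq, hm, if_true]
  ring

/-- The Hermite expansion of the covariance of a function of the process. -/
lemma tendsto_sum_hermiteCoeff_sq (hX : IsStdGaussField X P) (hg : MemLp g 2 stdGauss) (x y : ℝ) :
    Tendsto (fun N => ∑ k ∈ Finset.range N, hermiteCoeff g k ^ 2 * corr X P x y ^ k) atTop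
      (𝓝 (∫ ω, g (X x ω) * g (X y ω) ∂P)) := by
  set q : ℕ → ℝ := fun N => ∫ z, (g z - hermiteSum g N z) ^ 2 ∂stdGauss with hq
  set Q := ∫ z, g z ^ 2 ∂stdGauss
  have hlim : Tendsto (fun N => 2 * (√(q N) * √Q) + √(q N) * √(q N)) atTop (𝓝 0) := by
    have h0 : Tendsto (fun N => √(q N)) atTop (𝓝 0) := by
      simpa using (tendsto_integral_sub_hermiteSum_sq hg).sqrt
    simpa using ((h0.mul_const (√Q)).const_mul 2).add (h0.mul h0)
  refine tendsto_iff_dist_tendsto_zero.2 (squeeze_zero (fun _ => dist_nonneg) (fun N => ?_) hlim)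
  have hgS : MemLp (fun z => g z - hermiteSum g N z) 2 stdGauss := hg.sub (memLp_hermiteSum g N)
  have nq : ∀ x, ∫ ω, (g (X x ω) - hermiteSum g N (X x ω)) ^ 2 ∂P = q N := fun x =>
    hX.integral_comp x (f := fun z => (g z - hermiteSum g N z) ^ 2) hgS.integrable_sq.1
  have nQ : ∀ x, ∫ ω, g (X x ω) ^ 2 ∂P = Q := fun x =>
    hX.integral_comp x (f := fun z => g z ^ 2) hg.integrable_sq.1
  have b1 := abs_integral_mul_le_sqrt (hX.memLp_comp x hgS) (hX.memLp_comp y hg)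
  have b2 := abs_integral_mul_le_sqrt (hX.memLp_comp x hg) (hX.memLp_comp y hgS)
  have b3 := abs_integral_mul_le_sqrt (hX.memLp_comp x hgS) (hX.memLp_comp y hgS)
  rw [nq, nQ] at b1 b2
  rw [nq, nq] at b3
  have j1 := (hX.memLp_comp x hgS).integrable_mul (hX.memLp_comp y hg)
  have j2 := (hX.memLp_comp x hg).integrable_mul (hX.memLp_comp y hgS)
  have j3 := (hX.memLp_comp x hgS).integrable_mul (hX.memLp_comp y hgS)
  have j4 := (hX.memLp_comp x (memLp_hermiteSum g N)).integrable_mul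
    (hX.memLp_comp y (memLp_hermiteSum g N))
  -- Expand the product around the partial sums; every error term contains a factor g - S_N, so
  -- Cauchy–Schwarz bounds it by its L² norm √(q N).
  have key : ∫ ω, g (X x ω) * g (X y ω) ∂P =
      ∫ ω, hermiteSum g N (X x ω) * hermiteSum g N (X y ω) ∂P +
      (∫ ω, (g (X x ω) - hermiteSum g N (X x ω)) * g (X y ω) ∂P +
      (∫ ω, g (X x ω) * (g (X y ω) - hermiteSum g N (X y ω)) ∂P -
      ∫ ω, (g (X x ω) - hermiteSum g N (X x ω)) * (g (X y ω) - hermiteSum g N (X y ω)) ∂P)) := by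
    have e1 := integral_sub j2 j3
    have e2 := integral_add j1 (j2.sub j3)
    have e3 := integral_add j4 (j1.add (j2.sub j3))
    simp only [Pi.add_apply, Pi.sub_apply, Pi.mul_apply] at e1 e2 e3
    rw [← e1, ← e2, ← e3]
    refine integral_congr_ae (ae_of_all _ fun ω => ?_)
    simp only
    ring
  rw [← hX.integral_hermiteSum_mul_comp, key, dist_comm, Real.dist_eq, add_sub_cancel_left]
  refine (abs_add_le _ _).trans ((add_le_add b1 ((abs_sub _ _).trans (add_le_add b2 b3))).trans ?_)
  linarith

/-- Every surviving term carries |r|^k ≤ |r|^d. The squared coefficients sum to ∫ g² by the same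
expansion at x = y, where the correlation is 1. -/
lemma abs_integral_comp_mul_comp_le (hX : IsStdGaussField X P) (hg : MemLp g 2 stdGauss) {d : ℕ}
    (h0 : ∀ k < d, hermiteCoeff g k = 0) (x y : ℝ) :
    |∫ ω, g (X x ω) * g (X y ω) ∂P| ≤ |corr X P x y| ^ d * ∫ z, g z ^ 2 ∂stdGauss := by
  have hsq := hX.tendsto_sum_hermiteCoeff_sq hg x x
  simp only [hX.corr_self, one_pow, mul_one, ← sq] at hsq
  rw [hX.integral_comp x (f := fun z => g z ^ 2) hg.integrable_sq.1] at hsq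
  refine le_of_tendsto_of_tendsto (hX.tendsto_sum_hermiteCoeff_sq hg x y).abs
    (hsq.const_mul (|corr X P x y| ^ d)) (Eventually.of_forall fun N => ?_)
  simp only
  rw [Finset.mul_sum]
  refine (Finset.abs_sum_le_sum_abs _ _).trans (Finset.sum_le_sum fun k _ => ?_)
  rw [abs_mul, abs_of_nonneg (sq_nonneg (hermiteCoeff g k)), abs_pow, mul_comm]
  rcases lt_or_ge k d with h | h
  · simp [h0 k h]
  · exact mul_le_mul_of_nonneg_right
      (pow_le_pow_of_le_one (abs_nonneg _) (hX.abs_corr_le x y) h) (sq_nonneg _)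

/-- Without odd degrees every term a_k² r^k is nonnegative, so the sum dominates any single term.
Symmetry of f enters the variance bound here. -/
lemma hermiteCoeff_sq_mul_le_integral (hX : IsStdGaussField X P) (hg : MemLp g 2 stdGauss)
    (h0 : ∀ k, Odd k → hermiteCoeff g k = 0) (d : ℕ) (x y : ℝ) :
    hermiteCoeff g d ^ 2 * |corr X P x y| ^ d ≤ ∫ ω, g (X x ω) * g (X y ω) ∂P := by
  have hpos : ∀ k, hermiteCoeff g k ^ 2 * |corr X P x y| ^ k =
      hermiteCoeff g k ^ 2 * corr X P x y ^ k := fun k => by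
    rcases Nat.even_or_odd k with h | h
    · rw [h.pow_abs]
    · simp [h0 k h]
  refine ge_of_tendsto (hX.tendsto_sum_hermiteCoeff_sq hg x y) ?_
  filter_upwards [eventually_gt_atTop d] with N hN
  simp only [← hpos]
  exact Finset.single_le_sum (f := fun k => hermiteCoeff g k ^ 2 * |corr X P x y| ^ k)
    (fun k _ => by positivity) (Finset.mem_range.2 hN)

/-- Removing a partial sum of the Hermite expansion from a function subtracts the covariance. -/
lemma integral_comp_mul_comp_eq_add (hX : IsStdGaussField X P) (hg : MemLp g 2 stdGauss) (M : ℕ)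
    (x y : ℝ) :
    ∫ ω, g (X x ω) * g (X y ω) ∂P =
      ∫ ω, hermiteSum g M (X x ω) * hermiteSum g M (X y ω) ∂P +
      ∫ ω, (g (X x ω) - hermiteSum g M (X x ω)) * (g (X y ω) - hermiteSum g M (X y ω)) ∂P := by
  have hgS : MemLp (fun z => g z - hermiteSum g M z) 2 stdGauss := hg.sub (memLp_hermiteSum g M)
  have h1 := hX.tendsto_sum_hermiteCoeff_sq hg x y
  have h2 := (hX.tendsto_sum_hermiteCoeff_sq hgS x y).const_add
    (∫ ω, hermiteSum g M (X x ω) * hermiteSum g M (X y ω) ∂P)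
  refine tendsto_nhds_unique h1 (h2.congr' ?_)
  filter_upwards [eventually_ge_atTop M] with N hN
  rw [hX.integral_hermiteSum_mul_comp,
    ← Finset.sum_range_add_sum_Ico (fun k => hermiteCoeff g k ^ 2 * corr X P x y ^ k) hN,
    ← Finset.sum_range_add_sum_Ico (fun k => hermiteCoeff (fun z => g z - hermiteSum g M z) k ^ 2 *
      corr X P x y ^ k) hN]
  have z1 : ∑ k ∈ Finset.range M, hermiteCoeff (fun z => g z - hermiteSum g M z) k ^ 2 *
      corr X P x y ^ k = 0 := Finset.sum_eq_zero fun k hk => by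
    rw [hermiteCoeff_sub_hermiteSum hg, if_pos (Finset.mem_range.1 hk)]; simp
  rw [z1, zero_add]
  congr 1
  exact Finset.sum_congr rfl fun k hk => by
    rw [hermiteCoeff_sub_hermiteSum hg, if_neg (Finset.mem_Ico.1 hk).1.not_gt]

end IsStdGaussField

end GaussianIncrementCLT

/-! ### Truncation and the quantitative central limit theorem. -/

namespace GaussianIncrementCLT

lemma norm_cexp_mul_I_sub_le (x y : ℝ) :
    ‖Complex.exp ((x + y : ℝ) * Complex.I) - Complex.exp (x * Complex.I)‖ ≤ |y| := by
  have e : Complex.exp ((x + y : ℝ) * Complex.I) - Complex.exp (x * Complex.I) =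
      Complex.exp (x * Complex.I) * (Complex.exp (Complex.I * y) - 1) := by
    rw [mul_sub, ← Complex.exp_add, mul_one]
    congr 2
    push_cast
    ring
  rw [e, norm_mul, norm_cexp_mul_I, one_mul]
  exact Real.norm_exp_I_mul_ofReal_sub_one_le

lemma abs_exp_neg_sub_exp_neg_le {a b : ℝ} (ha : 0 ≤ a) (hab : a ≤ b) :
    |Real.exp (-a) - Real.exp (-b)| ≤ b - a := by
  rw [abs_of_nonneg (sub_nonneg.2 (Real.exp_le_exp.2 (neg_le_neg hab)))]
  have h1 : Real.exp (-a) ≤ 1 := Real.exp_le_one_iff.2 (by linarith)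
  have h2 : Real.exp (-b) = Real.exp (-a) * Real.exp (-(b - a)) := by
    rw [← Real.exp_add]; congr 1; ring
  have h3 := Real.add_one_le_exp (-(b - a))
  rw [h2]
  nlinarith [Real.exp_pos (-a), sub_nonneg.2 hab]

lemma hermiteSum_succ_eq_hermitePoly {g : ℝ → ℝ} (h0 : hermiteCoeff g 0 = 0) (N : ℕ) :
    hermiteSum g (N + 1) =
      hermitePoly (fun m => hermiteCoeff g (m + 1) / √((m + 1).factorial : ℝ)) N := by
  ext z
  rw [hermiteSum, Finset.sum_range_succ', h0, zero_mul, add_zero, hermitePoly]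
  exact Finset.sum_congr rfl fun m _ => by rw [hermiteFun_eq]; ring

lemma measurable_hermiteSum (g : ℝ → ℝ) (N : ℕ) : Measurable (hermiteSum g N) := by
  unfold hermiteSum
  simp only [hermiteFun_eq]
  fun_prop

namespace IsStdGaussField

variable {Ω : Type*} [MeasurableSpace Ω] {P : Measure Ω} {X : ℝ → Ω → ℝ}
  [IsProbabilityMeasure P] {ν : Measure ℝ} [IsFiniteMeasure ν] {g : ℝ → ℝ}

lemma integral_integral_abs_corr_pow (hX : IsStdGaussField X P) (d : ℕ) :
    Integrable (fun z : ℝ × ℝ => |corr X P z.1 z.2| ^ d) (ν.prod ν) ∧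
    ∫ x, ∫ y, |corr X P x y| ^ d ∂ν ∂ν = ∫ z, |corr X P z.1 z.2| ^ d ∂(ν.prod ν) := by
  have hi : Integrable (fun z : ℝ × ℝ => |corr X P z.1 z.2| ^ d) (ν.prod ν) :=
    integrable_of_nonneg_of_le ((hX.measurable_abs_corr measurable_fst measurable_snd).pow_const d)
      (fun _ => by positivity) fun _ => pow_le_one₀ (abs_nonneg _) (hX.abs_corr_le _ _)
  exact ⟨hi, (integral_prod _ hi).symm⟩

/-- Applied to the remainder of the expansion. With `le_integral_timeInt_sq` it compares the
remainder to the full variance, both on the scale A_d. -/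
lemma integral_timeInt_sq_le (hX : IsStdGaussField X P) (mg : Measurable g)
    (hg : MemLp g 2 stdGauss) {d : ℕ} (h0 : ∀ k < d, hermiteCoeff g k = 0) :
    ∫ ω, timeInt X ν g ω ^ 2 ∂P ≤
      (∫ x, ∫ y, |corr X P x y| ^ d ∂ν ∂ν) * ∫ z, g z ^ 2 ∂stdGauss := by
  have hF := hX.isL2Field_comp mg hg
  obtain ⟨hi, he⟩ := hX.integral_integral_abs_corr_pow (ν := ν) d
  simp only [timeInt]
  rw [hF.integral_integral_sq, he, ← integral_mul_const]
  exact integral_mono hF.integrable_pair.integral_prod_left (hi.mul_const _) fun z =>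
    (le_abs_self _).trans (hX.abs_integral_comp_mul_comp_le hg h0 z.1 z.2)

lemma le_integral_timeInt_sq (hX : IsStdGaussField X P) (mg : Measurable g)
    (hg : MemLp g 2 stdGauss) (h0 : ∀ k, Odd k → hermiteCoeff g k = 0) (d : ℕ) :
    hermiteCoeff g d ^ 2 * (∫ x, ∫ y, |corr X P x y| ^ d ∂ν ∂ν) ≤
      ∫ ω, timeInt X ν g ω ^ 2 ∂P := by
  have hF := hX.isL2Field_comp mg hg
  obtain ⟨hi, he⟩ := hX.integral_integral_abs_corr_pow (ν := ν) d
  simp only [timeInt]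
  rw [hF.integral_integral_sq, he, ← integral_const_mul]
  exact integral_mono (hi.const_mul _) hF.integrable_pair.integral_prod_left fun z =>
    hX.hermiteCoeff_sq_mul_le_integral hg h0 d z.1 z.2

lemma integral_timeInt_sq_eq_add (hX : IsStdGaussField X P) (mg : Measurable g)
    (hg : MemLp g 2 stdGauss) (M : ℕ) :
    ∫ ω, timeInt X ν g ω ^ 2 ∂P = ∫ ω, timeInt X ν (hermiteSum g M) ω ^ 2 ∂P +
      ∫ ω, timeInt X ν (fun z => g z - hermiteSum g M z) ω ^ 2 ∂P := by
  have h1 := hX.isL2Field_comp mg hg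
  have h2 := hX.isL2Field_comp (measurable_hermiteSum g M) (memLp_hermiteSum g M)
  have h3 := hX.isL2Field_comp (mg.sub (measurable_hermiteSum g M))
    (hg.sub (memLp_hermiteSum g M))
  have e3 := h3.integral_integral_sq (κ := ν)
  simp only [Pi.sub_apply] at e3
  have j2 : Integrable (fun z : ℝ × ℝ =>
      ∫ ω, hermiteSum g M (X z.1 ω) * hermiteSum g M (X z.2 ω) ∂P) (ν.prod ν) :=
    h2.integrable_pair.integral_prod_left
  have j3 : Integrable (fun z : ℝ × ℝ => ∫ ω, (g (X z.1 ω) - hermiteSum g M (X z.1 ω)) *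
      (g (X z.2 ω) - hermiteSum g M (X z.2 ω)) ∂P) (ν.prod ν) :=
    h3.integrable_pair.integral_prod_left
  simp only [timeInt]
  rw [h1.integral_integral_sq, h2.integral_integral_sq, e3, ← integral_add j2 j3]
  exact integral_congr_ae (ae_of_all _ fun z => hX.integral_comp_mul_comp_eq_add hg M z.1 z.2)

lemma timeInt_ae_eq_add (hX : IsStdGaussField X P) (hg : MemLp g 2 stdGauss) (M : ℕ) :
    ∀ᵐ ω ∂P, timeInt X ν g ω = timeInt X ν (hermiteSum g M) ω +
      timeInt X ν (fun z => g z - hermiteSum g M z) ω := by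
  filter_upwards [(hX.integrable_comp_prod ν measurable_id
      (hg.integrable one_le_two)).prod_left_ae, (hX.integrable_comp_prod ν measurable_id
      ((memLp_hermiteSum g M).integrable one_le_two)).prod_left_ae] with ω h1 h2
  have h := integral_sub h1 h2
  simp only [timeInt, id] at h ⊢
  rw [h]
  ring

/-- A quantitative central limit theorem for time integrals of functions of the process. -/
lemma exists_norm_charFun_sub_le (P : Measure Ω) [IsProbabilityMeasure P] (mg : Measurable g)
    (hg : MemLp g 2 stdGauss) {d : ℕ} (hd : 1 ≤ d) (h0 : ∀ k < d, hermiteCoeff g k = 0)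
    (hodd : ∀ k, Odd k → hermiteCoeff g k = 0) (hcd : hermiteCoeff g d ≠ 0) (N : ℕ) (t : ℝ) :
    ∃ C : ℝ, ∀ (X : ℝ → Ω → ℝ) (ν : Measure ℝ) [IsFiniteMeasure ν] [NeZero ν],
      IsStdGaussField X P → 0 < ∫ x, ∫ y, |corr X P x y| ^ d ∂ν ∂ν →
      ‖∫ ω, Complex.exp ((t / √(∫ ω, timeInt X ν g ω ^ 2 ∂P) * timeInt X ν g ω : ℝ) *
          Complex.I) ∂P - (Real.exp (-(t ^ 2 / 2)) : ℝ)‖ ≤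
        |t| * √((∫ z, (g z - hermiteSum g (N + 1) z) ^ 2 ∂stdGauss) / hermiteCoeff g d ^ 2) +
        t ^ 2 / 2 * ((∫ z, (g z - hermiteSum g (N + 1) z) ^ 2 ∂stdGauss) / hermiteCoeff g d ^ 2) +
        C * (√(∫ z, corrMajorant X P d z ∂((ν.prod ν).prod (ν.prod ν))) /
          ∫ x, ∫ y, |corr X P x y| ^ d ∂ν ∂ν) := by
  set c : ℕ → ℝ := fun m => hermiteCoeff g (m + 1) / √((m + 1).factorial : ℝ) with hc
  have hc0 : ∀ m, m + 1 < d → c m = 0 := fun m hm => by simp [hc, h0 (m + 1) hm]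
  obtain ⟨C, hC0, hC⟩ := exists_integral_abs_steinKernel_sub_le P c (fun m => c m * (m + 1)) N d
    hc0 fun m hm => by simp [hc0 m hm]
  -- From s² = t² / V and V ≥ a_d² A_d, where V is the second moment of the time integral.
  refine ⟨t ^ 2 * C / hermiteCoeff g d ^ 2, fun X ν _ _ hX hA => ?_⟩
  have hS : hermiteSum g (N + 1) = hermitePoly c N :=
    hermiteSum_succ_eq_hermitePoly (h0 0 (by omega)) N
  have hgS : MemLp (fun z => g z - hermiteSum g (N + 1) z) 2 stdGauss :=
    hg.sub (memLp_hermiteSum g (N + 1))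
  have mgS : Measurable fun z => g z - hermiteSum g (N + 1) z :=
    mg.sub (measurable_hermiteSum g (N + 1))
  have hR2 := hX.integral_timeInt_sq_le (ν := ν) mgS hgS (d := d) fun k hk => by
    rw [hermiteCoeff_sub_hermiteSum hg]; simp [h0 k hk]
  have hV := hX.le_integral_timeInt_sq (ν := ν) mg hg hodd d
  have hVadd := hX.integral_timeInt_sq_eq_add (ν := ν) mg hg (N + 1)
  have hae := hX.timeInt_ae_eq_add (ν := ν) hg (N + 1)
  have hRL := hX.memLp_timeInt (ν := ν) mgS hgS
  have hR1 := integral_abs_le_sqrt hRL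
  have mF : Measurable (timeInt X ν g) := (hX.isL2Field_comp mg hg).measurable_integral
  have mS : Measurable (timeInt X ν (hermiteSum g (N + 1))) :=
    (hX.isL2Field_comp (measurable_hermiteSum g (N + 1))
      (memLp_hermiteSum g (N + 1))).measurable_integral
  have hchar := hX.norm_integral_cexp_sub_le (ν := ν) c N (t / √(∫ ω, timeInt X ν g ω ^ 2 ∂P))
  have hT := hC X ν hX
  rw [← hS] at hchar
  set A := ∫ x, ∫ y, |corr X P x y| ^ d ∂ν ∂ν
  set q := ∫ z, (g z - hermiteSum g (N + 1) z) ^ 2 ∂stdGauss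
  set V := ∫ ω, timeInt X ν g ω ^ 2 ∂P
  set v := ∫ ω, timeInt X ν (hermiteSum g (N + 1)) ω ^ 2 ∂P
  set w := ∫ ω, timeInt X ν (fun z => g z - hermiteSum g (N + 1) z) ω ^ 2 ∂P
  set δ := ∫ ω, |steinKernel X P ν (lowPoly c N) (derivPoly c N) ω -
    ∫ ω, steinKernel X P ν (lowPoly c N) (derivPoly c N) ω ∂P| ∂P
  set D := hermiteCoeff g d ^ 2
  set m := √(∫ z, corrMajorant X P d z ∂((ν.prod ν).prod (ν.prod ν)))
  have hD : 0 < D := by positivity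
  have hDA : 0 < D * A := mul_pos hD hA
  have hVpos : 0 < V := hDA.trans_le hV
  have hv0 : 0 ≤ v := integral_nonneg fun _ => sq_nonneg _
  have hw0 : 0 ≤ w := integral_nonneg fun _ => sq_nonneg _
  have hq0 : 0 ≤ q := integral_nonneg fun _ => sq_nonneg _
  -- The remainder's share of the variance: w ≤ A q and V ≥ D A, so A cancels and the bound does not
  -- depend on the field.
  have hwV : w / V ≤ q / D := by
    rw [div_le_div_iff₀ hVpos hD]
    calc w * D ≤ A * q * D := by gcongr
      _ = q * (D * A) := by ring
      _ ≤ q * V := by gcongr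
  set s := t / √V with hs
  have hs2 : s ^ 2 = t ^ 2 / V := by rw [hs, div_pow, Real.sq_sqrt hVpos.le]
  have b1 : ‖∫ ω, Complex.exp ((s * timeInt X ν g ω : ℝ) * Complex.I) ∂P -
      ∫ ω, Complex.exp ((s * timeInt X ν (hermiteSum g (N + 1)) ω : ℝ) * Complex.I) ∂P‖ ≤
      |t| * √(q / D) := by
    have ie : ∀ {U : Ω → ℝ}, Measurable U →
        Integrable (fun ω => Complex.exp ((s * U ω : ℝ) * Complex.I)) P := fun hU =>
      (integrable_const (1 : ℝ)).mono' (Complex.continuous_exp.measurable.comp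
        ((Complex.measurable_ofReal.comp (hU.const_mul s)).mul_const _)).aestronglyMeasurable
        (ae_of_all _ fun ω => (norm_cexp_mul_I _).le)
    rw [← integral_sub (ie mF) (ie mS)]
    calc ‖∫ ω, (Complex.exp ((s * timeInt X ν g ω : ℝ) * Complex.I) -
            Complex.exp ((s * timeInt X ν (hermiteSum g (N + 1)) ω : ℝ) * Complex.I)) ∂P‖
        ≤ ∫ ω, |s| * |timeInt X ν (fun z => g z - hermiteSum g (N + 1) z) ω| ∂P := by
          refine norm_integral_le_of_norm_le ((hRL.integrable one_le_two).abs.const_mul |s|)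
            (hae.mono fun ω hω => ?_)
          rw [hω, mul_add, ← abs_mul]
          exact norm_cexp_mul_I_sub_le _ _
      _ ≤ |s| * √w := by
          rw [integral_const_mul]
          gcongr
      _ = |t| * √(w / V) := by
          rw [hs, abs_div, abs_of_nonneg (Real.sqrt_nonneg V), Real.sqrt_div hw0]
          ring
      _ ≤ |t| * √(q / D) := by gcongr
  have b2 : s ^ 2 * δ ≤ t ^ 2 * C / D * (m / A) := by
    rw [hs2]
    calc t ^ 2 / V * δ ≤ t ^ 2 / (D * A) * (C * m) := by gcongr
      _ = t ^ 2 * C / D * (m / A) := by field_simp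
  -- The truncated variance is v = V - w by orthogonality, so the two Gaussian exponents differ by
  -- (t² / 2)(w / V).
  have b3 : |Real.exp (-(v * s ^ 2 / 2)) - Real.exp (-(t ^ 2 / 2))| ≤ t ^ 2 / 2 * (q / D) := by
    have e1 : t ^ 2 / 2 - v * s ^ 2 / 2 = t ^ 2 / 2 * (w / V) := by
      rw [hs2]
      field_simp
      rw [hVadd]
      ring
    refine (abs_exp_neg_sub_exp_neg_le (by positivity) ?_).trans ?_
    · have : 0 ≤ t ^ 2 / 2 * (w / V) := by positivity
      linarith
    · rw [e1]
      gcongr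
  calc _ ≤ |t| * √(q / D) + s ^ 2 * δ + t ^ 2 / 2 * (q / D) := by
        refine (norm_sub_le_norm_sub_add_norm_sub _
          (∫ ω, Complex.exp ((s * timeInt X ν (hermiteSum g (N + 1)) ω : ℝ) * Complex.I) ∂P)
          _).trans ?_
        rw [add_assoc]
        refine add_le_add b1 ((norm_sub_le_norm_sub_add_norm_sub _
          ((Real.exp (-(v * s ^ 2 / 2)) : ℝ) : ℂ) _).trans (add_le_add hchar ?_))
        rw [← Complex.ofReal_sub, Complex.norm_real]
        exact b3
    _ ≤ _ := by linarith

end IsStdGaussField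

end GaussianIncrementCLT

/-! ### Symmetry, centering and normalized increments. -/

namespace GaussianIncrementCLT

section symmetry

lemma He_neg (n : ℕ) (x : ℝ) : He n (-x) = (-1) ^ n * He n x := by
  induction n using Nat.strong_induction_on with
  | _ n ih =>
    match n with
    | 0 => simp [He_zero]
    | 1 => simp [He_one]
    | n + 2 =>
      rw [He_succ (n + 1), He_succ (n + 1), ih (n + 1) (by omega), show n + 1 - 1 = n by omega,
        ih n (by omega)]
      ring

lemma integral_comp_neg_stdGauss (u : ℝ → ℝ) : ∫ z, u (-z) ∂stdGauss = ∫ z, u z ∂stdGauss := by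
  have h : stdGauss.map (fun z => -z) = stdGauss := by
    rw [stdGauss, gaussianReal_map_neg, neg_zero]
  have := integral_map_equiv (μ := stdGauss) (MeasurableEquiv.neg ℝ) u
  rw [show (⇑(MeasurableEquiv.neg ℝ)) = fun z : ℝ => -z from rfl, h] at this
  exact this.symm

lemma hermiteCoeff_eq_zero_of_odd {f : ℝ → ℝ} (hf : f.Even) {k : ℕ} (hk : Odd k) :
    hermiteCoeff f k = 0 := by
  have h := integral_comp_neg_stdGauss fun z => f z * hermiteFun k z
  have e : ∀ z, f (-z) * hermiteFun k (-z) = -(f z * hermiteFun k z) := fun z => by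
    rw [hf z, hermiteFun_eq, hermiteFun_eq, He_neg, hk.neg_one_pow]
    ring
  simp only [e, integral_neg] at h
  unfold hermiteCoeff
  linarith

end symmetry

lemma hermiteFun_zero (z : ℝ) : hermiteFun 0 z = 1 := by simp [hermiteFun_eq, He_zero]

/-- Centering a function removes its zeroth Hermite coefficient and keeps the others. -/
lemma exists_centered_version {f : ℝ → ℝ} (hf : MemLp f 2 stdGauss) : ∃ g : ℝ → ℝ,
    Measurable g ∧ MemLp g 2 stdGauss ∧ (∀ᵐ z ∂stdGauss, f z = g z + ∫ z, f z ∂stdGauss) ∧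
    ∀ k, hermiteCoeff g k = if k = 0 then 0 else hermiteCoeff f k := by
  set c := ∫ z, f z ∂stdGauss with hc
  have hfi : Integrable f stdGauss := hf.integrable one_le_two
  -- f is measurable only up to a null set, whereas path functionals need a truly measurable
  -- integrand; so a measurable version is centered.
  have hm : MemLp (hf.1.aemeasurable.mk f) 2 stdGauss :=
    (memLp_congr_ae hf.1.aemeasurable.ae_eq_mk).1 hf
  have hae : ∀ᵐ z ∂stdGauss, hf.1.aemeasurable.mk f z - c = f z - c := by
    filter_upwards [hf.1.aemeasurable.ae_eq_mk] with z hz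
    rw [hz]
  refine ⟨fun z => hf.1.aemeasurable.mk f z - c, hf.1.aemeasurable.measurable_mk.sub_const c,
    hm.sub (memLp_const c), hae.mono fun z hz => by simp only [hz]; ring, fun k => ?_⟩
  have i1 : Integrable (fun z => f z * hermiteFun k z) stdGauss :=
    hf.integrable_mul (memLp_hermiteFun k)
  have i2 : Integrable (fun z => c * (hermiteFun 0 z * hermiteFun k z)) stdGauss :=
    ((memLp_hermiteFun 0).integrable_mul (memLp_hermiteFun k)).const_mul c
  have e : hermiteCoeff (fun z => hf.1.aemeasurable.mk f z - c) k =
      ∫ z, (f z * hermiteFun k z - c * (hermiteFun 0 z * hermiteFun k z)) ∂stdGauss := by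
    refine integral_congr_ae (hae.mono fun z hz => ?_)
    simp only [hz, hermiteFun_zero]
    ring
  rw [e, integral_sub i1 i2, integral_const_mul, integral_hermiteFun_mul]
  split_ifs with h1 h2 h2
  · subst h1
    simp [hermiteFun_zero, hc]
  · exact absurd h1.symm h2
  · exact absurd h2.symm h1
  · simp [hermiteCoeff]

section increments

variable {Ω : Type*} [MeasurableSpace Ω] {P : Measure Ω} {G : ℝ → Ω → ℝ}

/-- The normalized increments of a process. -/
noncomputable def incr (G : ℝ → Ω → ℝ) (P : Measure Ω) (h x : ℝ) (ω : Ω) : ℝ :=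
  (G (x + h) ω - G x ω) / sigma G P h

lemma sigmaSq_nonneg (G : ℝ → Ω → ℝ) (P : Measure Ω) (h : ℝ) : 0 ≤ sigmaSq G P h :=
  integral_nonneg fun _ => sq_nonneg _

lemma sigma_sq (G : ℝ → Ω → ℝ) (P : Measure Ω) (h : ℝ) : sigma G P h ^ 2 = sigmaSq G P h :=
  Real.sq_sqrt (sigmaSq_nonneg G P h)

lemma corr_incr (h x y : ℝ) : corr (incr G P h) P x y = rho G P h x y := by
  unfold corr incr rho
  rw [← integral_div, ← sigma_sq]
  refine integral_congr_ae (ae_of_all _ fun ω => ?_)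
  simp only
  rw [div_mul_div_comm, sq]

lemma measurable_incr (hG : Measurable (Function.uncurry G)) (h : ℝ) :
    Measurable (Function.uncurry (incr G P h)) := by
  have h1 : Measurable fun q : ℝ × Ω => G (q.1 + h) q.2 :=
    hG.comp ((measurable_fst.add_const h).prodMk measurable_snd)
  exact (h1.sub hG).div_const _

lemma isGaussianProcess_incr (hG : IsGaussianProcess G P) (h : ℝ) :
    IsGaussianProcess (incr G P h) P := by
  classical
  exact hG.of_isGaussianProcess fun x => ⟨{x + h, x}, (sigma G P h)⁻¹ •
    (ContinuousLinearMap.proj ⟨x + h, by simp⟩ - ContinuousLinearMap.proj ⟨x, by simp⟩),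
    fun ω => by simp [incr]; ring⟩

lemma isStdGaussField_incr (hGmeas : Measurable (Function.uncurry G))
    (hG : IsGaussianProcess G P) (hmean : ∀ x, ∫ ω, G x ω ∂P = 0)
    (hstat : HasStationaryIncrements G P) {h : ℝ} (hσ : sigmaSq G P h ≠ 0) :
    IsStdGaussField (incr G P h) P where
  meas := measurable_incr hGmeas h
  gauss := isGaussianProcess_incr hG h
  law x := by
    have := hG.isProbabilityMeasure
    have hL := (isGaussianProcess_incr hG h).hasGaussianLaw_eval x
    have hGi : ∀ x, Integrable (G x) P := fun x => (hG.hasGaussianLaw_eval x).integrable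
    have h0 : ∫ ω, incr G P h x ω ∂P = 0 := by
      unfold incr
      rw [integral_div, integral_sub (hGi _) (hGi _), hmean, hmean]
      simp
    have h1 : ∫ ω, incr G P h x ω ^ 2 ∂P = 1 := by
      -- Stationarity with shift x moves the increment over [x, x + h] to [0, h], whose second
      -- moment is σ²(h).
      have hid := (hstat h 0 x).comp (u := fun z : ℝ => z ^ 2) (by fun_prop)
      have hi := hid.integral_eq
      simp only [Function.comp_def, zero_add] at hi
      unfold incr
      simp only [div_pow]
      rw [integral_div, add_comm x h, hi, sigma_sq]
      exact div_self hσ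
    rw [hL.map_eq_gaussianReal, variance_of_integral_eq_zero hL.aemeasurable h0, h0, h1]
    simp

variable {a b : ℝ}

lemma rhoInt_eq (hab : a ≤ b) (j : ℕ) (h : ℝ) : rhoInt G P a b j h =
    ∫ x, ∫ y, |corr (incr G P h) P x y| ^ j ∂(volume.restrict (Set.Ioc a b))
      ∂(volume.restrict (Set.Ioc a b)) := by
  unfold rhoInt
  simp only [intervalIntegral.integral_of_le hab, corr_incr]

lemma rhoInt_nonneg (hab : a ≤ b) (j : ℕ) (h : ℝ) : 0 ≤ rhoInt G P a b j h := by
  rw [rhoInt_eq hab]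
  exact integral_nonneg fun _ => integral_nonneg fun _ => by positivity

lemma rhoInt_le [IsProbabilityMeasure P] (hab : a ≤ b) (j : ℕ) {h : ℝ}
    (hX : IsStdGaussField (incr G P h) P) : rhoInt G P a b j h ≤ (b - a) * (b - a) := by
  rw [rhoInt_eq hab]
  set ν := volume.restrict (Set.Ioc a b)
  have hν : ν.real Set.univ = b - a := by simp [ν, hab]
  have hi : ∀ x, ∫ y, |corr (incr G P h) P x y| ^ j ∂ν ≤ b - a := fun x => by
    calc _ ≤ ∫ _, (1 : ℝ) ∂ν := integral_mono (hX.isUnitKernel.integrable_pow j x)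
          (integrable_const 1) fun y => pow_le_one₀ (abs_nonneg _) (hX.abs_corr_le x y)
      _ = b - a := by simp [hν]
  calc _ ≤ ∫ _, (b - a) ∂ν := integral_mono (hX.isUnitKernel.integrable_integral_pow j)
        (integrable_const _) hi
    _ = _ := by simp [hν]

/-- Division by σ²(h) = 0 makes ρ_h zero, and 0^j = 0 for j ≠ 0. -/
lemma sigmaSq_ne_zero_of_rhoInt_pos {j : ℕ} (hj : j ≠ 0) {h : ℝ}
    (hA : 0 < rhoInt G P a b j h) : sigmaSq G P h ≠ 0 := by
  intro h0
  refine hA.ne' ?_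
  unfold rhoInt rho
  simp [h0, hj]

/-- By `map_comp_prod` a null set of values corresponds to a null set of pairs (time, ω); Fubini
then gives, for almost every ω, agreement at almost every time. -/
lemma functionalI_ae_eq [IsProbabilityMeasure P] {h : ℝ} (hX : IsStdGaussField (incr G P h) P)
    (hab : a ≤ b) {f g : ℝ → ℝ} {c : ℝ} (hg : MemLp g 2 stdGauss)
    (hfg : ∀ᵐ z ∂stdGauss, f z = g z + c) :
    ∀ᵐ ω ∂P, IntervalIntegrable (fun x => f ((G (x + h) ω - G x ω) / sigma G P h)) volume a b ∧
      functionalI G P f a b h ω =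
        timeInt (incr G P h) (volume.restrict (Set.Ioc a b)) g ω + (b - a) * c := by
  set ν := volume.restrict (Set.Ioc a b) with hν
  have h1 : ∀ᵐ q ∂(ν.prod P), f (incr G P h q.1 q.2) = g (incr G P h q.1 q.2) + c := by
    refine ae_of_ae_map (f := fun q : ℝ × Ω => incr G P h q.1 q.2)
      (p := fun z => f z = g z + c) hX.meas.aemeasurable ?_
    rw [show (fun q : ℝ × Ω => incr G P h q.1 q.2) = fun q => incr G P h (id q.1) q.2 from rfl,
      hX.map_comp_prod ν measurable_id]
    exact Measure.ae_smul_measure hfg _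
  have h2 : ∀ᵐ ω ∂P, ∀ᵐ x ∂ν, f (incr G P h x ω) = g (incr G P h x ω) + c := by
    have := Measure.ae_ae_of_ae_prod
      ((Measure.measurePreserving_swap (μ := P) (ν := ν)).quasiMeasurePreserving.ae h1)
    simpa using this
  filter_upwards [h2, (hX.integrable_comp_prod ν measurable_id
    (hg.integrable one_le_two)).prod_left_ae] with ω h3 h4
  simp only [id] at h4
  have h5 : Integrable (fun x => g (incr G P h x ω) + c) ν := h4.add (integrable_const c)
  constructor
  · rw [intervalIntegrable_iff_integrableOn_Ioc_of_le hab]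
    exact h5.congr (h3.mono fun x hx => hx.symm)
  · have hi : ∫ x, (g (incr G P h x ω) + c) ∂ν = timeInt (incr G P h) ν g ω + (b - a) * c := by
      rw [integral_add h4 (integrable_const c)]
      simp [timeInt, hν, hab]
    rw [← hi, functionalI, intervalIntegral.integral_of_le hab]
    exact integral_congr_ae h3

lemma functionalI_of_sigma_eq_zero {f : ℝ → ℝ} {h : ℝ} (hσ : sigma G P h = 0) :
    functionalI G P f a b h = fun _ => (b - a) * f 0 := by
  ext ω
  simp [functionalI, hσ]

end increments

end GaussianIncrementCLT

/-! ### Passage to the limit and conclusion. -/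

namespace GaussianIncrementCLT

/-- Where v vanishes the quotient is 0 by convention. If this happened frequently, every eventual
lower bound would be at most 0; the supremum defining the real liminf is then nonpositive, even over
an empty set. -/
lemma eventually_pos_of_liminf_div_pos {l : Filter ℝ} {u v : ℝ → ℝ} (hv : ∀ h, 0 ≤ v h)
    (hl : 0 < liminf (fun h => u h / v h) l) : ∀ᶠ h in l, 0 < v h := by
  by_contra hcon
  refine hl.not_ge ?_
  rw [liminf_eq]
  refine Real.sSup_nonpos fun x hx => ?_
  obtain ⟨h, h1, h2⟩ := ((not_eventually.1 hcon).and_eventually hx).exists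
  have : v h = 0 := le_antisymm (not_lt.1 h1) (hv h)
  simpa [this] using h2

/-- Lévy's continuity theorem along sequences suffices for a countably generated filter. -/
lemma tendsto_probabilityMeasure_of_charFun {l : Filter ℝ} [l.IsCountablyGenerated]
    {κ : ℝ → ProbabilityMeasure ℝ} {κ₀ : ProbabilityMeasure ℝ}
    (h : ∀ t : ℝ, Tendsto (fun i => charFun (κ i : Measure ℝ) t) l
      (𝓝 (charFun (κ₀ : Measure ℝ) t))) :
    Tendsto κ l (𝓝 κ₀) :=
  tendsto_of_seq_tendsto fun _ hx =>
    ProbabilityMeasure.tendsto_of_tendsto_charFun fun t => (h t).comp hx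

variable {Ω : Type*} [MeasurableSpace Ω] {P : Measure Ω} [IsProbabilityMeasure P]
  {G : ℝ → Ω → ℝ} {a b : ℝ} {f g : ℝ → ℝ} {c : ℝ}

lemma memLp_functionalI {h : ℝ} (hX : IsStdGaussField (incr G P h) P) (hab : a ≤ b)
    (mg : Measurable g) (hg : MemLp g 2 stdGauss) (hfg : ∀ᵐ z ∂stdGauss, f z = g z + c) :
    MemLp (functionalI G P f a b h) 2 P :=
  (memLp_congr_ae ((functionalI_ae_eq hX hab hg hfg).mono fun _ hω => hω.2)).2
    ((hX.memLp_timeInt mg hg).add (memLp_const ((b - a) * c)))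

lemma variance_functionalI {h : ℝ} (hX : IsStdGaussField (incr G P h) P) (hab : a ≤ b)
    (mg : Measurable g) (hg : MemLp g 2 stdGauss) (hfg : ∀ᵐ z ∂stdGauss, f z = g z + c)
    (h0 : hermiteCoeff g 0 = 0) :
    variance (functionalI G P f a b h) P =
      ∫ ω, timeInt (incr G P h) (volume.restrict (Set.Ioc a b)) g ω ^ 2 ∂P := by
  have hL := hX.memLp_timeInt (ν := volume.restrict (Set.Ioc a b)) mg hg
  rw [variance_congr (Y := fun ω => timeInt (incr G P h) (volume.restrict (Set.Ioc a b)) g ω +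
      (b - a) * c) ((functionalI_ae_eq hX hab hg hfg).mono fun _ hω => hω.2),
    variance_add_const hL.1, variance_of_integral_eq_zero hL.1.aemeasurable]
  have hz : ∫ z, g z ∂stdGauss = 0 := by
    simpa [hermiteCoeff, hermiteFun_zero] using h0
  simp only [timeInt]
  rw [(hX.isL2Field_comp mg hg).integral_integral]
  simp only [hX.integral_comp _ hg.1, hz, integral_zero]

lemma tendsto_sqrt_corrMajorant_div (hab : a ≤ b) {d : ℕ} (hd : 1 < d)
    (hX : ∀ᶠ h in 𝓝[>] (0 : ℝ), IsStdGaussField (incr G P h) P)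
    (hpos : ∀ᶠ h in 𝓝[>] (0 : ℝ), 0 < rhoInt G P a b d h)
    (hsup : ∀ j : ℕ, 1 ≤ j → ∃ C : ℝ, ∀ᶠ h in 𝓝[>] (0 : ℝ), ∀ x ∈ Set.Icc a b,
      ∫ y in a..b, |rho G P h x y| ^ j ≤ C * rhoInt G P a b j h)
    (hsmall : ∀ j : ℕ, 1 ≤ j → j < d →
      (fun h : ℝ => (rhoInt G P a b j h) ^ (1 / (j : ℝ))) =o[𝓝[>] (0 : ℝ)]
        (fun h : ℝ => (rhoInt G P a b d h) ^ (1 / (d : ℝ)))) :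
    Tendsto (fun h => √(∫ z, corrMajorant (incr G P h) P d z
        ∂(((volume.restrict (Set.Ioc a b)).prod (volume.restrict (Set.Ioc a b))).prod
          ((volume.restrict (Set.Ioc a b)).prod (volume.restrict (Set.Ioc a b))))) /
      rhoInt G P a b d h) (𝓝[>] (0 : ℝ)) (𝓝 0) := by
  -- Absolute values make the constants nonnegative; the value 0 at j = 0 is a dummy.
  have hC : ∀ j : ℕ, ∃ C : ℝ, 0 ≤ C ∧ (1 ≤ j → ∀ᶠ h in 𝓝[>] (0 : ℝ), ∀ x ∈ Set.Icc a b,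
      ∫ y in a..b, |rho G P h x y| ^ j ≤ C * rhoInt G P a b j h) := by
    intro j
    by_cases hj : 1 ≤ j
    · obtain ⟨C, hC⟩ := hsup j hj
      refine ⟨|C|, abs_nonneg C, fun _ => hC.mono fun h hh x hx => (hh x hx).trans ?_⟩
      exact mul_le_mul_of_nonneg_right (le_abs_self C) (rhoInt_nonneg hab j h)
    · exact ⟨0, le_rfl, fun h => absurd h hj⟩
  choose C hC0 hC using hC
  have hall : ∀ᶠ h in 𝓝[>] (0 : ℝ), ∀ j ∈ Finset.Icc 1 d, ∀ x ∈ Set.Icc a b,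
      ∫ y in a..b, |rho G P h x y| ^ j ≤ C j * rhoInt G P a b j h :=
    (eventually_all_finset _).2 fun j hj => hC j (Finset.mem_Icc.1 hj).1
  have hlit := isLittleO_pathSum (A := fun j h => rhoInt G P a b j h)
    (fun j h => rhoInt_nonneg hab j h) hd (hX.mono fun h hh => rhoInt_le hab d hh) hsmall C
  have hlim := hlit.tendsto_div_nhds_zero.sqrt
  rw [Real.sqrt_zero] at hlim
  refine squeeze_zero' (Eventually.of_forall fun h =>
    div_nonneg (Real.sqrt_nonneg _) (rhoInt_nonneg hab d h)) ?_ hlim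
  filter_upwards [hX, hpos, hall] with h hXh hA hK
  rw [Real.sqrt_div' _ (sq_nonneg _), Real.sqrt_sq hA.le]
  refine div_le_div_of_nonneg_right (Real.sqrt_le_sqrt ?_) hA.le
  have hmaj := hXh.integral_corrMajorant_le (ν := volume.restrict (Set.Ioc a b))
    (K := fun j => C j * rhoInt G P a b j h) hd.le
    (fun j => mul_nonneg (hC0 j) (rhoInt_nonneg hab j h)) fun j h1 h2 => by
      refine (ae_restrict_iff' measurableSet_Ioc).2 (ae_of_all _ fun x hx => ?_)
      have := hK j (Finset.mem_Icc.2 ⟨h1, h2⟩) x (Set.Ioc_subset_Icc_self hx)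
      rw [intervalIntegral.integral_of_le hab] at this
      simpa only [corr_incr] using this
  simpa only [← rhoInt_eq hab] using hmaj

/-- Convergence of the characteristic functions of the normalized time integrals. -/
lemma tendsto_charFun_timeInt (hab : a < b) {d : ℕ} (hd : 1 < d)
    (hX : ∀ᶠ h in 𝓝[>] (0 : ℝ), IsStdGaussField (incr G P h) P)
    (hpos : ∀ᶠ h in 𝓝[>] (0 : ℝ), 0 < rhoInt G P a b d h)
    (hsup : ∀ j : ℕ, 1 ≤ j → ∃ C : ℝ, ∀ᶠ h in 𝓝[>] (0 : ℝ), ∀ x ∈ Set.Icc a b,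
      ∫ y in a..b, |rho G P h x y| ^ j ≤ C * rhoInt G P a b j h)
    (hsmall : ∀ j : ℕ, 1 ≤ j → j < d →
      (fun h : ℝ => (rhoInt G P a b j h) ^ (1 / (j : ℝ))) =o[𝓝[>] (0 : ℝ)]
        (fun h : ℝ => (rhoInt G P a b d h) ^ (1 / (d : ℝ))))
    (mg : Measurable g) (hg : MemLp g 2 stdGauss) (h0 : ∀ k < d, hermiteCoeff g k = 0)
    (hodd : ∀ k, Odd k → hermiteCoeff g k = 0) (hcd : hermiteCoeff g d ≠ 0) (t : ℝ) :
    Tendsto (fun h => ∫ ω, Complex.exp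
        ((t / √(∫ ω, timeInt (incr G P h) (volume.restrict (Set.Ioc a b)) g ω ^ 2 ∂P) *
          timeInt (incr G P h) (volume.restrict (Set.Ioc a b)) g ω : ℝ) * Complex.I) ∂P)
      (𝓝[>] (0 : ℝ)) (𝓝 (Real.exp (-(t ^ 2 / 2)) : ℝ)) := by
  have : NeZero (volume.restrict (Set.Ioc a b)) := ⟨by simp [Measure.restrict_eq_zero, hab]⟩
  have hmaj := tendsto_sqrt_corrMajorant_div hab.le hd hX hpos hsup hsmall
  have hq : Tendsto (fun N => |t| * √((∫ z, (g z - hermiteSum g (N + 1) z) ^ 2 ∂stdGauss) /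
        hermiteCoeff g d ^ 2) + t ^ 2 / 2 * ((∫ z, (g z - hermiteSum g (N + 1) z) ^ 2 ∂stdGauss) /
        hermiteCoeff g d ^ 2)) atTop (𝓝 0) := by
    have h1 := ((tendsto_add_atTop_iff_nat 1).2 (tendsto_integral_sub_hermiteSum_sq hg)).div_const
      (hermiteCoeff g d ^ 2)
    rw [zero_div] at h1
    simpa using (h1.sqrt.const_mul |t|).add (h1.const_mul (t ^ 2 / 2))
  rw [Metric.tendsto_nhds]
  intro ε hε
  -- The truncation level is fixed first, since its error is independent of h; only then does h tend
  -- to 0, with the constant C for this N.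
  obtain ⟨N, hN⟩ := (hq.eventually_lt_const (half_pos hε)).exists
  obtain ⟨C, hC⟩ := IsStdGaussField.exists_norm_charFun_sub_le P mg hg hd.le h0 hodd hcd N t
  have hlim := hmaj.const_mul C
  rw [mul_zero] at hlim
  filter_upwards [hX, hpos, hlim.eventually_lt_const (half_pos hε)] with h hXh hA hs
  rw [rhoInt_eq hab.le] at hA hs
  rw [dist_eq_norm]
  have := hC _ (volume.restrict (Set.Ioc a b)) hXh hA
  linarith

end GaussianIncrementCLT

open GaussianIncrementCLT in
theorem corollary2p1
    {Ω : Type*} [MeasurableSpace Ω] (P : Measure Ω) [IsProbabilityMeasure P]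
    (G : ℝ → Ω → ℝ)
    (hGmeas : Measurable (Function.uncurry G))
    (hGgauss : IsGaussianProcess G P)
    (hGmean : ∀ x : ℝ, ∫ ω, G x ω ∂P = 0)
    (hGstat : HasStationaryIncrements G P)
    (a b : ℝ) (hab : a < b)
    (f : ℝ → ℝ) (hf : MemLp f 2 (gaussianReal 0 1)) (hfsymm : f.Even)
    (k₀ : ℕ) (hk₀ : IsLeast {m : ℕ | 1 ≤ m ∧ hermiteCoeff f (2 * m) ≠ 0} k₀)
    (hsup : ∀ j : ℕ, 1 ≤ j → ∃ C : ℝ, ∀ᶠ h in 𝓝[>] (0 : ℝ), ∀ x ∈ Set.Icc a b,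
      ∫ y in a..b, |rho G P h x y| ^ j ≤ C * rhoInt G P a b j h)
    (hsmall : ∀ j : ℕ, 1 ≤ j → j < 2 * k₀ →
      (fun h : ℝ => (rhoInt G P a b j h) ^ (1 / (j : ℝ))) =o[𝓝[>] (0 : ℝ)]
        (fun h : ℝ => (rhoInt G P a b (2 * k₀) h) ^ (1 / (2 * (k₀ : ℝ)))))
    (hliminf : 0 < liminf
      (fun h : ℝ => rhoInt G P a b (2 * k₀ + 2) h / rhoInt G P a b (2 * k₀) h) (𝓝[>] (0 : ℝ))) :
    (∀ᶠ h in 𝓝[>] (0 : ℝ),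
      (∀ᵐ ω ∂P, IntervalIntegrable
        (fun x => f ((G (x + h) ω - G x ω) / sigma G P h)) volume a b) ∧
      MemLp (functionalI G P f a b h) 2 P ∧
      0 < variance (functionalI G P f a b h) P) ∧
    TendstoInDistribution
      (fun (h : ℝ) (ω : Ω) =>
        (functionalI G P f a b h ω - (b - a) * ∫ z, f z ∂(gaussianReal 0 1)) /
          √(variance (functionalI G P f a b h) P))
      (𝓝[>] (0 : ℝ)) (id : ℝ → ℝ) (fun _ => P) (gaussianReal 0 1) := by
  obtain ⟨⟨hk1, hk2⟩, hmin⟩ := hk₀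
  obtain ⟨g, mg, hg, hfg, hcoeff⟩ := exists_centered_version hf
  have hodd : ∀ k, Odd k → hermiteCoeff g k = 0 := fun k hk => by
    rw [hcoeff, hermiteCoeff_eq_zero_of_odd hfsymm hk, ite_self]
  have h0 : ∀ k < 2 * k₀, hermiteCoeff g k = 0 := fun k hk => by
    rcases Nat.even_or_odd' k with ⟨m, rfl | rfl⟩
    · rw [hcoeff]
      split_ifs with hm
      · rfl
      · by_contra hne
        have := hmin ⟨by omega, hne⟩
        omega
    · exact hodd _ ⟨m, rfl⟩
  have hcd : hermiteCoeff g (2 * k₀) ≠ 0 := by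
    rw [hcoeff, if_neg (by omega)]
    exact hk2
  have h00 : hermiteCoeff g 0 = 0 := h0 0 (by omega)
  -- A positive liminf excludes a vanishing denominator, and this also yields σ(h) ≠ 0.
  have hpos : ∀ᶠ h in 𝓝[>] (0 : ℝ), 0 < rhoInt G P a b (2 * k₀) h :=
    eventually_pos_of_liminf_div_pos (fun h => rhoInt_nonneg hab.le _ h) hliminf
  have hX : ∀ᶠ h in 𝓝[>] (0 : ℝ), IsStdGaussField (incr G P h) P := hpos.mono fun h hh =>
    isStdGaussField_incr hGmeas hGgauss hGmean hGstat
      (sigmaSq_ne_zero_of_rhoInt_pos (by omega) hh)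
  have hsmall' : ∀ j : ℕ, 1 ≤ j → j < 2 * k₀ →
      (fun h : ℝ => (rhoInt G P a b j h) ^ (1 / (j : ℝ))) =o[𝓝[>] (0 : ℝ)]
        (fun h : ℝ => (rhoInt G P a b (2 * k₀) h) ^ (1 / ((2 * k₀ : ℕ) : ℝ))) := by
    simpa only [Nat.cast_mul, Nat.cast_ofNat] using hsmall
  refine ⟨?_, ?_⟩
  · filter_upwards [hX, hpos] with h hXh hA
    refine ⟨(functionalI_ae_eq hXh hab.le hg hfg).mono fun ω hω => hω.1,
      memLp_functionalI hXh hab.le mg hg hfg, ?_⟩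
    rw [variance_functionalI hXh hab.le mg hg hfg h00]
    rw [rhoInt_eq hab.le] at hA
    exact (mul_pos (by positivity) hA).trans_le (hXh.le_integral_timeInt_sq mg hg hodd (2 * k₀))
  -- Convergence in distribution asks for measurability at every h, including those with σ(h) = 0,
  -- where the functional is constant.
  · have hmeas : ∀ h, AEMeasurable (functionalI G P f a b h) P := fun h => by
      by_cases hσ : sigmaSq G P h = 0
      · rw [functionalI_of_sigma_eq_zero (by rw [sigma, hσ, Real.sqrt_zero])]
        exact aemeasurable_const
      · exact (memLp_functionalI (isStdGaussField_incr hGmeas hGgauss hGmean hGstat hσ) hab.le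
          mg hg hfg).1.aemeasurable
    refine ⟨fun h => ((hmeas h).sub_const _).div_const _, aemeasurable_id, ?_⟩
    refine tendsto_probabilityMeasure_of_charFun fun t => ?_
    have hlim := tendsto_charFun_timeInt hab (by omega : 1 < 2 * k₀) hX hpos hsup hsmall' mg hg h0
      hodd hcd t
    have hgauss : charFun ((gaussianReal 0 1).map id) t = ((Real.exp (-(t ^ 2 / 2)) : ℝ) : ℂ) := by
      rw [Measure.map_id, charFun_gaussianReal]
      push_cast
      congr 1
      simp
    simp only [ProbabilityMeasure.coe_mk]
    rw [hgauss]
    refine hlim.congr' ?_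
    filter_upwards [hX] with h hXh
    rw [charFun_apply_real, integral_map (((hmeas h).sub_const _).div_const _) (by fun_prop),
      variance_functionalI hXh hab.le mg hg hfg h00]
    refine integral_congr_ae ((functionalI_ae_eq hXh hab.le hg hfg).mono fun ω hω => ?_)
    simp only [hω.2]
    push_cast
    congr 2
    ring
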